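/- An instance of the Days On Days Off Scheduling Problem (DODOSP) consists of a number of days $D\in\mathbb N$, a number of workers $N\in\mathbb N$, bounds $l_w,u_w,l_o,u_o,U_w,U_o\in\mathbb N$, and request bounds $0\le r_l^d\le r_u^d\le N$ for each day $d\in\{1,\dots,D\}$. All numbers are encoded in binary. A schedule assigns ON or OFF to every pair of a worker and a day. A work period (off period) of a worker is an inclusion-wise maximal nonempty set of consecutive days on which the worker is ON (OFF). The schedule is feasible if on every day $d$ at least $r_l^d$ and at most $r_u^d$ workers are ON, and, for every worker, every work period has length between $l_w$ and $u_w$, every off period has length between $l_o$ and $u_o$, and the total numbers of ON days and of OFF days are at most $U_w$ and $U_o$ respectively. (Periods at the beginning and at the end of the horizon are subject to the same bounds.) The question is whether a feasible schedule exists. For $D\ge 1$ let $G$ be the directed graph whose vertices are $s$, $t$ and all states $(d,\mathrm{SHIFT},a,b)$ (day, shift, position of the day in the current period, number of days worked so far) with $1\le d\le D$, $\mathrm{SHIFT}\in\{\mathrm{ON},\mathrm{OFF}\}$, $1\le a\le d$, $0\le b\le d$, $d-U_o\le b\le U_w$, and $a\le u_w$ if the shift is ON, $a\le u_o$ if it is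 OFF; for $d=1$ only $(1,\mathrm{ON},1,1)$ and $(1,\mathrm{OFF},1,0)$ are admitted. There are edges from $s$ to every state with $d=1$; from every state with $d=D$ and $a\ge l_w$ (shift ON) or $a\ge l_o$ (shift OFF) to $t$; and from $(d,\mathrm{SHIFT},a,b)$ to $(d+1,\mathrm{SHIFT}',a',b')$ whenever $b'=b+1$ if $\mathrm{SHIFT}'=\mathrm{ON}$ and $b'=b$ otherwise, and either $\mathrm{SHIFT}'=\mathrm{SHIFT}$ and $a'=a+1$, or $\mathrm{SHIFT}'\ne\mathrm{SHIFT}$, $a'=1$ and $a\ge l_w$ (if $\mathrm{SHIFT}=\mathrm{ON}$) resp. $a\ge l_o$ (if $\mathrm{SHIFT}=\mathrm{OFF}$). Edges have no capacities. **Proposition.** 1. DODOSP is in NP. 2. Instances whose bounds $l_w,u_w,l_o,u_o,U_w,U_o$ are at most $D$ have encodings of length at most $C\,(D+1)(\lfloor\log_2 N\rfloor+1)$ for an absolute constant $C$ (with $\log_2 0:=0$). In contrast, a schedule written as a table has $ND$ entries, which can be exponential in the length of the encoding: for every $D\ge1$ there is a constant $c$ such that there are feasible instances with $D$ days and arbitrarily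 long encodings for which $2^{L}\le (ND)^c$, where $L$ is the length of the encoding. 3. For $D\ge1$ the graph $G$ has $O(D^3)$ vertices and $O(D^3)$ edges, with absolute constants. 4. For $D\ge1$ an instance is feasible if and only if $G$ has an integral $s$-$t$-flow of value $N$ such that, for every day $d$, the total throughput of the states $(d,\mathrm{ON},a,b)$ lies in $[r_l^d,r_u^d]$. Every such flow takes values in $\{0,\dots,N\}$. 5. DODOSP restricted to instances with $r_l^d=0$ and $r_u^d=N$ for every day $d$ is decidable in polynomial time. For such an instance with $D\ge1$, a feasible schedule exists if and only if $G$ has an integral $s$-$t$-flow of value $N$. -/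

import Mathlib

namespace Dodosp

/-! ### Complexity classes

A decision problem is a predicate `P` on a type `α` of instances, together with an encoding
`ea : α → List Γ` of the instances as strings.  The machine model and its step count are the
multi-stack Turing machines of Mathlib (`Turing.FinTM2`, `Turing.TM2ComputableInPolyTime`). -/

/-- The decision problem `P` is decided in time polynomial in the length of the encoding. -/
def InP {α Γ : Type} (ea : α → List Γ) (P : α → Prop) : Prop :=
  ∃ f : α → Bool,
    Nonempty (Turing.TM2ComputableInPolyTime ea Computability.encodeBool f) ∧
    ∀ a, P a ↔ f a = true

/-- The string presented to a verifier: the encoded instance followed by the certificate,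
written in disjoint alphabets. -/
def encodeWithCertificate {α Γ : Type} (ea : α → List Γ) (x : α × List Bool) :
    List (Γ ⊕ Bool) :=
  (ea x.1).map Sum.inl ++ x.2.map Sum.inr

/-- The decision problem `P` is in NP: there is a polynomial-time verifier `V` such that the
yes-instances are exactly those for which `V` accepts some certificate (a bit string) of
polynomially bounded length. -/
def InNP {α Γ : Type} (ea : α → List Γ) (P : α → Prop) : Prop :=
  ∃ (p : Polynomial ℕ) (V : α × List Bool → Bool),
    Nonempty (Turing.TM2ComputableInPolyTime
      (encodeWithCertificate ea) Computability.encodeBool V) ∧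
    ∀ a, P a ↔ ∃ y : List Bool, y.length ≤ p.eval (ea a).length ∧ V (a, y) = true

/-! ### The Days On Days Off Scheduling Problem -/

/-- An instance: numbers of days `D` and of workers `N`, bounds on the lengths of work periods
(`lw`, `uw`) and off periods (`lo`, `uo`), on the total number of work days (`Uw`) and of days
off (`Uo`) of each worker, and daily request bounds `0 ≤ rl d ≤ ru d ≤ N`.
Day `d = 1, …, D` is the element `d - 1` of `Fin D`. -/
structure Instance where
  D : ℕ
  N : ℕ
  lw : ℕ
  uw : ℕ
  lo : ℕ
  uo : ℕ
  Uw : ℕ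
  Uo : ℕ
  rl : Fin D → ℕ
  ru : Fin D → ℕ
  rl_le_ru : ∀ d, rl d ≤ ru d
  ru_le_N : ∀ d, ru d ≤ N

/-- `S` is a period of the work plan `w` (`true` = ON, `false` = OFF) of type `v`: an
inclusion-wise maximal nonempty set of consecutive days on which the plan has the value `v`. -/
def IsPeriod {D : ℕ} (w : Fin D → Bool) (v : Bool) (S : Finset (Fin D)) : Prop :=
  Maximal (fun T : Finset (Fin D) =>
    T.Nonempty ∧ (T : Set (Fin D)).OrdConnected ∧ ∀ d ∈ T, w d = v) S

/-- The work plan `w` of a single worker respects the local and the global bounds. -/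
def Instance.PlanFeasible (I : Instance) (w : Fin I.D → Bool) : Prop :=
  (∀ S, IsPeriod w true S → I.lw ≤ S.card ∧ S.card ≤ I.uw) ∧
  (∀ S, IsPeriod w false S → I.lo ≤ S.card ∧ S.card ≤ I.uo) ∧
  (Finset.univ.filter fun d => w d = true).card ≤ I.Uw ∧
  (Finset.univ.filter fun d => w d = false).card ≤ I.Uo

/-- The schedule `f` (`f i d = true` iff worker `i` is on duty on day `d`) is feasible. -/
def Instance.ScheduleFeasible (I : Instance) (f : Fin I.N → Fin I.D → Bool) : Prop :=
  (∀ d, I.rl d ≤ (Finset.univ.filter fun i => f i d = true).card ∧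
    (Finset.univ.filter fun i => f i d = true).card ≤ I.ru d) ∧
  ∀ i, I.PlanFeasible (f i)

/-- The question of the problem: does a feasible schedule exist? -/
def Instance.Feasible (I : Instance) : Prop :=
  ∃ f : Fin I.N → Fin I.D → Bool, I.ScheduleFeasible f

/-- Numbers are written in binary, each one followed by the separator `none`. -/
def encodeNats (l : List ℕ) : List (Option Bool) :=
  l.flatMap fun n => (Computability.encodeNat n).map some ++ [none]

/-- The binary encoding of an instance. -/
def Instance.encode (I : Instance) : List (Option Bool) :=
  encodeNats ([I.D, I.N, I.lw, I.uw, I.lo, I.uo, I.Uw, I.Uo] ++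
    (List.finRange I.D).flatMap fun d => [I.rl d, I.ru d])

/-- Instances without requests: `rl d = 0` and `ru d = N` on every day. -/
def Instance.RequestFree (I : Instance) : Prop :=
  ∀ d, I.rl d = 0 ∧ I.ru d = I.N

/-! ### The layered flow network -/

/-- Possible vertices of the network: a source, a sink, and states (day, shift, position of the
day in the current period, number of days worked up to and including the day). -/
inductive Vertex where
  | source : Vertex
  | sink : Vertex
  | state (day : ℕ) (on : Bool) (pos : ℕ) (worked : ℕ) : Vertex
  deriving DecidableEq

/-- The upper bound on the length of a work period (`true`) or an off period (`false`). -/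
def Instance.upper (I : Instance) (on : Bool) : ℕ := if on then I.uw else I.uo

/-- The lower bound on the length of a work period (`true`) or an off period (`false`). -/
def Instance.lower (I : Instance) (on : Bool) : ℕ := if on then I.lw else I.lo

/-- The number of days worked that one day with the given shift contributes. -/
def workOf (on : Bool) : ℕ := if on then 1 else 0

/-- The vertices of the network: source, sink and all states `(d, shift, a, b)` with
`1 ≤ d ≤ D`, `1 ≤ a ≤ min d u` (`u` the upper bound for the shift), `0 ≤ b ≤ d` and
`d - Uo ≤ b ≤ Uw`, where for `d = 1` only `(1, ON, 1, 1)` and `(1, OFF, 1, 0)` are admitted. -/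
def Instance.vertices (I : Instance) : Finset Vertex :=
  {Vertex.source, Vertex.sink} ∪
  ((Finset.Icc 1 I.D ×ˢ (Finset.univ : Finset Bool) ×ˢ
      Finset.Icc 1 I.D ×ˢ Finset.range (I.D + 1)).filter
    fun x : ℕ × Bool × ℕ × ℕ =>
      x.2.2.1 ≤ x.1 ∧ x.2.2.1 ≤ I.upper x.2.1 ∧
      x.2.2.2 ≤ x.1 ∧ x.1 ≤ x.2.2.2 + I.Uo ∧ x.2.2.2 ≤ I.Uw ∧
      (x.1 = 1 → x.2.2.2 = workOf x.2.1)).image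
    fun x => Vertex.state x.1 x.2.1 x.2.2.1 x.2.2.2

/-- The edges of the network: from the source to the states of day `1`, from the states of day
`D` whose last period is long enough to the sink, and from a state to each state of the next day
that either continues the current period or, if the current period is long enough, starts a
period of the other type. -/
def Instance.Edge (I : Instance) : Vertex → Vertex → Prop
  | .source, .state d _ _ _ => d = 1
  | .state d on a _, .sink => d = I.D ∧ I.lower on ≤ a
  | .state d on a b, .state d' on' a' b' =>
      d' = d + 1 ∧ b' = b + workOf on' ∧
      ((on' = on ∧ a' = a + 1) ∨ (on' ≠ on ∧ I.lower on ≤ a ∧ a' = 1))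
  | _, _ => False

open Classical in
/-- The finite set of edges between vertices of the network. -/
noncomputable def Instance.edges (I : Instance) : Finset (Vertex × Vertex) :=
  (I.vertices ×ˢ I.vertices).filter fun e => I.Edge e.1 e.2

/-- `f` is an integral flow (edges are uncapacitated) of value `k` from the source to the sink.
No edge enters the source, so the value is the amount that leaves it. -/
structure Instance.IsFlow (I : Instance) (f : Vertex → Vertex → ℕ) (k : ℕ) : Prop where
  support : ∀ u v, f u v ≠ 0 → (u, v) ∈ I.edges
  conservation : ∀ v ∈ I.vertices, v ≠ .source → v ≠ .sink →
    ∑ u ∈ I.vertices, f u v = ∑ u ∈ I.vertices, f v u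
  value : ∑ v ∈ I.vertices, f .source v = k

/-- `v` is a state of day `d` whose shift is ON. -/
def Vertex.IsOn (d : ℕ) : Vertex → Prop
  | .state d' on _ _ => d' = d ∧ on = true
  | _ => False

open Classical in
/-- The total throughput of all ON states of day `d`. -/
noncomputable def Instance.onThroughput (I : Instance) (f : Vertex → Vertex → ℕ) (d : ℕ) : ℕ :=
  ∑ v ∈ I.vertices.filter (Vertex.IsOn d), ∑ u ∈ I.vertices, f u v

/-- `f` is a flow certificate: an integral flow of value `N` whose throughput through the ON
states of each day lies within the request bounds of that day. -/
def Instance.IsCertificate (I : Instance) (f : Vertex → Vertex → ℕ) : Prop :=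
  I.IsFlow f I.N ∧
  ∀ d : Fin I.D, I.rl d ≤ I.onThroughput f (d + 1) ∧ I.onThroughput f (d + 1) ≤ I.ru d

end Dodosp

/-! The combinatorics rests on the plans of single workers. A plan determines, day by day, the
position in the current period (`runLen`) and the number of days worked (`worked`), so for D ≥ 1 the
feasible plans are exactly the source-sink paths of the network. Workers are interchangeable, hence
a feasible schedule amounts to a vector of multiplicities of feasible plans with total N that meets
the requests (`feasible_iff_exists_isSolution`).

An integral flow of value k is a sum of k such paths. The graph is layered by days: from a positive
value, positive edges can be followed from source to sink and the resulting path subtracted, and a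
flow of value 0 vanishes because there are no cycles (`IsFlow.exists_solution`). This yields both
flow characterisations and the bound N on each edge. The edge count follows from the vertex count,
since every vertex has at most three possible successors.

For membership in NP the number of workers may be exponential, so a certificate lists plans with
binary multiplicities. Few plans suffice: among 4(D+1)² plans there are more subsets than possible
vectors (size, number of plans working on each day), so two distinct subsets A and B agree in all
these numbers. Moving the least multiplicity on A \ B from A to B changes no total and removes a
plan from the support (`IsSolution.exists_smaller`).

Without requests all workers may share one plan. A plan exists if and only if there are counts p, q
of work and off periods with |p - q| ≤ 1 and a division of D into W working days and X free days
such that p periods can fill W days and q periods can fill X days (`exists_localFeasible_iff`).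
These numbers are at most D, and D is below the length of the encoding because each day contributes
two request bounds; exhaustive search is therefore polynomial.

Running times are proved through three levels. Terms (`Tm`) denote functions with values up to the
input length |w|, recursion being iterated at most |w| times. They compile to while-programs
(`Tm.correct`), and these to multi-stack machines in which a register is a position in a copy of the
input (`Exec.runs`). Numbers beyond |w| are never stored: bounds are read truncated at |w|, which
does not affect comparisons with numbers below |w|, and N and the requests are compared digit by
digit with a carry (`eval_carry`). -/

namespace Dodosp

open Turing Function

/-! ### Programs over bounded registers -/

/-- Tests of register programs: a register is positive, or the input symbol at the position given
by a register exists and satisfies a predicate. -/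
inductive Test (Γ : Type) where
  | pos (r : ℕ) : Test Γ
  | read (p : Γ → Bool) (r : ℕ) : Test Γ

/-- The truth value of a test on the input `w` with register contents `e`. -/
def Test.eval {Γ : Type} (w : List Γ) (e : ℕ → ℕ) : Test Γ → Bool
  | .pos r => decide (e r ≠ 0)
  | .read p r => (w[e r]?).any p

/-- The register a test refers to. -/
def Test.reg {Γ : Type} : Test Γ → ℕ
  | .pos r => r
  | .read _ r => r

/-- While-programs over registers that hold numbers up to the length of the input. -/
inductive Prog (Γ : Type) where
  | inc (r : ℕ) : Prog Γ
  | dec (r : ℕ) : Prog Γ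
  | seq (c d : Prog Γ) : Prog Γ
  | ite (b : Test Γ) (c d : Prog Γ) : Prog Γ
  | loop (b : Test Γ) (c : Prog Γ) : Prog Γ

/-- `Exec w c e t e'`: on the input `w` the program `c` transforms the register contents `e`
into `e'` in `t` steps. -/
inductive Exec {Γ : Type} (w : List Γ) : Prog Γ → (ℕ → ℕ) → ℕ → (ℕ → ℕ) → Prop where
  | inc (r e) : Exec w (.inc r) e 1 (update e r (min (e r + 1) w.length))
  | dec (r e) : Exec w (.dec r) e 1 (update e r (e r - 1))
  | seq {c d e t e' t' e''} : Exec w c e t e' → Exec w d e' t' e'' →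
      Exec w (.seq c d) e (t + t') e''
  | ite_true {b c d e t e'} : b.eval w e = true → Exec w c e t e' →
      Exec w (.ite b c d) e (1 + t) e'
  | ite_false {b c d e t e'} : b.eval w e = false → Exec w d e t e' →
      Exec w (.ite b c d) e (1 + t) e'
  | loop_false {b c e} : b.eval w e = false → Exec w (.loop b c) e 1 e
  | loop_true {b c e t e' t' e''} : b.eval w e = true → Exec w c e t e' →
      Exec w (.loop b c) e' t' e'' → Exec w (.loop b c) e (1 + t + t') e''

/-- A strict bound on the registers of a program. -/
def Prog.bound {Γ : Type} : Prog Γ → ℕ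
  | .inc r => r + 1
  | .dec r => r + 1
  | .seq c d => max c.bound d.bound
  | .ite b c d => max (b.reg + 1) (max c.bound d.bound)
  | .loop b c => max (b.reg + 1) c.bound

theorem Exec.le_length {Γ : Type} {w : List Γ} {c : Prog Γ} {e e' : ℕ → ℕ} {t : ℕ}
    (h : Exec w c e t e') (he : ∀ r, e r ≤ w.length) : ∀ r, e' r ≤ w.length := by
  induction h with
  | inc r e =>
    intro i
    by_cases hi : i = r
    · subst hi; simp
    · simpa [hi] using he i
  | dec r e =>
    intro i
    by_cases hi : i = r
    · subst hi; have := he i; simp; omega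
    · simpa [hi] using he i
  | seq _ _ ih₁ ih₂ => exact ih₂ (ih₁ he)
  | ite_true _ _ ih => exact ih he
  | ite_false _ _ ih => exact ih he
  | loop_false _ => exact he
  | loop_true _ _ _ ih₁ ih₂ => exact ih₂ (ih₁ he)

/-! ### Compilation to multi-stack machines -/

/-- The stacks: input, output, an auxiliary stack, and for each register the input to the left and
to the right of the position that the register stores. -/
inductive Stk (m : ℕ) where
  | inp : Stk m
  | out : Stk m
  | tmp : Stk m
  | left (j : Fin m) : Stk m
  | right (j : Fin m) : Stk m
  deriving DecidableEq, Fintype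

/-- The alphabets of the stacks. -/
@[reducible] def Stk.sym (Γ : Type) {m : ℕ} : Stk m → Type
  | .out => Bool
  | _ => Γ

/-- The labels of the code of a program. -/
@[reducible] def Prog.Lab {Γ : Type} : Prog Γ → Type
  | .inc _ => Unit
  | .dec _ => Unit
  | .seq c d => c.Lab ⊕ d.Lab
  | .ite _ c d => Option (c.Lab ⊕ d.Lab)
  | .loop _ c => Option c.Lab

instance Prog.fintypeLab {Γ : Type} : (c : Prog Γ) → Fintype c.Lab
  | .inc _ => inferInstanceAs (Fintype Unit)
  | .dec _ => inferInstanceAs (Fintype Unit)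
  | .seq c d => by
    have := c.fintypeLab
    have := d.fintypeLab
    exact inferInstanceAs (Fintype (c.Lab ⊕ d.Lab))
  | .ite _ c d => by
    have := c.fintypeLab
    have := d.fintypeLab
    exact inferInstanceAs (Fintype (Option (c.Lab ⊕ d.Lab)))
  | .loop _ c => by
    have := c.fintypeLab
    exact inferInstanceAs (Fintype (Option c.Lab))

/-- The label at which the code of a program starts. -/
def Prog.start {Γ : Type} : (c : Prog Γ) → c.Lab
  | .inc _ => ()
  | .dec _ => ()
  | .seq c _ => .inl c.start
  | .ite _ _ _ => none
  | .loop _ _ => none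

section code

variable {Γ Λ : Type} {m : ℕ}

/-- The code of a test. -/
def Test.code (m : ℕ) (b : Test Γ) (l₁ l₂ : Λ) :
    TM2.Stmt (Stk.sym Γ (m := m + 1)) Λ (Option Γ) :=
  match b with
  | .pos r => .peek (.left (Fin.ofNat (m + 1) r)) (fun _ x => x)
      (.branch (fun v => v.isSome) (.load (fun _ => none) (.goto fun _ => l₁))
        (.load (fun _ => none) (.goto fun _ => l₂)))
  | .read p r => .peek (.right (Fin.ofNat (m + 1) r)) (fun _ x => x)
      (.branch (fun v => v.any p) (.load (fun _ => none) (.goto fun _ => l₁))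
        (.load (fun _ => none) (.goto fun _ => l₂)))

/-- The code of a program, with an embedding `emb` of its labels into the labels of the machine and
a label `ex` at which the computation is continued. -/
def Prog.code [Inhabited Γ] (m : ℕ) : (c : Prog Γ) → (emb : c.Lab → Λ) → (ex : Λ) → c.Lab →
    TM2.Stmt (Stk.sym Γ (m := m + 1)) Λ (Option Γ)
  | .inc r, _, ex, _ => .pop (.right (Fin.ofNat (m + 1) r)) (fun _ x => x)
      (.branch (fun v => v.isSome)
        (.push (.left (Fin.ofNat (m + 1) r)) (fun v => v.getD default)
          (.load (fun _ => none) (.goto fun _ => ex)))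
        (.load (fun _ => none) (.goto fun _ => ex)))
  | .dec r, _, ex, _ => .pop (.left (Fin.ofNat (m + 1) r)) (fun _ x => x)
      (.branch (fun v => v.isSome)
        (.push (.right (Fin.ofNat (m + 1) r)) (fun v => v.getD default)
          (.load (fun _ => none) (.goto fun _ => ex)))
        (.load (fun _ => none) (.goto fun _ => ex)))
  | .seq c d, emb, _, .inl l => c.code m (fun l => emb (.inl l)) (emb (.inr d.start)) l
  | .seq _ d, emb, ex, .inr l => d.code m (fun l => emb (.inr l)) ex l
  | .ite b c d, emb, _, none => b.code m (emb (some (.inl c.start))) (emb (some (.inr d.start)))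
  | .ite _ c _, emb, ex, some (.inl l) => c.code m (fun l => emb (some (.inl l))) ex l
  | .ite _ _ d, emb, ex, some (.inr l) => d.code m (fun l => emb (some (.inr l))) ex l
  | .loop b c, emb, ex, none => b.code m (emb (some c.start)) ex
  | .loop _ c, emb, _, some l => c.code m (fun l => emb (some l)) (emb none) l

/-- The stacks that represent the register contents `e` on the input `w`. -/
def zippers (w : List Γ) (e : ℕ → ℕ) : (k : Stk (m + 1)) → List (k.sym Γ)
  | .inp => []
  | .out => []
  | .tmp => []
  | .left j => (w.take (e j)).reverse
  | .right j => w.drop (e j)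

/-- `Runs M t a b`: the machine gets from `a` to `b` in `t` steps. -/
def Runs {K : Type} [DecidableEq K] {G : K → Type} {Λ σ : Type} (M : Λ → TM2.Stmt G Λ σ) (t : ℕ)
    (a b : TM2.Cfg G Λ σ) : Prop :=
  (flip bind (TM2.step M))^[t] (some a) = some b

theorem Runs.trans {K : Type} [DecidableEq K] {G : K → Type} {Λ σ : Type}
    {M : Λ → TM2.Stmt G Λ σ} {t t' : ℕ} {a b c : TM2.Cfg G Λ σ} (h : Runs M t a b)
    (h' : Runs M t' b c) : Runs M (t + t') a c := by
  unfold Runs at *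
  rw [add_comm, Function.iterate_add_apply, h, h']

theorem Runs.single {K : Type} [DecidableEq K] {G : K → Type} {Λ σ : Type}
    {M : Λ → TM2.Stmt G Λ σ} {l : Λ} {v : σ} {S : ∀ k, List (G k)} {b : TM2.Cfg G Λ σ}
    (h : TM2.stepAux (M l) v S = b) : Runs M 1 ⟨some l, v, S⟩ b := by
  unfold Runs
  simp only [Function.iterate_one, flip, Option.bind_eq_bind, Option.bind_some, TM2.step, h]

theorem zippers_update (w : List Γ) (e : ℕ → ℕ) {r : ℕ} (hr : r < m + 1) (x : ℕ) :
    zippers w (update e r x) = update (update (zippers w e) (.left (Fin.ofNat (m + 1) r))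
      (w.take x).reverse) (.right (Fin.ofNat (m + 1) r)) (w.drop x) := by
  have h0 : ∀ j : Fin (m + 1), (j : ℕ) = r ↔ j = Fin.ofNat (m + 1) r := by
    intro j
    rw [Fin.ext_iff]
    simp [Fin.ofNat, Nat.mod_eq_of_lt hr]
  funext k
  cases k with
  | inp => simp [zippers]
  | out => simp [zippers]
  | tmp => simp [zippers]
  | left j =>
    by_cases hj : j = Fin.ofNat (m + 1) r
    · have := (h0 j).2 hj
      subst hj
      rw [update_of_ne (by simp), update_self]
      simp only [zippers]
      rw [this, update_self]
    · have := mt (h0 j).1 hj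
      have h2 : (Stk.left j : Stk (m + 1)) ≠ Stk.left (Fin.ofNat (m + 1) r) := by simpa using hj
      rw [update_of_ne (by simp), update_of_ne h2]
      simp [zippers, this]
  | right j =>
    by_cases hj : j = Fin.ofNat (m + 1) r
    · have := (h0 j).2 hj
      subst hj
      rw [update_self]
      simp only [zippers]
      rw [this, update_self]
    · have := mt (h0 j).1 hj
      have h2 : (Stk.right j : Stk (m + 1)) ≠ Stk.right (Fin.ofNat (m + 1) r) := by simpa using hj
      rw [update_of_ne h2, update_of_ne (by simp)]
      simp [zippers, this]

theorem zippers_left (w : List Γ) (e : ℕ → ℕ) {r : ℕ} (hr : r < m + 1) :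
    zippers w e (.left (Fin.ofNat (m + 1) r)) = (w.take (e r)).reverse := by
  simp [zippers, Fin.ofNat, Nat.mod_eq_of_lt hr]

theorem zippers_right (w : List Γ) (e : ℕ → ℕ) {r : ℕ} (hr : r < m + 1) :
    zippers w e (.right (Fin.ofNat (m + 1) r)) = w.drop (e r) := by
  simp [zippers, Fin.ofNat, Nat.mod_eq_of_lt hr]

/-- The left stack is nonempty exactly when the register is positive, and the top of the right stack
is the symbol at the position stored in the register. Resetting the internal state to `none` makes
consecutive pieces of code composable. -/
theorem Test.stepAux_code (w : List Γ) (e : ℕ → ℕ) (b : Test Γ) (l₁ l₂ : Λ) (hb : b.reg < m + 1)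
    (he : ∀ r, e r ≤ w.length) :
    TM2.stepAux (b.code m l₁ l₂) none (zippers w e) =
      ⟨some (if b.eval w e then l₁ else l₂), none, zippers w e⟩ := by
  cases b with
  | pos r =>
    simp only [Test.reg] at hb
    simp only [Test.code, TM2.stepAux, zippers_left w e hb]
    have : ((w.take (e r)).reverse.head?).isSome = decide (e r ≠ 0) := by
      have := he r
      rcases Nat.eq_zero_or_pos (e r) with h0 | h0
      · simp [h0]
      · have : (w.take (e r)).reverse ≠ [] := by
          intro h
          have := congrArg List.length h
          simp at this
          rcases this with h | h
          · omega
          · subst h; simp at *; omega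
        obtain ⟨x, l, hx⟩ := List.exists_cons_of_ne_nil this
        simp [hx]; omega
    rw [this, Test.eval]
    cases decide (e r ≠ 0) <;> rfl
  | read p r =>
    simp only [Test.reg] at hb
    simp only [Test.code, TM2.stepAux, zippers_right w e hb, Test.eval, List.head?_drop]
    rcases Bool.eq_false_or_eq_true (Option.any p w[e r]?) with h | h <;> simp [h]

/-- Time is preserved exactly: every elementary instruction and every test is one machine step,
while sequencing costs nothing because the exit label of the first program is the start label of the
second. A loop uses its own test as the exit of its body. -/
theorem Exec.runs [Inhabited Γ] {M : Λ → TM2.Stmt (Stk.sym Γ (m := m + 1)) Λ (Option Γ)} {w : List Γ}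
    {c : Prog Γ} {e e' : ℕ → ℕ} {t : ℕ} (h : Exec w c e t e') (he : ∀ r, e r ≤ w.length)
    (hc : c.bound ≤ m + 1) {emb : c.Lab → Λ} {ex : Λ} (hM : ∀ l, M (emb l) = c.code m emb ex l) :
    Runs M t ⟨some (emb c.start), none, zippers w e⟩ ⟨some ex, none, zippers w e'⟩ := by
  induction h generalizing ex with
  | inc r e =>
    apply Runs.single
    rw [hM]
    simp only [Prog.bound] at hc
    simp only [Prog.code, TM2.stepAux, zippers_right w e hc, zippers_update w e hc,
      List.head?_drop, List.tail_drop]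
    rcases Nat.lt_or_ge (e r) w.length with h | h
    · simp only [List.getElem?_eq_getElem h, Option.isSome_some, cond_true, Option.getD_some]
      rw [min_eq_left (by omega)]
      have h5 : (w.take (e r + 1)).reverse = w[e r] :: (w.take (e r)).reverse := by
        rw [List.take_add_one, List.getElem?_eq_getElem h]; simp
      congr 1
      rw [update_comm (by simp), update_of_ne (by simp), zippers_left w e hc, h5]
    -- At the right end of the input the pop finds an empty stack and nothing moves, which matches
    -- the saturation of `inc`.
    · have h2 := he r
      have h3 : e r = w.length := le_antisymm h2 h
      simp only [h3, List.getElem?_length, Option.isSome_none, cond_false]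
      congr 1
      rw [min_eq_right (by omega), update_comm (by simp)]
      simp only [List.take_length, List.drop_length]
      have h4 : zippers w e (.left (Fin.ofNat (m + 1) r)) = w.reverse := by
        rw [zippers_left w e hc, h3, List.take_length]
      rw [show w.drop (w.length + 1) = [] by simp]
      rw [eq_comm, update_eq_self_iff, update_of_ne (by simp), h4]
  | dec r e =>
    apply Runs.single
    rw [hM]
    simp only [Prog.bound] at hc
    simp only [Prog.code, TM2.stepAux, zippers_left w e hc, zippers_update w e hc]
    rcases Nat.eq_zero_or_pos (e r) with h | h
    · have h4 : zippers w e (.right (Fin.ofNat (m + 1) r)) = w := by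
        rw [zippers_right w e hc, h]; rfl
      simp only [h, List.take_zero, List.reverse_nil, List.head?_nil, Option.isSome_none, cond_false,
        List.tail_nil, Nat.zero_sub, List.drop_zero]
      congr 1
      rw [eq_comm, update_eq_self_iff, update_of_ne (by simp), h4]
    · obtain ⟨k, hk⟩ : ∃ k, e r = k + 1 := ⟨e r - 1, by omega⟩
      have hk' : k < w.length := by have := he r; omega
      have h5 : (w.take (k + 1)).reverse = w[k] :: (w.take k).reverse := by
        rw [List.take_add_one, List.getElem?_eq_getElem hk']; simp
      simp only [hk, h5, List.head?_cons, Option.isSome_some, cond_true, Option.getD_some,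
        List.tail_cons, Nat.add_sub_cancel]
      congr 1
      rw [update_of_ne (by simp), zippers_right w e hc, hk]
      congr 1
      exact List.cons_getElem_drop_succ
  | @seq c d e t e' t' e'' h₁ _ ih₁ ih₂ =>
    simp only [Prog.bound, max_le_iff] at hc
    refine (ih₁ he hc.1 (emb := fun l => emb (.inl l)) fun l => ?_).trans
      (ih₂ (h₁.le_length he) hc.2 (emb := fun l => emb (.inr l)) fun l => ?_)
    · rw [hM]; rfl
    · rw [hM]; rfl
  | @ite_true b c d e t e' hb h₁ ih =>
    simp only [Prog.bound, max_le_iff] at hc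
    refine (Runs.single ?_).trans (ih he hc.2.1 (emb := fun l => emb (some (.inl l))) fun l => ?_)
    · rw [hM]
      refine (Test.stepAux_code w e b _ _ hc.1 he).trans ?_
      rw [hb]; rfl
    · rw [hM]; rfl
  | @ite_false b c d e t e' hb h₁ ih =>
    simp only [Prog.bound, max_le_iff] at hc
    refine (Runs.single ?_).trans (ih he hc.2.2 (emb := fun l => emb (some (.inr l))) fun l => ?_)
    · rw [hM]
      refine (Test.stepAux_code w e b _ _ hc.1 he).trans ?_
      rw [hb]; rfl
    · rw [hM]; rfl
  | @loop_false b c e hb =>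
    simp only [Prog.bound, max_le_iff] at hc
    refine Runs.single ?_
    rw [hM]
    refine (Test.stepAux_code w e b _ _ hc.1 he).trans ?_
    rw [hb]; rfl
  | @loop_true b c e t e' t' e'' hb h₁ _ ih₁ ih₂ =>
    have hc' := hc
    simp only [Prog.bound, max_le_iff] at hc
    refine ((Runs.single ?_).trans
      (ih₁ he hc.2 (emb := fun l => emb (some l)) (ex := emb none) fun l => ?_)).trans
      (ih₂ (h₁.le_length he) hc' hM)
    · rw [hM]
      refine (Test.stepAux_code w e b _ _ hc.1 he).trans ?_
      rw [hb]; rfl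
    · rw [hM]; rfl

end code

end Dodosp


namespace Dodosp

open Turing Function

/-! ### The complete machine -/

section machine

variable {Γ : Type} {m : ℕ}

/-- The labels of the machine: two phases that copy the input to the registers, the code of the
program, reading the result, and clearing the stacks. -/
inductive MachineLabel (L : Type) where
  | reverse : MachineLabel L
  | distribute : MachineLabel L
  | main (l : L) : MachineLabel L
  | result : MachineLabel L
  | clean (b : Bool) : MachineLabel L
  deriving Fintype

/-- Contents of all stacks. -/
def contents (i : List Γ) (o : List Bool) (t : List Γ) (l r : Fin m → List Γ) :
    (k : Stk m) → List (k.sym Γ)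
  | .inp => i
  | .out => o
  | .tmp => t
  | .left j => l j
  | .right j => r j

/-- Push the symbol in the internal state on the right stacks of the given registers. -/
def pushAll [Inhabited Γ] {Λ : Type} (q : TM2.Stmt (Stk.sym Γ (m := m)) Λ (Option Γ)) :
    List (Fin m) → TM2.Stmt (Stk.sym Γ (m := m)) Λ (Option Γ)
  | [] => q
  | j :: js => .push (.right j) (fun v => v.getD default) (pushAll q js)

/-- Pop the stacks of the given registers, and keep a popped symbol in the internal state. -/
def popAll {Λ : Type} (q : TM2.Stmt (Stk.sym Γ (m := m)) Λ (Option Γ)) :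
    List (Fin m) → TM2.Stmt (Stk.sym Γ (m := m)) Λ (Option Γ)
  | [] => q
  | j :: js => .pop (.left j) (fun v x => v.or x) (.pop (.right j) (fun v x => v.or x)
      (popAll q js))

variable {i : List Γ} {o : List Bool} {t : List Γ} {l r : Fin m → List Γ}

theorem contents_update_inp (x : List Γ) :
    update (contents i o t l r) .inp x = contents x o t l r := by
  funext k; cases k <;> simp [contents]

theorem contents_update_out (x : List Bool) :
    update (contents i o t l r) .out x = contents i x t l r := by
  funext k; cases k <;> simp [contents]

theorem contents_update_tmp (x : List Γ) :
    update (contents i o t l r) .tmp x = contents i o x l r := by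
  funext k; cases k <;> simp [contents]

theorem contents_update_left (j : Fin m) (x : List Γ) :
    update (contents i o t l r) (.left j) x = contents i o t (update l j x) r := by
  funext k
  cases k with
  | left j' =>
    by_cases h : j' = j
    · subst h; simp [contents]
    · rw [update_of_ne (by simpa using h)]; simp [contents, h]
  | _ => simp [contents]

theorem contents_update_right (j : Fin m) (x : List Γ) :
    update (contents i o t l r) (.right j) x = contents i o t l (update r j x) := by
  funext k
  cases k with
  | right j' =>
    by_cases h : j' = j
    · subst h; simp [contents]
    · rw [update_of_ne (by simpa using h)]; simp [contents, h]
  | _ => simp [contents]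

theorem stepAux_pushAll [Inhabited Γ] {Λ : Type}
    (q : TM2.Stmt (Stk.sym Γ (m := m)) Λ (Option Γ)) (x : Γ) (js : List (Fin m)) (hjs : js.Nodup) :
    TM2.stepAux (pushAll q js) (some x) (contents i o t l r) =
      TM2.stepAux q (some x) (contents i o t l fun j => if j ∈ js then x :: r j else r j) := by
  induction js generalizing r with
  | nil => simp [pushAll]
  | cons j js ih =>
    rw [List.nodup_cons] at hjs
    simp only [pushAll, TM2.stepAux, Option.getD_some, contents_update_right]
    rw [ih hjs.2]
    congr 2
    funext j'
    by_cases h : j' = j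
    · subst h; simp [hjs.1, contents]
    · simp [h]

/-- The internal state stays `none` only if every popped stack was already empty; this is how the
cleaning loop detects that it is done. -/
theorem stepAux_popAll {Λ : Type} (q : TM2.Stmt (Stk.sym Γ (m := m)) Λ (Option Γ))
    (js : List (Fin m)) (hjs : js.Nodup) (v : Option Γ) :
    ∃ v' : Option Γ, (v' = none ↔ v = none ∧ ∀ j ∈ js, l j = [] ∧ r j = []) ∧
      TM2.stepAux (popAll q js) v (contents i o t l r) =
      TM2.stepAux q v' (contents i o t (fun j => if j ∈ js then (l j).tail else l j)
        fun j => if j ∈ js then (r j).tail else r j) := by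
  induction js generalizing l r v with
  | nil => exact ⟨v, by simp, by simp [popAll]⟩
  | cons j js ih =>
    rw [List.nodup_cons] at hjs
    simp only [popAll, TM2.stepAux, contents_update_left, contents_update_right]
    obtain ⟨v', h₁, h₂⟩ := ih hjs.2 (l := update l j (l j).tail) (r := update r j (r j).tail)
      ((v.or (l j).head?).or (r j).head?)
    refine ⟨v', ?_, ?_⟩
    · rw [h₁]
      have : ∀ j' ∈ js, j' ≠ j := fun j' h h' => hjs.1 (h' ▸ h)
      simp only [Option.or_eq_none_iff, List.head?_eq_none_iff, List.mem_cons, forall_eq_or_imp]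
      constructor
      · rintro ⟨⟨⟨h1, h2⟩, h3⟩, h4⟩
        refine ⟨h1, ⟨h2, h3⟩, fun a ha => ?_⟩
        simpa [this a ha] using h4 a ha
      · rintro ⟨h1, ⟨h2, h3⟩, h4⟩
        refine ⟨⟨⟨h1, h2⟩, h3⟩, fun a ha => ?_⟩
        simpa [this a ha] using h4 a ha
    · refine Eq.trans ?_ (h₂.trans ?_)
      · rfl
      · congr 2
        · funext j'
          by_cases h : j' = j
          · subst h; simp [hjs.1]
          · simp [h]
        · funext j'
          by_cases h : j' = j
          · subst h; simp [hjs.1]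
          · simp [h]

/-- The code of the machine that copies the input to all registers, executes `c`, and outputs
whether the register `0` is positive. -/
def machineCode [Inhabited Γ] (m : ℕ) (c : Prog Γ) : MachineLabel c.Lab →
    TM2.Stmt (Stk.sym Γ (m := m + 1)) (MachineLabel c.Lab) (Option Γ)
  | .reverse => .pop .inp (fun _ x => x) (.branch (fun v => v.isSome)
      (.push .tmp (fun v => v.getD default) (.load (fun _ => none) (.goto fun _ => .reverse)))
      (.load (fun _ => none) (.goto fun _ => .distribute)))
  | .distribute => .pop .tmp (fun _ x => x) (.branch (fun v => v.isSome)
      (pushAll (.load (fun _ => none) (.goto fun _ => .distribute)) (List.finRange (m + 1)))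
      (.load (fun _ => none) (.goto fun _ => .main c.start)))
  | .main l => c.code m .main .result l
  | .result => (Test.pos 0).code m (.clean true) (.clean false)
  | .clean b => popAll (.branch (fun v => v.isSome)
      (.load (fun _ => none) (.goto fun _ => .clean b))
      (.load (fun _ => none) (.push .out (fun _ => b) .halt))) (List.finRange (m + 1))

/-- The detour over `tmp` reverses the input, so that pushing it symbol by symbol onto the right
stacks restores the order. All registers then represent 0. -/
theorem runs_reverse [Inhabited Γ] (c : Prog Γ) (i t : List Γ) :
    Runs (machineCode m c) (i.length + 1)
      ⟨some .reverse, none, contents i [] t (fun _ => []) fun _ => []⟩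
      ⟨some .distribute, none, contents [] [] (i.reverse ++ t) (fun _ => []) fun _ => []⟩ := by
  induction i generalizing t with
  | nil =>
    refine Runs.single ?_
    simp only [machineCode, TM2.stepAux, contents_update_inp]
    simp [contents]
  | cons a i ih =>
    rw [List.length_cons, add_comm (i.length + 1) 1]
    refine Runs.trans (Runs.single (b := ⟨some .reverse, none,
      contents i [] (a :: t) (fun _ => []) fun _ => []⟩) ?_) ?_
    · simp only [machineCode, TM2.stepAux, contents_update_inp, contents_update_tmp]
      simp [contents]
    · simpa using ih (a :: t)

theorem runs_distribute [Inhabited Γ] (c : Prog Γ) (t r : List Γ) :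
    Runs (machineCode m c) (t.length + 1)
      ⟨some .distribute, none, contents [] [] t (fun _ => []) fun _ => r⟩
      ⟨some (.main c.start), none, contents [] [] [] (fun _ => []) fun _ => t.reverse ++ r⟩ := by
  induction t generalizing r with
  | nil =>
    refine Runs.single ?_
    simp only [machineCode, TM2.stepAux, contents_update_tmp]
    simp [contents]
  | cons a t ih =>
    rw [List.length_cons, add_comm (t.length + 1) 1]
    refine Runs.trans (Runs.single (b := ⟨some .distribute, none,
      contents [] [] t (fun _ => []) fun _ => a :: r⟩) ?_) ?_
    · simp only [machineCode, TM2.stepAux, contents_update_tmp]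
      simp only [contents, List.head?_cons, Option.isSome_some, cond_true, List.tail_cons]
      rw [stepAux_pushAll _ _ _ (List.nodup_finRange _)]
      simp
    · simpa using ih (a :: r)

/-- The halting configuration must have every stack but the output empty. One symbol per stack
disappears in each step, so the longest stack determines the time. -/
theorem runs_clean [Inhabited Γ] (c : Prog Γ) (b : Bool) (B : ℕ) (l r : Fin (m + 1) → List Γ)
    (hl : ∀ j, (l j).length ≤ B) (hr : ∀ j, (r j).length ≤ B) :
    ∃ s ≤ B + 1, Runs (machineCode m c) s ⟨some (.clean b), none, contents [] [] [] l r⟩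
      ⟨none, none, contents [] [b] [] (fun _ => []) fun _ => []⟩ := by
  induction B generalizing l r with
  | zero =>
    refine ⟨1, le_rfl, Runs.single ?_⟩
    obtain ⟨v', h₁, h₂⟩ := stepAux_popAll (i := []) (o := []) (t := []) (l := l) (r := r)
      (.branch (fun v => v.isSome)
      (.load (fun _ => none) (.goto fun _ => MachineLabel.clean (L := c.Lab) b))
      (.load (fun _ => none) (.push .out (fun _ => b) .halt))) _ (List.nodup_finRange _) none
    have hl' : ∀ j, l j = [] := fun j => List.length_eq_zero_iff.1 (Nat.le_zero.1 (hl j))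
    have hr' : ∀ j, r j = [] := fun j => List.length_eq_zero_iff.1 (Nat.le_zero.1 (hr j))
    rw [h₁.2 ⟨rfl, fun j _ => ⟨hl' j, hr' j⟩⟩] at h₂
    refine h₂.trans ?_
    simp only [TM2.stepAux, contents_update_out]
    simp [contents, hl', hr']
  | succ B ih =>
    obtain ⟨v', h₁, h₂⟩ := stepAux_popAll (i := []) (o := []) (t := []) (l := l) (r := r)
      (.branch (fun v => v.isSome)
      (.load (fun _ => none) (.goto fun _ => MachineLabel.clean (L := c.Lab) b))
      (.load (fun _ => none) (.push .out (fun _ => b) .halt))) _ (List.nodup_finRange _) none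
    rcases v' with _ | a
    · refine ⟨1, by omega, Runs.single (h₂.trans ?_)⟩
      have h₃ := (h₁.1 rfl).2
      simp only [List.mem_finRange, true_implies] at h₃
      simp only [TM2.stepAux, contents_update_out]
      simp [contents, h₃]
    · obtain ⟨s, hs, h₃⟩ := ih (fun j => (l j).tail) (fun j => (r j).tail)
        (fun j => by rw [List.length_tail]; have := hl j; omega)
        (fun j => by rw [List.length_tail]; have := hr j; omega)
      refine ⟨1 + s, by omega, (Runs.single (h₂.trans ?_)).trans h₃⟩
      simp [TM2.stepAux]

/-- The machine that executes a program. -/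
@[reducible] def machine [Inhabited Γ] [Fintype Γ] (c : Prog Γ) : FinTM2 where
  K := Stk (c.bound + 1)
  k₀ := .inp
  k₁ := .out
  Γ := Stk.sym Γ
  Λ := MachineLabel c.Lab
  main := .reverse
  σ := Option Γ
  initialState := none
  Γk₀Fin := inferInstanceAs (Fintype Γ)
  m := machineCode c.bound c

theorem zippers_eq_contents (w : List Γ) (e : ℕ → ℕ) : zippers (m := m) w e =
    contents [] [] [] (fun j => (w.take (e j)).reverse) fun j => w.drop (e j) := by
  funext k; cases k <;> rfl

theorem initList_machine [Inhabited Γ] [Fintype Γ] (c : Prog Γ) (w : List Γ) :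
    initList (machine c) w =
      ⟨some .reverse, none, contents w [] [] (fun _ => []) fun _ => []⟩ := by
  unfold initList
  congr 1
  funext k
  cases k <;> rfl

theorem haltList_machine [Inhabited Γ] [Fintype Γ] (c : Prog Γ) (o : List Bool) :
    haltList (machine c) o =
      ⟨none, none, contents [] o [] (fun _ => []) fun _ => []⟩ := by
  unfold haltList
  congr 1
  funext k
  cases k <;> rfl

theorem runs_machine [Inhabited Γ] (c : Prog Γ) {w : List Γ} {t : ℕ} {e' : ℕ → ℕ} {b : Bool}
    (he : Exec w c (fun _ => 0) t e') (hf : b = decide (e' 0 ≠ 0)) :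
    ∃ s ≤ t + 3 * w.length + 4, Runs (machineCode c.bound c) s
        ⟨some .reverse, none, contents w [] [] (fun _ => []) fun _ => []⟩
        ⟨none, none, contents [] [b] [] (fun _ => []) fun _ => []⟩ := by
  have h₁ := runs_reverse (m := c.bound) c w []
  have h₂ := runs_distribute (m := c.bound) c w.reverse []
  have h₃ := he.runs (m := c.bound) (M := machineCode c.bound c) (by simp) (by omega)
    (emb := .main) (ex := .result) (fun l => rfl)
  have hle := he.le_length (by simp)
  have h₄ : Runs (machineCode c.bound c) 1 ⟨some .result, none, zippers w e'⟩
      ⟨some (.clean (b)), none, zippers w e'⟩ := by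
    refine Runs.single ?_
    refine (Test.stepAux_code w e' (.pos 0) _ _ (by simp [Test.reg]) hle).trans ?_
    rw [Test.eval, hf]
    cases decide (e' 0 ≠ 0) <;> rfl
  obtain ⟨s, hs, h₅⟩ := runs_clean (m := c.bound) c (b) w.length
    (fun j => (w.take (e' j)).reverse) (fun j => w.drop (e' j))
    (fun j => by simp) (fun j => by simp)
  simp only [zippers_eq_contents] at h₃ h₄
  simp only [List.append_nil, List.reverse_reverse, List.take_zero, List.reverse_nil,
    List.drop_zero, List.length_reverse] at h₁ h₂ h₃
  -- Reversing, distributing and cleaning take at most |w| + 1 steps each and reading the result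
  -- takes one, which explains 3|w| + 4.
  refine ⟨_, ?_, (((h₁.trans h₂).trans h₃).trans h₄).trans h₅⟩
  omega

theorem computableInPolyTime_of_prog [Inhabited Γ] [Fintype Γ] {α : Type} (enc : α → List Γ)
    (f : α → Bool) (c : Prog Γ) (P : Polynomial ℕ)
    (h : ∀ a, ∃ t ≤ P.eval (enc a).length, ∃ e', Exec (enc a) c (fun _ => 0) t e' ∧
      f a = decide (e' 0 ≠ 0)) :
    Nonempty (TM2ComputableInPolyTime enc Computability.encodeBool f) := by
  obtain ⟨Q, hQ⟩ : ∃ Q : Polynomial ℕ, ∀ n, Q.eval n = P.eval n + 3 * n + 4 :=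
    ⟨P + 3 * .X + 4, fun n => by simp⟩
  have key : ∀ a, ∃ s ≤ Q.eval (enc a).length,
      (flip bind (machine c).step)^[s] (some (initList (machine c) (enc a))) =
        some (haltList (machine c) [f a]) := by
    intro a
    obtain ⟨t, ht, e', he, hf⟩ := h a
    obtain ⟨s, hs, hr⟩ := runs_machine c he hf
    refine ⟨s, ?_, ?_⟩
    · rw [hQ]
      omega
    · rw [initList_machine, haltList_machine]
      exact hr
  choose s hs hr using key
  have hin : ∀ a, List.map (Equiv.refl Γ).invFun (enc a) = enc a := fun a => List.map_id _
  refine ⟨⟨⟨machine c, Equiv.refl Γ, Equiv.refl Bool⟩, Q, fun a => ⟨⟨s a, ?_⟩, hs a⟩⟩⟩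
  have h₁ := hr a
  rw [← hin a] at h₁
  exact h₁

end machine

end Dodosp


namespace Dodosp

open Function

/-! ### Total correctness of programs -/

/-- From `e` the program `c` terminates within `T` steps with register contents satisfying `Q`. -/
def Ensures {Γ : Type} (w : List Γ) (c : Prog Γ) (e : ℕ → ℕ) (T : ℕ) (Q : (ℕ → ℕ) → Prop) : Prop :=
  ∃ t ≤ T, ∃ e', Exec w c e t e' ∧ Q e'

namespace Ensures

variable {Γ : Type} {w : List Γ} {c d : Prog Γ} {e : ℕ → ℕ} {T T' : ℕ} {Q Q' : (ℕ → ℕ) → Prop}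

theorem imp (h : Ensures w c e T Q) (hT : T ≤ T') (hQ : ∀ e', Q e' → Q' e') :
    Ensures w c e T' Q' := by
  obtain ⟨t, ht, e', h₁, h₂⟩ := h
  exact ⟨t, ht.trans hT, e', h₁, hQ e' h₂⟩

theorem seq (he : ∀ r, e r ≤ w.length) (h : Ensures w c e T Q)
    (h' : ∀ e', (∀ r, e' r ≤ w.length) → Q e' → Ensures w d e' T' Q') :
    Ensures w (.seq c d) e (T + T') Q' := by
  obtain ⟨t, ht, e', h₁, h₂⟩ := h
  obtain ⟨t', ht', e'', h₃, h₄⟩ := h' e' (h₁.le_length he) h₂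
  exact ⟨t + t', by omega, e'', .seq h₁ h₃, h₄⟩

theorem ite {b : Test Γ} (h : b.eval w e = true → Ensures w c e T Q)
    (h' : b.eval w e = false → Ensures w d e T Q) : Ensures w (.ite b c d) e (1 + T) Q := by
  rcases Bool.eq_false_or_eq_true (b.eval w e) with hb | hb
  · obtain ⟨t, ht, e', h₁, h₂⟩ := h hb
    exact ⟨1 + t, by omega, e', .ite_true hb h₁, h₂⟩
  · obtain ⟨t, ht, e', h₁, h₂⟩ := h' hb
    exact ⟨1 + t, by omega, e', .ite_false hb h₁, h₂⟩

/-- The invariant is indexed by the number of iterations still to come, so it proves termination and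
the time bound together with correctness. -/
theorem loop {b : Test Γ} (I : ℕ → (ℕ → ℕ) → Prop)
    (h0 : ∀ e, I 0 e → b.eval w e = false)
    (h1 : ∀ j e, (∀ r, e r ≤ w.length) → I (j + 1) e → b.eval w e = true ∧ Ensures w c e T (I j))
    (j : ℕ) (he : ∀ r, e r ≤ w.length) (hj : I j e) :
    Ensures w (.loop b c) e (j * (T + 1) + 1) (I 0) := by
  induction j generalizing e with
  | zero => exact ⟨1, by omega, e, .loop_false (h0 e hj), hj⟩
  | succ j ih =>
    obtain ⟨hb, t, ht, e', h₁, h₂⟩ := h1 j e he hj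
    obtain ⟨t', ht', e'', h₃, h₄⟩ := ih (h₁.le_length he) h₂
    refine ⟨1 + t + t', ?_, e'', .loop_true hb h₁ h₃, h₄⟩
    rw [Nat.add_mul]
    omega

theorem inc (r : ℕ) (hQ : Q (update e r (min (e r + 1) w.length))) : Ensures w (.inc r) e 1 Q :=
  ⟨1, le_rfl, _, .inc r e, hQ⟩

theorem dec (r : ℕ) (hQ : Q (update e r (e r - 1))) : Ensures w (.dec r) e 1 Q :=
  ⟨1, le_rfl, _, .dec r e, hQ⟩

end Ensures

namespace Prog

variable {Γ : Type} {w : List Γ} {e : ℕ → ℕ}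

/-- Set a register to zero. -/
def clear (r : ℕ) : Prog Γ := .loop (.pos r) (.dec r)

/-- Add the register `a` to the register `b`, and set `a` to zero. -/
def drain (a b : ℕ) : Prog Γ := .loop (.pos a) (.seq (.dec a) (.inc b))

/-- Add the register `a` to the registers `b` and `b'`, and set `a` to zero. -/
def drain₂ (a b b' : ℕ) : Prog Γ :=
  .loop (.pos a) (.seq (.dec a) (.seq (.inc b) (.inc b')))

/-- Copy the register `a` to the register `b`, with the help of the register `tmp`. -/
def copy (a b tmp : ℕ) : Prog Γ :=
  .seq (clear b) (.seq (clear tmp) (.seq (drain₂ a b tmp) (drain tmp a)))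

theorem ensures_clear (r : ℕ) (he : ∀ r, e r ≤ w.length) :
    Ensures w (clear r) e (2 * w.length + 1) fun e' => e' r = 0 ∧ ∀ i ≠ r, e' i = e i := by
  have := Ensures.loop (w := w) (b := .pos r) (c := .dec r) (T := 1)
    (fun j e' => e' r = j ∧ ∀ i ≠ r, e' i = e i)
    (fun e' h => by simp [Test.eval, h.1])
    (fun j e' _ h => ⟨by simp [Test.eval, h.1], .dec r ⟨by simp [h.1], fun i hi => by
      simp [hi, h.2 i hi]⟩⟩)
    (e r) he ⟨rfl, fun _ _ => rfl⟩
  exact this.imp (by have := he r; omega) fun _ h => h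

/-- The hypothesis on the sum of the two registers excludes saturation of `b`. -/
theorem ensures_drain {a b : ℕ} (hab : a ≠ b) (he : ∀ r, e r ≤ w.length)
    (hs : e a + e b ≤ w.length) :
    Ensures w (drain a b) e (3 * w.length + 1) fun e' =>
      e' b = e a + e b ∧ e' a = 0 ∧ ∀ i, i ≠ a → i ≠ b → e' i = e i := by
  have := Ensures.loop (w := w) (b := .pos a) (c := .seq (.dec a) (.inc b)) (T := 1 + 1)
    (fun j e' => j ≤ e a ∧ e' a = j ∧ e' b = (e a - j) + e b ∧ ∀ i, i ≠ a → i ≠ b → e' i = e i)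
    (fun e' h => by simp [Test.eval, h.2.1])
    (fun j e' he' h => ⟨by simp [Test.eval, h.2.1], by
      refine Ensures.seq he' (.dec a rfl) fun e₁ _ h₁ => .inc b ?_
      subst h₁
      obtain ⟨h1, h2, h3, h4⟩ := h
      refine ⟨by omega, by simp [hab, h2], ?_, fun i hi hi' => by simp [hi, hi', h4 i hi hi']⟩
      simp only [update_self, update_of_ne hab.symm, h3]
      omega⟩)
    (e a) he ⟨le_rfl, rfl, by simp, fun _ _ _ => rfl⟩
  refine this.imp (by have := he a; omega) fun _ h => ⟨by rw [h.2.2.1, Nat.sub_zero], h.2.1, h.2.2.2⟩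

theorem ensures_drain₂ {a b b' : ℕ} (hab : a ≠ b) (hab' : a ≠ b') (hbb : b ≠ b')
    (he : ∀ r, e r ≤ w.length) (hb : e b = 0) (hb' : e b' = 0) :
    Ensures w (drain₂ a b b') e (4 * w.length + 1) fun e' =>
      e' b = e a ∧ e' b' = e a ∧ e' a = 0 ∧ ∀ i, i ≠ a → i ≠ b → i ≠ b' → e' i = e i := by
  have := Ensures.loop (w := w) (b := .pos a) (c := .seq (.dec a) (.seq (.inc b) (.inc b')))
    (T := 1 + (1 + 1))
    (fun j e' => j ≤ e a ∧ e' a = j ∧ e' b = e a - j ∧ e' b' = e a - j ∧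
      ∀ i, i ≠ a → i ≠ b → i ≠ b' → e' i = e i)
    (fun e' h => by simp [Test.eval, h.2.1])
    (fun j e' he' h => ⟨by simp [Test.eval, h.2.1], by
      refine Ensures.seq he' (.dec a rfl) fun e₁ he₁ h₁ =>
        Ensures.seq he₁ (.inc b rfl) fun e₂ _ h₂ => .inc b' ?_
      subst h₁ h₂
      obtain ⟨h1, h2, h3, h4, h5⟩ := h
      have := he a
      refine ⟨by omega, by simp [hab, hab', h2], ?_, ?_,
        fun i hi hi' hi'' => by simp [hi, hi', hi'', h5 i hi hi' hi'']⟩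
      · simp only [update_self, update_of_ne hab.symm, update_of_ne hbb, h3]
        omega
      · simp only [update_self, update_of_ne hab'.symm, update_of_ne hbb.symm, h4]
        omega⟩)
    (e a) he ⟨le_rfl, rfl, by simp [hb], by simp [hb'], fun _ _ _ _ => rfl⟩
  refine this.imp (by have := he a; omega) fun _ h =>
    ⟨by rw [h.2.2.1, Nat.sub_zero], by rw [h.2.2.2.1, Nat.sub_zero], h.2.1, h.2.2.2.2⟩

theorem ensures_copy {a b tmp : ℕ} (hab : a ≠ b) (hat : a ≠ tmp) (hbt : b ≠ tmp)
    (he : ∀ r, e r ≤ w.length) :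
    Ensures w (copy a b tmp) e (11 * w.length + 4) fun e' =>
      e' b = e a ∧ ∀ i, i ≠ b → i ≠ tmp → e' i = e i := by
  refine Ensures.imp (T := (2 * w.length + 1) + ((2 * w.length + 1) + ((4 * w.length + 1) +
    (3 * w.length + 1)))) (Q := fun e' => e' b = e a ∧ ∀ i, i ≠ b → i ≠ tmp → e' i = e i)
    ?_ (by omega) fun _ h => h
  refine (ensures_clear b he).seq he fun e₁ he₁ h₁ => ?_
  refine (ensures_clear tmp he₁).seq he₁ fun e₂ he₂ h₂ => ?_
  have hb : e₂ b = 0 := by rw [h₂.2 b hbt, h₁.1]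
  have ha : e₂ a = e a := by rw [h₂.2 a hat, h₁.2 a hab]
  refine (ensures_drain₂ hab hat hbt he₂ hb h₂.1).seq he₂ fun e₃ he₃ h₃ => ?_
  obtain ⟨h3, h4, h5, h6⟩ := h₃
  refine (ensures_drain hat.symm he₃ (by rw [h5]; have := he₃ tmp; omega)).imp le_rfl ?_
  rintro e₄ ⟨h7, h8, h9⟩
  refine ⟨by rw [h9 b hbt hab.symm, h3, ha], fun i hi hi' => ?_⟩
  by_cases hia : i = a
  · subst hia
    rw [h7, h4, h5, ha, add_zero]
  · rw [h9 i hi' hia, h6 i hia hi hi', h₂.2 i hi', h₁.2 i hi]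

end Prog

/-! ### Terms for bounded primitive recursive functions -/

/-- Terms with `k` free variables, for functions of `k` numbers and an input string. -/
inductive Tm (Γ : Type) : ℕ → Type where
  | var {k : ℕ} (i : Fin k) : Tm Γ k
  | zero {k : ℕ} : Tm Γ k
  | top {k : ℕ} : Tm Γ k
  | succ {k : ℕ} (t : Tm Γ k) : Tm Γ k
  | pred {k : ℕ} (t : Tm Γ k) : Tm Γ k
  | read {k : ℕ} (p : Γ → Bool) (t : Tm Γ k) : Tm Γ k
  | ite {k : ℕ} (t u v : Tm Γ k) : Tm Γ k
  | recN {k : ℕ} (count init : Tm Γ k) (body : Tm Γ (k + 2)) : Tm Γ k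
  | comp {k m : ℕ} (f : Tm Γ m) (g : Fin m → Tm Γ k) : Tm Γ k

/-- The value of a term on the input `w`. All values are at most `w.length`; in particular `succ`
saturates. In the body of `recN` the variables `0` and `1` are the accumulator and the index. -/
def Tm.eval {Γ : Type} (w : List Γ) : {k : ℕ} → Tm Γ k → (Fin k → ℕ) → ℕ
  | _, .var i, v => v i
  | _, .zero, _ => 0
  | _, .top, _ => w.length
  | _, .succ t, v => min (t.eval w v + 1) w.length
  | _, .pred t, v => t.eval w v - 1
  | _, .read p t, v => ((w[t.eval w v]?).any p).toNat
  | _, .ite t u u', v => cond (t.eval w v == 0) (u'.eval w v) (u.eval w v)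
  | _, .recN count init body, v => Nat.rec (init.eval w v)
      (fun i acc => body.eval w (Matrix.vecCons acc (Matrix.vecCons i v))) (count.eval w v)
  | _, .comp f g, v => f.eval w fun i => (g i).eval w v

namespace Tm

variable {Γ : Type}

/-- Execute a list of programs one after the other. -/
def seqList (skip : Prog Γ) : List (Prog Γ) → Prog Γ
  | [] => skip
  | c :: cs => .seq c (seqList skip cs)

/-- A program that evaluates a term: the variables are read from the registers `ctx`, the result is
stored in the register `s`, and the registers below `s` are not changed. -/
def compile : {k : ℕ} → Tm Γ k → (Fin k → ℕ) → ℕ → Prog Γ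
  | _, .var i, ctx, s => .copy (ctx i) s (s + 1)
  | _, .zero, _, s => .clear s
  | _, .top, _, s => .seq (.clear s) (.loop (.read (fun _ => true) s) (.inc s))
  | _, .succ t, ctx, s => .seq (t.compile ctx s) (.inc s)
  | _, .pred t, ctx, s => .seq (t.compile ctx s) (.dec s)
  | _, .read p t, ctx, s => .seq (t.compile ctx s)
      (.ite (.read p s) (.seq (.clear s) (.inc s)) (.clear s))
  | _, .ite t u u', ctx, s => .seq (t.compile ctx s)
      (.ite (.pos s) (u.compile ctx s) (u'.compile ctx s))
  | _, .recN count init body, ctx, s => .seq (init.compile ctx s) (.seq (count.compile ctx (s + 1))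
      (.seq (.clear (s + 2)) (.loop (.pos (s + 1)) (.seq (.dec (s + 1))
        (.seq (body.compile (Matrix.vecCons s (Matrix.vecCons (s + 2) ctx)) (s + 3))
          (.seq (.clear s) (.seq (.drain (s + 3) s) (.inc (s + 2)))))))))
  | _, @Tm.comp _ _ m f g, ctx, s =>
      .seq (seqList (.clear s) ((List.finRange m).map fun i => (g i).compile ctx (s + 1 + i)))
        (.seq (f.compile (fun i => s + 1 + i) (s + 1 + m))
          (.seq (.clear s) (.drain (s + 1 + m) s)))

/-- The specification of the compilation of a term. -/
def Correct {k : ℕ} (t : Tm Γ k) : Prop :=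
  ∃ P : Polynomial ℕ, ∀ (ctx : Fin k → ℕ) (s : ℕ) (w : List Γ) (e : ℕ → ℕ),
    (∀ i, ctx i < s) → (∀ r, e r ≤ w.length) →
    Ensures w (t.compile ctx s) e (P.eval w.length) fun e' =>
      e' s = t.eval w (fun i => e (ctx i)) ∧ ∀ r < s, e' r = e r

theorem correct_var {k : ℕ} (i : Fin k) : (var i : Tm Γ k).Correct := by
  refine ⟨11 * .X + 4, fun ctx s w e hc he => ?_⟩
  have := hc i
  refine (Prog.ensures_copy (by omega) (by omega) (by omega) he).imp (by simp) ?_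
  rintro e' ⟨h1, h2⟩
  exact ⟨h1, fun r hr => h2 r (by omega) (by omega)⟩

theorem correct_zero {k : ℕ} : (zero : Tm Γ k).Correct := by
  refine ⟨2 * .X + 1, fun ctx s w e hc he => ?_⟩
  refine (Prog.ensures_clear s he).imp (by simp) ?_
  rintro e' ⟨h1, h2⟩
  exact ⟨h1, fun r hr => h2 r (by omega)⟩

/-- A symbol exists at position `s` exactly while the register is below |w|, so counting up until
the read fails yields |w|. -/
theorem correct_top {k : ℕ} : (top : Tm Γ k).Correct := by
  refine ⟨2 * .X + 1 + (2 * .X + 1), fun ctx s w e hc he => ?_⟩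
  refine Ensures.imp (T := (2 * w.length + 1) + (w.length * (1 + 1) + 1))
    (Q := fun e' => e' s = w.length ∧ ∀ r < s, e' r = e r) ?_ (by simp; omega) fun _ h => h
  refine (Prog.ensures_clear s he).seq he fun e₁ he₁ h₁ => ?_
  refine (Ensures.loop (w := w) (T := 1)
    (fun j e' => e' s = w.length - j ∧ j ≤ w.length ∧ ∀ r < s, e' r = e r)
    (fun e' h => by simp [Test.eval, h.1])
    (fun j e' _ h => ⟨?_, .inc s ⟨?_, by omega, fun r hr => ?_⟩⟩)
    w.length he₁ ⟨by simp [h₁.1], le_rfl, fun r hr => h₁.2 r (by omega)⟩).imp le_rfl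
    fun e' h => ⟨by simp [h.1], h.2.2⟩
  · have : w.length - (j + 1) < w.length := by omega
    simp [Test.eval, h.1, List.getElem?_eq_getElem this]
  · simp [h.1]; omega
  · rw [Function.update_of_ne (by omega)]
    exact h.2.2 r hr

theorem Correct.succ {k : ℕ} {t : Tm Γ k} (ht : t.Correct) : t.succ.Correct := by
  obtain ⟨P, hP⟩ := ht
  refine ⟨P + 1, fun ctx s w e hc he => ?_⟩
  rw [Polynomial.eval_add, Polynomial.eval_one]
  refine (hP ctx s w e hc he).seq he fun e₁ he₁ h₁ => .inc s ⟨?_, fun r hr => ?_⟩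
  · simp [h₁.1, Tm.eval]
  · rw [update_of_ne (by omega), h₁.2 r hr]

theorem Correct.pred {k : ℕ} {t : Tm Γ k} (ht : t.Correct) : t.pred.Correct := by
  obtain ⟨P, hP⟩ := ht
  refine ⟨P + 1, fun ctx s w e hc he => ?_⟩
  rw [Polynomial.eval_add, Polynomial.eval_one]
  refine (hP ctx s w e hc he).seq he fun e₁ he₁ h₁ => .dec s ⟨?_, fun r hr => ?_⟩
  · simp [h₁.1, Tm.eval]
  · rw [update_of_ne (by omega), h₁.2 r hr]

theorem Correct.read {k : ℕ} {t : Tm Γ k} (p : Γ → Bool) (ht : t.Correct) :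
    (t.read p).Correct := by
  obtain ⟨P, hP⟩ := ht
  refine ⟨P + (1 + (2 * .X + 1 + 1)), fun ctx s w e hc he => ?_⟩
  refine Ensures.imp (T := P.eval w.length + (1 + (2 * w.length + 1 + 1)))
    (Q := fun e' => e' s = (t.read p).eval w (fun i => e (ctx i)) ∧ ∀ r < s, e' r = e r)
    ?_ (by simp) fun _ h => h
  refine (hP ctx s w e hc he).seq he fun e₁ he₁ h₁ => .ite (fun hb => ?_) (fun hb => ?_)
  · simp only [Test.eval, h₁.1] at hb
    refine (Prog.ensures_clear s he₁).seq he₁ fun e₂ _ h₂ => .inc s ⟨?_, fun r hr => ?_⟩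
    · have : 1 ≤ w.length := by
        rcases w with _ | ⟨a, w⟩
        · simp at hb
        · simp
      simp only [update_self, h₂.1, Tm.eval, hb, Bool.toNat_true]
      omega
    · rw [update_of_ne (by omega), h₂.2 r (by omega), h₁.2 r hr]
  · simp only [Test.eval, h₁.1] at hb
    refine (Prog.ensures_clear s he₁).imp (by omega) fun e₂ h₂ => ⟨?_, fun r hr => ?_⟩
    · simp [h₂.1, Tm.eval, hb]
    · rw [h₂.2 r (by omega), h₁.2 r hr]

theorem Correct.ite {k : ℕ} {t u v : Tm Γ k} (ht : t.Correct) (hu : u.Correct) (hv : v.Correct) :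
    (t.ite u v).Correct := by
  obtain ⟨P, hP⟩ := ht
  obtain ⟨Q, hQ⟩ := hu
  obtain ⟨R, hR⟩ := hv
  refine ⟨P + (1 + (Q + R)), fun ctx s w e hc he => ?_⟩
  refine Ensures.imp (T := P.eval w.length + (1 + (Q.eval w.length + R.eval w.length)))
    (Q := fun e' => e' s = (t.ite u v).eval w (fun i => e (ctx i)) ∧ ∀ r < s, e' r = e r)
    ?_ (by simp) fun _ h => h
  refine (hP ctx s w e hc he).seq he fun e₁ he₁ h₁ => .ite (fun hb => ?_) (fun hb => ?_)
  · simp only [Test.eval, h₁.1, decide_eq_true_eq] at hb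
    refine (hQ ctx s w e₁ hc he₁).imp (by omega) fun e₂ h₂ => ⟨?_, fun r hr => ?_⟩
    · simp only [h₂.1, Tm.eval, beq_eq_false_iff_ne.2 hb, cond_false, h₁.2 _ (hc _)]
    · rw [h₂.2 r hr, h₁.2 r hr]
  · simp only [Test.eval, h₁.1, decide_eq_false_iff_not, not_not] at hb
    refine (hR ctx s w e₁ hc he₁).imp (by omega) fun e₂ h₂ => ⟨?_, fun r hr => ?_⟩
    · simp only [h₂.1, Tm.eval, beq_iff_eq.2 hb, cond_true, h₁.2 _ (hc _)]
    · rw [h₂.2 r hr, h₁.2 r hr]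

/-- Register `s` holds the accumulator, `s + 1` the remaining iterations and `s + 2` the index. The
body works from `s + 3` on, so it cannot disturb them, and its result is moved back to `s`. -/
theorem Correct.recN {k : ℕ} {count init : Tm Γ k} {body : Tm Γ (k + 2)} (hcount : count.Correct)
    (hinit : init.Correct) (hbody : body.Correct) : (count.recN init body).Correct := by
  obtain ⟨P, hP⟩ := hcount
  obtain ⟨Q, hQ⟩ := hinit
  obtain ⟨R, hR⟩ := hbody
  refine ⟨Q + (P + ((2 * .X + 1) + (.X * ((1 + (R + ((2 * .X + 1) + ((3 * .X + 1) + 1)))) + 1) + 1))),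
    fun ctx s w e hc he => ?_⟩
  refine Ensures.imp (T := Q.eval w.length + (P.eval w.length + ((2 * w.length + 1) +
    (w.length * ((1 + (R.eval w.length + ((2 * w.length + 1) + ((3 * w.length + 1) + 1)))) + 1) + 1))))
    (Q := fun e' => e' s = (count.recN init body).eval w (fun i => e (ctx i)) ∧
      ∀ r < s, e' r = e r) ?_ (by simp) fun _ h => h
  refine (hQ ctx s w e hc he).seq he fun e₁ he₁ h₁ => ?_
  refine (hP ctx (s + 1) w e₁ (fun i => (hc i).trans (by omega)) he₁).seq he₁ fun e₂ he₂ h₂ => ?_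
  refine (Prog.ensures_clear (s + 2) he₂).seq he₂ fun e₃ he₃ h₃ => ?_
  set v : Fin k → ℕ := fun i => e (ctx i)
  set n := count.eval w v
  set F : ℕ → ℕ := fun j => Nat.rec (init.eval w v)
    (fun i acc => body.eval w (Matrix.vecCons acc (Matrix.vecCons i v))) j with hF
  have hn : e₃ (s + 1) = n := by
    rw [h₃.2 _ (by omega), h₂.1]
    simp only [h₁.2 _ (hc _), n, v]
  -- Registers never exceed |w|; this bounds the number of iterations and keeps the running time
  -- polynomial under nesting.
  have hn' : n ≤ w.length := hn ▸ he₃ (s + 1)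
  have hlow : ∀ r < s, e₃ r = e r := fun r hr => by
    rw [h₃.2 r (by omega), h₂.2 r (by omega), h₁.2 r hr]
  refine (Ensures.loop (w := w)
    (T := 1 + (R.eval w.length + ((2 * w.length + 1) + ((3 * w.length + 1) + 1))))
    (fun j e' => j ≤ n ∧ e' (s + 1) = j ∧ e' (s + 2) = n - j ∧ e' s = F (n - j) ∧ ∀ r < s, e' r = e r)
    (fun e' h => by simp [Test.eval, h.2.1])
    (fun j e' he' h => ⟨by simp [Test.eval, h.2.1], ?_⟩)
    n he₃ ⟨le_rfl, hn, by simp [h₃.1], ?_, hlow⟩).imp ?_ ?_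
  · obtain ⟨i1, i2, i3, i4, i5⟩ := h
    refine Ensures.seq he' (.dec (s + 1) rfl) fun f₁ hf₁ g₁ => ?_
    have hctx : ∀ i, (Matrix.vecCons s (Matrix.vecCons (s + 2) ctx) : Fin (k + 2) → ℕ) i < s + 3 := by
      intro i
      refine Fin.cases (by simp) (fun i => ?_) i
      refine Fin.cases (by simp) (fun i => ?_) i
      have := hc i
      simp only [Matrix.cons_val_succ]
      omega
    refine (hR _ (s + 3) w f₁ hctx hf₁).seq hf₁ fun f₂ hf₂ g₂ => ?_
    refine (Prog.ensures_clear s hf₂).seq hf₂ fun f₃ hf₃ g₃ => ?_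
    refine (Prog.ensures_drain (by omega) hf₃ (by rw [g₃.1]; exact hf₃ _)).seq hf₃
      fun f₄ hf₄ g₄ => .inc (s + 2) ?_
    obtain ⟨g4, g5, g6⟩ := g₄
    refine ⟨by omega, ?_, ?_, ?_, fun r hr => ?_⟩
    · rw [update_of_ne (by omega), g6 _ (by omega) (by omega), g₃.2 _ (by omega),
        g₂.2 _ (by omega), ← g₁, update_self, i2]
      rfl
    · rw [update_self, g6 _ (by omega) (by omega), g₃.2 _ (by omega),
        g₂.2 _ (by omega), ← g₁, update_of_ne (by omega), i3]
      omega
    · rw [update_of_ne (by omega), g4, g₃.1, add_zero, g₃.2 _ (by omega), g₂.1,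
        show n - j = (n - (j + 1)) + 1 by omega]
      rw [hF]
      dsimp only
      congr 1
      funext i
      refine Fin.cases ?_ (fun i => ?_) i
      · simp only [Matrix.cons_val_zero]
        rw [← g₁, update_of_ne (by omega), i4]
      · refine Fin.cases ?_ (fun i => ?_) i
        · simp only [Matrix.cons_val_succ, Matrix.cons_val_zero]
          rw [← g₁, update_of_ne (by omega), i3]
        · have := hc i
          simp only [Matrix.cons_val_succ]
          rw [← g₁, update_of_ne (by omega), i5 _ this]
    · rw [update_of_ne (by omega), g6 _ (by omega) (by omega), g₃.2 _ (by omega),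
        g₂.2 _ (by omega), ← g₁, update_of_ne (by omega), i5 r hr]
  · rw [h₃.2 _ (by omega), h₂.2 _ (by omega), h₁.1, Nat.sub_self]; rfl
  · exact Nat.add_le_add_right (Nat.mul_le_mul_right _ hn') 1
  · intro e' h
    exact ⟨by rw [h.2.2.2.1, Nat.sub_zero]; rfl, h.2.2.2.2⟩

/-- Argument number `i` goes to register `s + 1 + i`. Evaluation in increasing order is safe because
each argument only changes registers from its own target on. -/
theorem ensures_args {k m : ℕ} {g : Fin m → Tm Γ k} {P : Fin m → Polynomial ℕ}
    {ctx : Fin k → ℕ} {s : ℕ} {w : List Γ} (hc : ∀ i, ctx i < s)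
    (hP : ∀ (j : Fin m) (s' : ℕ) (e : ℕ → ℕ), (∀ i, ctx i < s') → (∀ r, e r ≤ w.length) →
      Ensures w ((g j).compile ctx s') e ((P j).eval w.length) fun e' =>
        e' s' = (g j).eval w (fun i => e (ctx i)) ∧ ∀ r < s', e' r = e r)
    (l : List (Fin m)) (hl : l.Pairwise (· < ·)) (e : ℕ → ℕ) (he : ∀ r, e r ≤ w.length) :
    Ensures w (seqList (.clear s) (l.map fun i => (g i).compile ctx (s + 1 + i))) e
      ((l.map fun j => (P j).eval w.length).sum + (2 * w.length + 1)) fun e' =>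
        (∀ i ∈ l, e' (s + 1 + i) = (g i).eval w fun i => e (ctx i)) ∧
        ∀ r, r ≠ s → (∀ i ∈ l, r < s + 1 + i) → e' r = e r := by
  induction l generalizing e with
  | nil =>
    simp only [List.map_nil, seqList, List.sum_nil, zero_add]
    refine (Prog.ensures_clear s he).imp le_rfl fun e' h => ⟨by simp, fun r hr _ => h.2 r hr⟩
  | cons j l ih =>
    rw [List.pairwise_cons] at hl
    simp only [List.map_cons, seqList, List.sum_cons, add_assoc]
    refine (hP j (s + (1 + j)) e (fun i => (hc i).trans (by omega)) he).seq he fun e₁ he₁ h₁ => ?_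
    have := ih hl.2 e₁ he₁
    simp only [add_assoc] at this
    refine this.imp le_rfl fun e' h => ⟨?_, fun r hr hr' => ?_⟩
    · intro i hi
      rcases List.mem_cons.1 hi with rfl | hi
      · rw [h.2 _ (by omega) fun i' hi' => by have := hl.1 i' hi'; omega, h₁.1]
      · rw [h.1 i hi]
        congr 1
        funext i'
        exact h₁.2 _ ((hc i').trans (by omega))
    · rw [h.2 r hr fun i hi => hr' i (List.mem_cons_of_mem _ hi), h₁.2 r (hr' j List.mem_cons_self)]

theorem Correct.comp {k m : ℕ} {f : Tm Γ m} {g : Fin m → Tm Γ k} (hf : f.Correct)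
    (hg : ∀ i, (g i).Correct) : (f.comp g).Correct := by
  obtain ⟨P, hP⟩ := hf
  choose Q hQ using hg
  refine ⟨(((List.finRange m).map Q).sum + (2 * .X + 1)) + (P + ((2 * .X + 1) + (3 * .X + 1))),
    fun ctx s w e hc he => ?_⟩
  refine Ensures.imp (T := (((List.finRange m).map fun j => (Q j).eval w.length).sum +
    (2 * w.length + 1)) + (P.eval w.length + ((2 * w.length + 1) + (3 * w.length + 1))))
    (Q := fun e' => e' s = (f.comp g).eval w (fun i => e (ctx i)) ∧
      ∀ r < s, e' r = e r) ?_ ?_ fun _ h => h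
  · refine (ensures_args hc (fun j s' e h h' => hQ j ctx s' w e h h') _
      (List.pairwise_lt_finRange m) e he).seq he fun e₁ he₁ h₁ => ?_
    refine (hP _ (s + 1 + m) w e₁ (fun i => by omega) he₁).seq he₁ fun e₂ he₂ h₂ => ?_
    refine (Prog.ensures_clear s he₂).seq he₂ fun e₃ he₃ h₃ => ?_
    refine (Prog.ensures_drain (by omega) he₃ (by rw [h₃.1]; exact he₃ _)).imp le_rfl
      fun e₄ h₄ => ⟨?_, fun r hr => ?_⟩
    · rw [h₄.1, h₃.1, add_zero, h₃.2 _ (by omega), h₂.1]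
      simp only [Tm.eval]
      congr 1
      funext i
      exact h₁.1 i (List.mem_finRange i)
    · rw [h₄.2.2 r (by omega) (by omega), h₃.2 r (by omega), h₂.2 r (by omega),
        h₁.2 r (by omega) fun i _ => by omega]
  · have : ∀ l : List (Fin m), (l.map Q).sum.eval w.length =
        (l.map fun j => (Q j).eval w.length).sum := by
      intro l
      induction l with
      | nil => simp
      | cons a l ih => simp [ih]
    simp [this]

/-- The polynomial is obtained by recursion on the term and depends neither on the input nor on the
registers, so each fixed term is a polynomial-time algorithm. -/
theorem correct {k : ℕ} (t : Tm Γ k) : t.Correct := by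
  induction t with
  | var i => exact correct_var i
  | zero => exact correct_zero
  | top => exact correct_top
  | succ t ih => exact ih.succ
  | pred t ih => exact ih.pred
  | read p t ih => exact ih.read p
  | ite t u v iht ihu ihv => exact iht.ite ihu ihv
  | recN c i b ihc ihi ihb => exact ihc.recN ihi ihb
  | comp f g ihf ihg => exact ihf.comp ihg

theorem computableInPolyTime [Inhabited Γ] [Fintype Γ] {α : Type} (enc : α → List Γ)
    (t : Tm Γ 0) : Nonempty (Turing.TM2ComputableInPolyTime enc Computability.encodeBool
      fun a => decide (t.eval (enc a) ![] ≠ 0)) := by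
  obtain ⟨P, hP⟩ := t.correct
  refine computableInPolyTime_of_prog enc _ (t.compile ![] 0) P fun a => ?_
  obtain ⟨s, hs, e', h₁, h₂, -⟩ := hP ![] 0 (enc a) (fun _ => 0) (fun i => i.elim0) (by simp)
  refine ⟨s, hs, e', h₁, ?_⟩
  rw [h₂]
  congr 4
  exact Subsingleton.elim _ _

end Tm

end Dodosp


namespace Dodosp

/-! ### Arithmetic, logic and bounded quantifiers as terms -/

namespace Tm

variable {Γ : Type} {k : ℕ} {w : List Γ} {v : Fin k → ℕ}

theorem eval_args_cons {m : ℕ} (t : Tm Γ k) (g : Fin m → Tm Γ k) :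
    (fun i => ((Matrix.vecCons t g : Fin (m + 1) → Tm Γ k) i).eval w v) =
      Matrix.vecCons (t.eval w v) fun i => (g i).eval w v := by
  funext i
  refine Fin.cases rfl (fun i => rfl) i

theorem eval_args_nil (g : Fin 0 → Tm Γ k) : (fun i => (g i).eval w v) = ![] :=
  Subsingleton.elim _ _

theorem eval_comp₁ (f : Tm Γ 1) (t : Tm Γ k) :
    (comp f ![t]).eval w v = f.eval w ![t.eval w v] := by
  rw [Tm.eval, eval_args_cons, eval_args_nil]

theorem eval_comp₂ (f : Tm Γ 2) (s t : Tm Γ k) :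
    (comp f ![s, t]).eval w v = f.eval w ![s.eval w v, t.eval w v] := by
  rw [Tm.eval, eval_args_cons, eval_args_cons, eval_args_nil]

/-- The constant `c`. -/
def const : ℕ → Tm Γ k
  | 0 => zero
  | c + 1 => succ (const c)

theorem eval_const (c : ℕ) : (const c : Tm Γ k).eval w v = min c w.length := by
  induction c with
  | zero => simp [const, Tm.eval]
  | succ c ih => simp only [const, Tm.eval, ih]; omega

/-- Sum, saturating. -/
def add (s t : Tm Γ k) : Tm Γ k := comp (recN (var 1) (var 0) (succ (var 0))) ![s, t]

theorem eval_add (s t : Tm Γ k) (hs : s.eval w v ≤ w.length) :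
    (add s t).eval w v = min (s.eval w v + t.eval w v) w.length := by
  rw [add, eval_comp₂]
  simp only [Tm.eval, Matrix.cons_val_zero, Matrix.cons_val_one]
  induction t.eval w v with
  | zero => simp [hs]
  | succ n ih => simp only [ih]; omega

/-- Truncated difference. -/
def sub (s t : Tm Γ k) : Tm Γ k := comp (recN (var 1) (var 0) (pred (var 0))) ![s, t]

theorem eval_sub (s t : Tm Γ k) : (sub s t).eval w v = s.eval w v - t.eval w v := by
  rw [sub, eval_comp₂]
  simp only [Tm.eval, Matrix.cons_val_zero, Matrix.cons_val_one]
  induction t.eval w v with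
  | zero => simp
  | succ n ih => simp only [ih]; omega

/-- Product, saturating. -/
def mul (s t : Tm Γ k) : Tm Γ k := comp (recN (var 1) zero (add (var 0) (var 2))) ![s, t]

theorem eval_mul (s t : Tm Γ k) :
    (mul s t).eval w v = min (s.eval w v * t.eval w v) w.length := by
  rw [mul, eval_comp₂]
  have key : ∀ i, Nat.rec (motive := fun _ => ℕ) 0 (fun i acc =>
      (add (var 0) (var 2) : Tm Γ 4).eval w
        (Matrix.vecCons acc (Matrix.vecCons i ![s.eval w v, t.eval w v]))) i =
      min (s.eval w v * i) w.length := by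
    intro i
    induction i with
    | zero => simp
    | succ i ih =>
      dsimp only
      rw [ih, eval_add _ _ (by simp [Tm.eval])]
      simp only [Tm.eval, Matrix.cons_val_zero, Matrix.cons_val]
      rw [Nat.mul_succ]
      omega
  exact key _

theorem eval_ite (t u u' : Tm Γ k) : (ite t u u').eval w v =
    if t.eval w v ≠ 0 then u.eval w v else u'.eval w v := by
  rw [Tm.eval, Bool.cond_eq_ite]
  simp

/-- Negation. -/
def not (t : Tm Γ k) : Tm Γ k := ite t zero (const 1)

theorem eval_not (t : Tm Γ k) (hw : 1 ≤ w.length) :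
    (not t).eval w v ≠ 0 ↔ ¬ t.eval w v ≠ 0 := by
  simp only [not, Tm.eval, eval_const]
  rcases Nat.eq_zero_or_pos (t.eval w v) with h | h
  · simp only [h, beq_self_eq_true, cond_true]
    omega
  · simp [beq_eq_false_iff_ne.2 h.ne', h.ne']

/-- Conjunction. -/
def and (s t : Tm Γ k) : Tm Γ k := ite s t zero

theorem eval_and (s t : Tm Γ k) :
    (and s t).eval w v ≠ 0 ↔ s.eval w v ≠ 0 ∧ t.eval w v ≠ 0 := by
  simp only [and, Tm.eval]
  rcases Nat.eq_zero_or_pos (s.eval w v) with h | h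
  · simp [h]
  · simp [beq_eq_false_iff_ne.2 h.ne', h.ne']

/-- Disjunction. -/
def or (s t : Tm Γ k) : Tm Γ k := ite s s t

theorem eval_or (s t : Tm Γ k) :
    (or s t).eval w v ≠ 0 ↔ s.eval w v ≠ 0 ∨ t.eval w v ≠ 0 := by
  simp only [or, Tm.eval]
  rcases Nat.eq_zero_or_pos (s.eval w v) with h | h
  · simp [h]
  · simp [beq_eq_false_iff_ne.2 h.ne', h.ne']

/-- Strict comparison. -/
def lt (s t : Tm Γ k) : Tm Γ k := sub t s

theorem eval_lt (s t : Tm Γ k) : (lt s t).eval w v ≠ 0 ↔ s.eval w v < t.eval w v := by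
  simp only [lt, eval_sub]; omega

/-- Comparison. -/
def le (s t : Tm Γ k) : Tm Γ k := not (lt t s)

theorem eval_le' (s t : Tm Γ k) (hw : 1 ≤ w.length) :
    (le s t).eval w v ≠ 0 ↔ s.eval w v ≤ t.eval w v := by
  rw [le, eval_not _ hw, eval_lt, not_lt]

/-- Equality. -/
def eq (s t : Tm Γ k) : Tm Γ k := and (le s t) (le t s)

theorem eval_eq' (s t : Tm Γ k) (hw : 1 ≤ w.length) :
    (eq s t).eval w v ≠ 0 ↔ s.eval w v = t.eval w v := by
  rw [eq, eval_and, eval_le' _ _ hw, eval_le' _ _ hw]; omega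

/-- Implication. -/
def imp (s t : Tm Γ k) : Tm Γ k := or (not s) t

theorem eval_imp (s t : Tm Γ k) (hw : 1 ≤ w.length) :
    (imp s t).eval w v ≠ 0 ↔ (s.eval w v ≠ 0 → t.eval w v ≠ 0) := by
  rw [imp, eval_or, eval_not _ hw, imp_iff_not_or]

/-- Equivalence. -/
def iff (s t : Tm Γ k) : Tm Γ k := and (imp s t) (imp t s)

theorem eval_iff (s t : Tm Γ k) (hw : 1 ≤ w.length) :
    (iff s t).eval w v ≠ 0 ↔ (s.eval w v ≠ 0 ↔ t.eval w v ≠ 0) := by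
  rw [iff, eval_and, eval_imp _ _ hw, eval_imp _ _ hw]
  exact iff_def.symm

/-- Half of a number, rounded down. -/
def half (t : Tm Γ k) : Tm Γ k :=
  comp (recN (var 0) zero
    (ite (lt (var 0) (sub (var 2) (succ (var 0)))) (succ (var 0)) (var 0))) ![t]

/-- Writing t for the value of the argument, the accumulator a grows while a < t - (a + 1), that is,
while 2(a + 1) ≤ t. After i rounds it is min(i, t / 2), and t rounds are enough. -/
theorem eval_half (t : Tm Γ k) (ht : t.eval w v ≤ w.length) :
    (half t).eval w v = t.eval w v / 2 := by
  rw [half, eval_comp₁]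
  have key : ∀ i ≤ t.eval w v, Nat.rec (motive := fun _ => ℕ) 0 (fun i acc =>
      (ite (lt (var 0) (sub (var 2) (succ (var 0)))) (succ (var 0)) (var 0) : Tm Γ 3).eval w
        (Matrix.vecCons acc (Matrix.vecCons i ![t.eval w v]))) i = min i (t.eval w v / 2) := by
    intro i hi
    induction i with
    | zero => simp
    | succ i ih =>
      dsimp only
      rw [ih (by omega)]
      simp only [Tm.eval, lt, eval_sub, Matrix.cons_val_zero, Matrix.cons_val]
      rcases Nat.eq_zero_or_pos (t.eval w v - min (min i (t.eval w v / 2) + 1) w.length -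
        min i (t.eval w v / 2)) with h | h
      · simp only [h, beq_self_eq_true, cond_true]
        omega
      · simp only [beq_eq_false_iff_ne.2 h.ne', cond_false]
        omega
  have := key _ le_rfl
  simp only [Tm.eval, Matrix.cons_val_zero] at this ⊢
  rw [this]
  omega

/-- The body of a bounded quantifier, as a body of a recursion. -/
def shift (body : Tm Γ (k + 1)) : Tm Γ (k + 2) :=
  comp body (Matrix.vecCons (var 1) fun i => var i.succ.succ)

theorem eval_shift (body : Tm Γ (k + 1)) (a i : ℕ) :
    (shift body).eval w (Matrix.vecCons a (Matrix.vecCons i v)) =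
      body.eval w (Matrix.vecCons i v) := by
  simp only [shift, Tm.eval]
  congr 1
  funext j
  refine Fin.cases rfl (fun j => rfl) j

/-- Bounded existential quantification. -/
def ex (bound : Tm Γ k) (body : Tm Γ (k + 1)) : Tm Γ k :=
  recN bound zero (ite (var 0) (var 0) (shift body))

theorem eval_ex (bound : Tm Γ k) (body : Tm Γ (k + 1)) :
    (ex bound body).eval w v ≠ 0 ↔
      ∃ i < bound.eval w v, body.eval w (Matrix.vecCons i v) ≠ 0 := by
  simp only [ex, Tm.eval, eval_shift, Matrix.cons_val_zero]
  induction bound.eval w v with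
  | zero => simp
  | succ n ih =>
    dsimp only
    set A := Nat.rec (motive := fun _ => ℕ) 0 (fun i acc =>
      cond (acc == 0) (body.eval w (Matrix.vecCons i v)) acc) n with hA
    rcases Nat.eq_zero_or_pos A with h | h
    · simp only [h, beq_self_eq_true, cond_true]
      constructor
      · exact fun h' => ⟨n, by omega, h'⟩
      · rintro ⟨i, hi, h'⟩
        rcases Nat.lt_succ_iff_lt_or_eq.1 hi with hi | rfl
        · exact absurd h (ih.2 ⟨i, hi, h'⟩)
        · exact h'
    · simp only [beq_eq_false_iff_ne.2 h.ne', cond_false]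
      obtain ⟨i, hi, h'⟩ := ih.1 h.ne'
      exact iff_of_true h.ne' ⟨i, by omega, h'⟩

/-- Bounded universal quantification. -/
def all (bound : Tm Γ k) (body : Tm Γ (k + 1)) : Tm Γ k := not (ex bound (not body))

theorem eval_all (bound : Tm Γ k) (body : Tm Γ (k + 1)) (hw : 1 ≤ w.length) :
    (all bound body).eval w v ≠ 0 ↔
      ∀ i < bound.eval w v, body.eval w (Matrix.vecCons i v) ≠ 0 := by
  rw [all, eval_not _ hw, eval_ex]
  simp only [eval_not _ hw]
  push Not
  rfl

/-- Bounded counting. -/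
def count (bound : Tm Γ k) (body : Tm Γ (k + 1)) : Tm Γ k :=
  recN bound zero (ite (shift body) (succ (var 0)) (var 0))

theorem eval_count (bound : Tm Γ k) (body : Tm Γ (k + 1)) (hb : bound.eval w v ≤ w.length)
    (p : ℕ → Prop) [DecidablePred p]
    (hp : ∀ i < bound.eval w v, body.eval w (Matrix.vecCons i v) ≠ 0 ↔ p i) :
    (count bound body).eval w v = ((Finset.range (bound.eval w v)).filter p).card := by
  simp only [count, Tm.eval, eval_shift, Matrix.cons_val_zero]
  revert hb hp
  induction bound.eval w v with
  | zero => simp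
  | succ n ih =>
    intro hb hp
    dsimp only
    rw [ih (by omega) fun i hi => hp i (by omega), Finset.range_add_one, Finset.filter_insert]
    have hle : ((Finset.range n).filter p).card ≤ n := by
      simpa using Finset.card_filter_le (Finset.range n) p
    by_cases h : p n
    · have h' := (hp n (by omega)).2 h
      rw [if_pos h, Finset.card_insert_of_notMem (by simp)]
      simp only [beq_eq_false_iff_ne.2 h', cond_false]
      omega
    · have h' := not_not.1 (mt (hp n (by omega)).1 h)
      rw [if_neg h, h']
      rfl

end Tm

/-! ### Reading numbers in binary -/

/-- Binary numbers are written with the least significant digit first, so list positions are bit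
positions. -/
theorem encodePosNum_getElem? (p : PosNum) (r : ℕ) :
    (Computability.encodePosNum p)[r]? = some true ↔ (p : ℕ).testBit r = true := by
  induction p generalizing r with
  | one =>
    cases r with
    | zero => simp [Computability.encodePosNum]
    | succ r => simp [Computability.encodePosNum, Nat.testBit_add_one]
  | bit1 p ih =>
    cases r with
    | zero =>
      simp only [Computability.encodePosNum, PosNum.cast_bit1, Nat.testBit_zero]
      simp; omega
    | succ r =>
      simp only [Computability.encodePosNum, List.getElem?_cons_succ, ih, PosNum.cast_bit1,
        Nat.testBit_add_one]
      rw [show ((p : ℕ) + p + 1) / 2 = p by omega]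
  | bit0 p ih =>
    cases r with
    | zero =>
      simp only [Computability.encodePosNum, PosNum.cast_bit0, Nat.testBit_zero]
      simp; omega
    | succ r =>
      simp only [Computability.encodePosNum, List.getElem?_cons_succ, ih, PosNum.cast_bit0,
        Nat.testBit_add_one]
      rw [show ((p : ℕ) + p) / 2 = p by omega]

theorem encodeNat_getElem? (n r : ℕ) :
    (Computability.encodeNat n)[r]? = some true ↔ n.testBit r = true := by
  rw [Computability.encodeNat, Computability.encodeNum.eq_def]
  conv_rhs => rw [← Num.to_of_nat n]
  cases (n : Num) with
  | zero => simp
  | pos p => exact encodePosNum_getElem? p r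

theorem encodePosNum_length (p : PosNum) :
    (p : ℕ) < 2 ^ (Computability.encodePosNum p).length ∧
      2 ^ (Computability.encodePosNum p).length ≤ 2 * (p : ℕ) := by
  induction p with
  | one => simp [Computability.encodePosNum]
  | bit1 p ih =>
    simp only [Computability.encodePosNum, PosNum.cast_bit1, List.length_cons, pow_succ]; omega
  | bit0 p ih =>
    simp only [Computability.encodePosNum, PosNum.cast_bit0, List.length_cons, pow_succ]; omega

theorem lt_two_pow_encodeNat_length (n : ℕ) : n < 2 ^ (Computability.encodeNat n).length := by
  rw [Computability.encodeNat, Computability.encodeNum.eq_def]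
  conv_lhs => rw [← Num.to_of_nat n]
  cases (n : Num) with
  | zero => simp
  | pos p => exact (encodePosNum_length p).1

theorem encodeNat_length_le (n : ℕ) : (Computability.encodeNat n).length ≤ Nat.log 2 n + 1 := by
  rcases Nat.eq_zero_or_pos n with rfl | hn
  · simp [Computability.encodeNat, Computability.encodeNum]
  have : 2 ^ (Computability.encodeNat n).length ≤ 2 * n := by
    rw [Computability.encodeNat, Computability.encodeNum.eq_def]
    conv_rhs => rw [← Num.to_of_nat n]
    cases h : (n : Num) with
    | zero =>
      have := Num.to_of_nat n
      rw [h] at this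
      simp at this
      omega
    | pos p => exact (encodePosNum_length p).2
  have h2 := Nat.lt_pow_succ_log_self (b := 2) (by norm_num) n
  by_contra! hlt
  have h3 : 2 ^ (Nat.log 2 n + 2) ≤ 2 ^ (Computability.encodeNat n).length :=
    Nat.pow_le_pow_right (by norm_num) hlt
  rw [pow_succ] at h3
  omega

/-- The symbols of an alphabet that contains the alphabet of the encoded instances. -/
structure Reading (Γ : Type) where
  /-- the embedding -/
  emb : Option Bool → Γ
  /-- recognizes separators -/
  isSep : Γ → Bool
  /-- recognizes the digit one -/
  isOne : Γ → Bool
  isSep_none : isSep (emb none) = true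
  isSep_some : ∀ b, isSep (emb (some b)) = false
  isOne_none : isOne (emb none) = false
  isOne_some : ∀ b, isOne (emb (some b)) = b

namespace Reading

open Tm

variable {Γ : Type} (R : Reading Γ) {k : ℕ}

/-- The number of separators to the left of a position. -/
def seps (t : Tm Γ k) : Tm Γ k := comp (count (var 0) (read R.isSep (var 0))) ![t]

/-- The position at which a number starts. -/
def start (j : Tm Γ k) : Tm Γ k :=
  comp (count top (lt (R.seps (var 0)) (var 1))) ![j]

/-- The digit at position `r` of the number with index `j`. -/
def bit (j r : Tm Γ k) : Tm Γ k :=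
  comp (ite (eq (R.seps (add (R.start (var 0)) (var 1))) (var 0))
    (read R.isOne (add (R.start (var 0)) (var 1))) zero) ![j, r]

/-- The number with index `j`, or the length of the input, if that is smaller. -/
def num (j : Tm Γ k) : Tm Γ k :=
  comp (recN top zero
    (add (add (var 0) (var 0)) (R.bit (var 2) (pred (sub top (var 1)))))) ![j]

variable {R} {w : List Γ} {v : Fin k → ℕ}

theorem eval_seps (t : Tm Γ k) (ht : t.eval w v ≤ w.length) :
    (R.seps t).eval w v = (w.take (t.eval w v)).countP R.isSep := by
  rw [seps, eval_comp₁, eval_count _ _ (by simpa [Tm.eval] using ht)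
    (fun i => (w[i]?).any R.isSep = true) fun i _ => by simp [Tm.eval]]
  simp only [Tm.eval, Matrix.cons_val_zero]
  generalize t.eval w v = n at ht
  induction n with
  | zero => simp
  | succ n ih =>
    have hn : n < w.length := by omega
    rw [Finset.range_add_one, Finset.filter_insert, List.take_add_one,
      List.getElem?_eq_getElem hn, List.countP_append, ← ih (by omega)]
    by_cases h : R.isSep w[n] = true
    · rw [if_pos (by simp [h]), Finset.card_insert_of_notMem (by simp)]
      simp [h]
    · rw [if_neg (by simp [h])]
      simp [h]

/-- Since `pre` is empty or ends with a separator, the positions inside `pre` are exactly those with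
fewer separators to their left than `pre` contains. -/
theorem eval_start {pre post : List Γ} (hw : w = pre ++ post)
    (hpre : pre = [] ∨ ∃ l s, pre = l ++ [s] ∧ R.isSep s = true)
    (j : Tm Γ k) (hj : j.eval w v = pre.countP R.isSep) :
    (R.start j).eval w v = pre.length := by
  have hle : pre.length ≤ w.length := by rw [hw]; simp
  rw [start, eval_comp₁, eval_count _ _ (by simp [Tm.eval]) (fun i => i < pre.length)]
  · simp only [Tm.eval]
    rw [show (Finset.range w.length).filter (fun i => i < pre.length) = Finset.range pre.length by
      ext i; simp; omega, Finset.card_range]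
  · intro i hi
    simp only [Tm.eval] at hi
    rw [eval_lt, eval_seps _ (by simpa [Tm.eval] using hi.le)]
    simp only [Tm.eval, Matrix.cons_val_zero, Matrix.cons_val_one, hj]
    constructor
    · intro h2
      by_contra! h3
      rw [hw, List.take_append, List.take_of_length_le h3, List.countP_append] at h2
      omega
    · intro h1
      rcases hpre with rfl | ⟨l, s, rfl, hs⟩
      · simp at h1
      · rw [List.length_append, List.length_singleton] at h1
        have h2 : i ≤ l.length := by omega
        rw [hw, List.append_assoc, List.take_append_of_le_length h2, List.countP_append]
        have := (List.take_sublist i l).countP_le (p := R.isSep)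
        simp [hs]
        omega

/-- Beyond the closing separator the number of separators to the left differs from `j`, so the guard
fails and digits past the end of the number are read as 0. -/
theorem eval_bit_of_append {pre x post : List Γ} {s : Γ} (hw : w = pre ++ (x ++ s :: post))
    (hpre : pre = [] ∨ ∃ l s, pre = l ++ [s] ∧ R.isSep s = true)
    (hx : ∀ a ∈ x, R.isSep a = false) (hs : R.isSep s = true) (hs' : R.isOne s = false)
    (j r : Tm Γ k) (hj : j.eval w v = pre.countP R.isSep) :
    (R.bit j r).eval w v = if (x[r.eval w v]?).any R.isOne then 1 else 0 := by
  have hw1 : 1 ≤ w.length := by rw [hw]; simp; omega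
  have hle : pre.length ≤ w.length := by rw [hw]; simp
  rw [bit, eval_comp₂]
  have hst : (R.start (var 0) : Tm Γ 2).eval w ![j.eval w v, r.eval w v] = pre.length :=
    eval_start hw hpre _ (by simpa [Tm.eval] using hj)
  have hpos : (add (R.start (var 0)) (var 1) : Tm Γ 2).eval w ![j.eval w v, r.eval w v] =
      min (pre.length + r.eval w v) w.length := by
    rw [eval_add _ _ (by rw [hst]; exact hle), hst]
    simp [Tm.eval]
  rw [eval_ite]
  simp only [eval_eq' _ _ hw1]
  rw [eval_seps _ (by rw [hpos]; omega)]
  simp only [Tm.eval, hpos]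
  simp only [Matrix.cons_val_zero, hj]
  rw [show ∀ b : Bool, (if b = true then 1 else 0) = b.toNat by decide]
  generalize r.eval w v = q
  have hx0 : x.countP R.isSep = 0 := by
    rw [List.countP_eq_zero]
    intro a ha
    simp [hx a ha]
  have hlen : w.length = pre.length + (x.length + (post.length + 1)) := by
    rw [hw]; simp
  rcases lt_trichotomy q x.length with hq | rfl | hq
  · rw [min_eq_left (by omega), if_pos]
    · rw [hw, List.getElem?_append_right (by omega), Nat.add_sub_cancel_left,
        List.getElem?_append_left hq]
    · rw [hw, List.take_length_add_append, List.countP_append, List.take_append_of_le_length hq.le]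
      have := (List.take_sublist q x).countP_le (p := R.isSep)
      omega
  -- The closing separator itself still passes the guard, but it is not the digit one.
  · rw [min_eq_left (by omega)]
    have : w[pre.length + x.length]? = some s := by
      rw [hw, List.getElem?_append_right (by omega), Nat.add_sub_cancel_left,
        List.getElem?_append_right le_rfl]
      simp
    rw [this]
    simp [hs']
  · rw [if_neg]
    · simp [hq.le]
    -- Even a position saturated at the end of the input lies strictly to the right of the closing
    -- separator.
    · obtain ⟨u, hu⟩ : ∃ u, min (pre.length + q) w.length = pre.length + (x.length + (u + 1)) :=
        ⟨min (pre.length + q) w.length - pre.length - x.length - 1, by omega⟩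
      rw [hu, hw, List.take_length_add_append, List.take_length_add_append, List.take_succ_cons]
      simp only [List.countP_append, List.countP_cons, hs]
      simp

theorem isSep_map (l : List Bool) : ∀ a ∈ l.map (fun b => R.emb (some b)), R.isSep a = false := by
  intro a ha
  obtain ⟨b, -, rfl⟩ := List.mem_map.1 ha
  exact R.isSep_some b

theorem encodeNats_split {l : List ℕ} {i : ℕ} (hi : i < l.length) :
    encodeNats l = encodeNats (l.take i) ++ ((Computability.encodeNat l[i]).map some ++
      none :: encodeNats (l.drop (i + 1))) := by
  have hl : l = l.take i ++ l[i] :: l.drop (i + 1) := by simp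
  have h : ∀ l₁ l₂ a, encodeNats (l₁ ++ a :: l₂) = encodeNats l₁ ++
      ((Computability.encodeNat a).map some ++ none :: encodeNats l₂) := fun l₁ l₂ a => by
    simp [encodeNats]
  conv_lhs => rw [hl]
  exact h _ _ _

theorem countP_encodeNats (l : List ℕ) :
    ((encodeNats l).map R.emb).countP R.isSep = l.length := by
  induction l with
  | nil => simp [encodeNats]
  | cons a l ih =>
    have : encodeNats (a :: l) = ((Computability.encodeNat a).map some ++ [none]) ++ encodeNats l :=
      rfl
    rw [this, List.map_append, List.countP_append, ih, List.map_append, List.countP_append]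
    have h0 : (List.map R.emb (List.map some (Computability.encodeNat a))).countP R.isSep = 0 := by
      rw [List.countP_eq_zero, List.map_map]
      intro x hx
      simp [R.isSep_map _ x hx]
    rw [h0]
    simp [R.isSep_none]
    omega

theorem eval_bit {l : List ℕ} {rest : List Γ} (hw : w = (encodeNats l).map R.emb ++ rest)
    (j r : Tm Γ k) (hj : j.eval w v < l.length) :
    (R.bit j r).eval w v = if l[j.eval w v].testBit (r.eval w v) then 1 else 0 := by
  set i := j.eval w v with hi
  have h1 := encodeNats_split hj
  rw [eval_bit_of_append (pre := (encodeNats (l.take i)).map R.emb)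
    (x := (Computability.encodeNat l[i]).map fun b => R.emb (some b)) (s := R.emb none)
    (post := (encodeNats (l.drop (i + 1))).map R.emb ++ rest)]
  · have := encodeNat_getElem? l[i] (r.eval w v)
    rw [List.getElem?_map]
    rcases h : (Computability.encodeNat l[i])[r.eval w v]? with _ | b
    · rw [h] at this
      simpa using this
    · rw [h] at this
      cases b <;> simpa [R.isOne_some] using this
  · rw [hw, h1]
    simp [Function.comp_def]
  · rcases List.eq_nil_or_concat (l.take i) with h | ⟨l', a, h⟩
    · left; rw [h]; rfl
    · right
      refine ⟨(encodeNats l' ++ (Computability.encodeNat a).map some).map R.emb, R.emb none, ?_,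
        R.isSep_none⟩
      rw [h]
      simp [encodeNats]
  · exact R.isSep_map _
  · exact R.isSep_none
  · exact R.isOne_none
  · rw [countP_encodeNats, List.length_take]
    omega

/-- Horner's scheme from the most significant digit: after m rounds the accumulator is the number
divided by 2 ^ (|w| - m), truncated at |w|. Truncating in every round is the same as truncating once
at the end, since doubling and adding a digit are monotone and do not decrease the value. -/
theorem eval_num {l : List ℕ} {rest : List Γ} (hw : w = (encodeNats l).map R.emb ++ rest)
    (j : Tm Γ k) (hj : j.eval w v < l.length) :
    (R.num j).eval w v = min l[j.eval w v] w.length := by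
  rw [num, eval_comp₁]
  set i := j.eval w v with hi
  -- The digits of the number are part of the input, so |w| rounds suffice and the scheme starts
  -- from 0.
  have hlt : l[i] < 2 ^ w.length := by
    refine (lt_two_pow_encodeNat_length l[i]).trans_le (Nat.pow_le_pow_right (by norm_num) ?_)
    rw [hw, encodeNats_split hj]
    simp
    omega
  have key : ∀ m ≤ w.length, Nat.rec (motive := fun _ => ℕ) 0 (fun q acc =>
      (add (add (var 0) (var 0)) (R.bit (var 2) (pred (sub top (var 1)))) : Tm Γ 3).eval w
        (Matrix.vecCons acc (Matrix.vecCons q ![i]))) m =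
      min (l[i] / 2 ^ (w.length - m)) w.length := by
    intro m hm
    induction m with
    | zero => simp [Nat.div_eq_of_lt hlt]
    | succ m ih =>
      dsimp only
      rw [ih (by omega)]
      set A := l[i] / 2 ^ (w.length - m) with hA
      have hvar : ∀ a, (var 0 : Tm Γ 3).eval w (Matrix.vecCons (min A w.length) a) =
        min A w.length := fun a => rfl
      have hadd : ∀ a, (add (var 0) (var 0) : Tm Γ 3).eval w (Matrix.vecCons (min A w.length) a) =
          min (min A w.length + min A w.length) w.length := by
        intro a
        rw [eval_add _ _ (by rw [hvar]; omega), hvar]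
      rw [eval_add _ _ (by rw [hadd]; omega), hadd, eval_bit hw _ _ (by simpa [Tm.eval] using hj)]
      simp only [Tm.eval, eval_sub, Matrix.cons_val]
      obtain ⟨q, hq⟩ : ∃ q, w.length - m = q + 1 := ⟨w.length - m - 1, by omega⟩
      rw [show w.length - m - 1 = q by omega, show w.length - (m + 1) = q by omega]
      have h2 : l[i] / 2 ^ q = 2 * A + if l[i].testBit q then 1 else 0 := by
        rw [hA, hq, pow_succ, ← Nat.div_div_eq_div_mul, Nat.testBit_eq_decide_div_mod_eq]
        simp only [decide_eq_true_eq]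
        split_ifs <;> omega
      rw [h2]
      split_ifs <;> omega
  have := key w.length le_rfl
  simp only [Tm.eval] at this ⊢
  rw [this, Nat.sub_self, pow_zero, Nat.div_one]

end Reading

end Dodosp


namespace Dodosp

/-! ### Feasible plans in terms of run lengths -/

/-- The position of day `i` in its period. -/
def runLen (w : ℕ → Bool) : ℕ → ℕ
  | 0 => 1
  | i + 1 => if w (i + 1) = w i then runLen w i + 1 else 1

/-- The number of days worked before day `i`. -/
def worked (w : ℕ → Bool) : ℕ → ℕ
  | 0 => 0
  | i + 1 => worked w i + workOf (w i)

/-- The bounds for a plan, with periods described by their last days. -/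
def Instance.LocalFeasible (I : Instance) (w : ℕ → Bool) : Prop :=
  (∀ i < I.D, (i + 1 = I.D ∨ w (i + 1) ≠ w i) →
    I.lower (w i) ≤ runLen w i ∧ runLen w i ≤ I.upper (w i)) ∧
  worked w I.D ≤ I.Uw ∧ I.D ≤ worked w I.D + I.Uo

theorem runLen_pos (w : ℕ → Bool) (i : ℕ) : 1 ≤ runLen w i := by
  cases i with
  | zero => simp [runLen]
  | succ i => rw [runLen]; split_ifs <;> omega

theorem runLen_le (w : ℕ → Bool) (i : ℕ) : runLen w i ≤ i + 1 := by
  induction i with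
  | zero => simp [runLen]
  | succ i ih => rw [runLen]; split_ifs <;> omega

/-- This identifies the last `runLen w i` days up to `i` with the maximal constant stretch ending at
`i`, which links run lengths to periods. -/
theorem lt_add_runLen_iff (w : ℕ → Bool) {d i : ℕ} (hd : d ≤ i) :
    i < d + runLen w i ↔ ∀ j, d ≤ j → j ≤ i → w j = w i := by
  induction i with
  | zero =>
    obtain rfl : d = 0 := by omega
    simp [runLen]
  | succ i ih =>
    rcases Nat.lt_or_ge i d with h | h
    · obtain rfl : d = i + 1 := by omega
      have := runLen_pos w (i + 1)
      refine iff_of_true (by omega) fun j h1 h2 => ?_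
      rw [show j = i + 1 by omega]
    · rw [runLen]
      split_ifs with hw
      · rw [show i + 1 < d + (runLen w i + 1) ↔ i < d + runLen w i by omega, ih h]
        constructor
        · intro h1 j h2 h3
          rcases Nat.lt_or_ge i j with h4 | h4
          · rw [show j = i + 1 by omega]
          · rw [h1 j h2 h4, hw]
        · intro h1 j h2 h3
          rw [h1 j h2 (by omega), hw]
      · refine iff_of_false (by omega) fun h1 => hw ?_
        rw [h1 i h (by omega)]

theorem worked_eq_sum (w : ℕ → Bool) (n : ℕ) :
    worked w n = ∑ i ∈ Finset.range n, workOf (w i) := by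
  induction n with
  | zero => rfl
  | succ n ih => rw [worked, Finset.sum_range_succ, ih]

theorem card_on (w : ℕ → Bool) (n : ℕ) :
    (Finset.univ.filter fun d : Fin n => w d = true).card = worked w n := by
  rw [Finset.card_filter, worked_eq_sum, ← Fin.sum_univ_eq_sum_range (fun i => workOf (w i))]
  rfl

theorem card_off (w : ℕ → Bool) (n : ℕ) :
    (Finset.univ.filter fun d : Fin n => w d = false).card + worked w n = n := by
  rw [← card_on, add_comm]
  have := Finset.card_filter_add_card_filter_not (s := (Finset.univ : Finset (Fin n)))
    (fun d => w d = true)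
  simpa using this

theorem isPeriod_run {D : ℕ} (w : ℕ → Bool) {i : ℕ} (hi : i < D)
    (he : i + 1 = D ∨ w (i + 1) ≠ w i) :
    IsPeriod (fun d : Fin D => w d) (w i)
      (Finset.univ.filter fun d : Fin D => (d : ℕ) ≤ i ∧ i < d + runLen w i) := by
  refine ⟨⟨⟨⟨i, hi⟩, ?_⟩, ⟨?_⟩, ?_⟩, ?_⟩
  · have := runLen_pos w i
    simp; omega
  · rintro a ha b hb c ⟨hac, hcb⟩
    simp only [Finset.coe_filter, Finset.mem_univ, true_and, Set.mem_ofPred_eq] at ha hb ⊢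
    rw [Fin.le_def] at hac hcb
    omega
  · intro d hd
    simp only [Finset.mem_filter, Finset.mem_univ, true_and] at hd
    exact (lt_add_runLen_iff w hd.1).1 hd.2 d le_rfl hd.1
  · rintro T ⟨-, h2, h3⟩ hST d hd
    have hiT : (⟨i, hi⟩ : Fin D) ∈ T := hST (by
      have := runLen_pos w i
      simp; omega)
    have hle : (d : ℕ) ≤ i := by
      by_contra! hlt
      have h4 : (⟨i + 1, by omega⟩ : Fin D) ∈ T :=
        h2.out hiT hd ⟨by simp [Fin.le_def], by simp [Fin.le_def]; omega⟩
      rcases he with he | he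
      · omega
      · exact he (h3 _ h4)
    simp only [Finset.mem_filter, Finset.mem_univ, true_and]
    refine ⟨hle, (lt_add_runLen_iff w hle).2 fun j h5 h6 => ?_⟩
    exact h3 ⟨j, by omega⟩ (h2.out hd hiT ⟨h5, h6⟩)

theorem card_run {D : ℕ} (w : ℕ → Bool) {i : ℕ} (hi : i < D) :
    (Finset.univ.filter fun d : Fin D => (d : ℕ) ≤ i ∧ i < d + runLen w i).card = runLen w i := by
  have h1 := runLen_le w i
  have : (Finset.univ.filter fun d : Fin D => (d : ℕ) ≤ i ∧ i < d + runLen w i).map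
      Fin.valEmbedding = Finset.Ico (i + 1 - runLen w i) (i + 1) := by
    ext j
    simp only [Finset.mem_map, Finset.mem_filter, Finset.mem_univ, true_and, Fin.valEmbedding_apply,
      Finset.mem_Ico]
    constructor
    · rintro ⟨d, hd, rfl⟩
      omega
    · intro h
      exact ⟨⟨j, by omega⟩, by simp; omega, rfl⟩
  rw [← Finset.card_map Fin.valEmbedding, this, Nat.card_Ico]
  omega

/-- A period is determined by its last day: it cannot be continued to the right by maximality, it is
contained in the run ending there, and maximality gives equality. -/
theorem IsPeriod.exists_run {D : ℕ} {w : ℕ → Bool} {v : Bool} {S : Finset (Fin D)}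
    (h : IsPeriod (fun d : Fin D => w d) v S) :
    ∃ i < D, (i + 1 = D ∨ w (i + 1) ≠ w i) ∧ w i = v ∧ S.card = runLen w i := by
  obtain ⟨⟨h1, h2, h3⟩, hmax⟩ := h
  set m := S.max' h1
  have hm : m ∈ S := S.max'_mem h1
  have hmv : w m = v := h3 m hm
  have hend : (m : ℕ) + 1 = D ∨ w (m + 1) ≠ w m := by
    by_contra! hc
    have hlt : (m : ℕ) + 1 < D := by have := m.2; omega
    have hnot : (⟨m + 1, hlt⟩ : Fin D) ∉ S := fun hin => by
      have := S.le_max' _ hin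
      simp [Fin.le_def, m] at this
    -- If the plan kept its value on the next day, inserting that day would give a larger admissible
    -- set.
    refine hnot (hmax (y := insert ⟨m + 1, hlt⟩ S) ⟨⟨m, Finset.mem_insert_of_mem hm⟩, ⟨?_⟩, ?_⟩
      (Finset.subset_insert _ _) (Finset.mem_insert_self _ _))
    · rintro a ha b hb c ⟨hac, hcb⟩
      rw [Finset.mem_coe, Finset.mem_insert] at ha hb ⊢
      by_cases hcm : c = ⟨m + 1, hlt⟩
      · exact Or.inl hcm
      · right
        have hlb : (b : ℕ) ≤ m + 1 := by
          rcases hb with rfl | hb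
          · exact le_rfl
          · have := S.le_max' _ hb
            rw [Fin.le_def] at this
            omega
        have hcm' : (c : ℕ) ≠ m + 1 := fun h => hcm (Fin.ext h)
        rw [Fin.le_def] at hac hcb
        rcases ha with rfl | ha
        · exact absurd (le_antisymm (hcb.trans hlb) hac) hcm'
        · exact h2.out ha hm ⟨hac, by rw [Fin.le_def]; omega⟩
    · intro d hd
      rcases Finset.mem_insert.1 hd with rfl | hd
      · exact hc.2.trans hmv
      · exact h3 d hd
  refine ⟨m, m.2, hend, hmv, ?_⟩
  rw [← card_run w m.2]
  have hrun := isPeriod_run w m.2 hend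
  have hsub : S ≤ Finset.univ.filter fun d : Fin D => (d : ℕ) ≤ m ∧ (m : ℕ) < d + runLen w m := by
    intro d hd
    have hdm : (d : ℕ) ≤ m := S.le_max' _ hd
    simp only [Finset.mem_filter, Finset.mem_univ, true_and]
    refine ⟨hdm, (lt_add_runLen_iff w hdm).2 fun j h5 h6 => ?_⟩
    rw [hmv]
    exact h3 ⟨j, by have := m.2; omega⟩ (h2.out hd hm ⟨h5, h6⟩)
  congr 1
  exact le_antisymm hsub (hmax (hmv ▸ hrun.1) hsub)

/-- Periods correspond to their last days. Days off are the complement of days worked, so the bound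
on them becomes `I.D ≤ worked w I.D + I.Uo`. -/
theorem Instance.planFeasible_iff (I : Instance) (w : ℕ → Bool) :
    I.PlanFeasible (fun d => w d) ↔ I.LocalFeasible w := by
  have hoff := card_off w I.D
  have key : (∀ v S, IsPeriod (fun d : Fin I.D => w d) v S →
      I.lower v ≤ S.card ∧ S.card ≤ I.upper v) ↔
      ∀ i < I.D, (i + 1 = I.D ∨ w (i + 1) ≠ w i) →
        I.lower (w i) ≤ runLen w i ∧ runLen w i ≤ I.upper (w i) := by
    constructor
    · intro h i hi he
      have := h _ _ (isPeriod_run w hi he)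
      rwa [card_run w hi] at this
    · intro h v S hS
      obtain ⟨i, hi, he, rfl, hc⟩ := hS.exists_run
      rw [hc]
      exact h i hi he
  rw [Instance.LocalFeasible, ← key, Instance.PlanFeasible, card_on]
  constructor
  · rintro ⟨h1, h2, h3, h4⟩
    refine ⟨fun v => ?_, h3, by omega⟩
    cases v
    · exact h2
    · exact h1
  · rintro ⟨h1, h3, h4⟩
    exact ⟨h1 true, h1 false, h3, by omega⟩

/-- Extend a plan by days off. -/
def extend {D : ℕ} (w : Fin D → Bool) (i : ℕ) : Bool := if h : i < D then w ⟨i, h⟩ else false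

theorem extend_coe {D : ℕ} (w : Fin D → Bool) : (fun d : Fin D => extend w d) = w := by
  funext d
  simp [extend]

theorem Instance.planFeasible_iff_extend (I : Instance) (w : Fin I.D → Bool) :
    I.PlanFeasible w ↔ I.LocalFeasible (extend w) := by
  rw [← I.planFeasible_iff, extend_coe]

/-! ### Schedules as multisets of plans -/

/-- The number of workers on duty on day `d`, if `m w` workers have the plan `w`. -/
def onDuty {D : ℕ} (m : (Fin D → Bool) → ℕ) (d : Fin D) : ℕ := ∑ w, m w * workOf (w d)

/-- The multiplicities `m` of the plans describe a feasible schedule. -/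
structure Instance.IsSolution (I : Instance) (m : (Fin I.D → Bool) → ℕ) : Prop where
  plan : ∀ w, m w ≠ 0 → I.PlanFeasible w
  total : ∑ w, m w = I.N
  request : ∀ d, I.rl d ≤ onDuty m d ∧ onDuty m d ≤ I.ru d

theorem card_eq_sum_card_fiber {α : Type} [Fintype α] {D : ℕ} (f : α → Fin D → Bool)
    (d : Fin D) : (Finset.univ.filter fun i => f i d = true).card =
      onDuty (fun w => (Finset.univ.filter fun i => f i = w).card) d := by
  rw [Finset.card_eq_sum_card_fiberwise (f := f) (t := Finset.univ) (by simp), onDuty]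
  refine Finset.sum_congr rfl fun w _ => ?_
  rw [Finset.filter_filter]
  cases h : w d
  · rw [workOf, if_neg (by simp), mul_zero, Finset.card_eq_zero, Finset.filter_eq_empty_iff]
    rintro i - ⟨h1, rfl⟩
    rw [h1] at h
    exact absurd h (by simp)
  · rw [workOf, if_pos rfl, mul_one]
    congr 1
    ext i
    simp only [Finset.mem_filter, Finset.mem_univ, true_and, and_iff_right_iff_imp]
    rintro rfl
    exact h

/-- Feasibility depends only on how many workers follow each plan. Conversely, the disjoint union of
the sets `Fin (m w)` has N elements, and a bijection with the workers distributes the plans. -/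
theorem Instance.feasible_iff_exists_isSolution (I : Instance) :
    I.Feasible ↔ ∃ m, I.IsSolution m := by
  constructor
  · rintro ⟨f, h1, h2⟩
    refine ⟨fun w => (Finset.univ.filter fun i => f i = w).card, fun w hw => ?_, ?_, fun d => ?_⟩
    · obtain ⟨i, hi⟩ := Finset.card_ne_zero.1 hw
      rw [Finset.mem_filter] at hi
      exact hi.2 ▸ h2 i
    · rw [← Finset.card_eq_sum_card_fiberwise (by simp)]
      simp
    · rw [← card_eq_sum_card_fiber]
      exact h1 d
  · rintro ⟨m, h1, h2, h3⟩
    have hcard : Fintype.card (Fin I.N) = Fintype.card (Σ w, Fin (m w)) := by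
      simp [h2]
    let e := Fintype.equivOfCardEq hcard
    have hm : ∀ w, (Finset.univ.filter fun i => (e i).1 = w).card = m w := by
      intro w
      rw [← Fintype.card_fin (m w), ← Fintype.card_subtype]
      refine Fintype.card_congr ⟨fun x => x.2 ▸ (e x.1).2, fun a => ⟨e.symm ⟨w, a⟩, by simp⟩,
        ?_, ?_⟩
      · rintro ⟨i, rfl⟩
        simp
      · intro a
        have : ∀ (s : Σ w, Fin (m w)) (hs : s = ⟨w, a⟩) (h : s.1 = w), h ▸ s.2 = a := by
          rintro _ rfl h
          rfl
        exact this _ (by simp) _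
    refine ⟨fun i => (e i).1, fun d => ?_, fun i => h1 _ ?_⟩
    · rw [card_eq_sum_card_fiber (fun i => (e i).1)]
      simp only [hm]
      exact h3 d
    · exact ((Nat.zero_le _).trans_lt (e i).2.2).ne'

end Dodosp


namespace Dodosp

/-! ### Integral flows and plans -/

namespace Instance

variable (I : Instance)

theorem mem_vertices_state {d : ℕ} {on : Bool} {a b : ℕ} :
    Vertex.state d on a b ∈ I.vertices ↔ 1 ≤ d ∧ d ≤ I.D ∧ 1 ≤ a ∧ a ≤ d ∧ a ≤ I.upper on ∧
      b ≤ d ∧ d ≤ b + I.Uo ∧ b ≤ I.Uw ∧ (d = 1 → b = workOf on) := by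
  simp only [vertices, Finset.mem_union, Finset.mem_insert, reduceCtorEq, Finset.mem_singleton,
    or_self, Finset.mem_image, Finset.mem_filter, Finset.mem_product, Finset.mem_Icc,
    Finset.mem_univ, true_and, Finset.mem_range, Vertex.state.injEq, Prod.exists, false_or]
  constructor
  · rintro ⟨d, on, a, b, h, rfl, rfl, rfl, rfl⟩
    omega
  · intro h
    refine ⟨d, on, a, b, ?_, rfl, rfl, rfl, rfl⟩
    omega

theorem source_mem_vertices : Vertex.source ∈ I.vertices := by simp [vertices]

theorem sink_mem_vertices : Vertex.sink ∈ I.vertices := by simp [vertices]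

theorem mem_edges {u v : Vertex} :
    (u, v) ∈ I.edges ↔ u ∈ I.vertices ∧ v ∈ I.vertices ∧ I.Edge u v := by
  simp [edges, and_assoc]

/-- The vertices on the path of a plan. -/
def pathVertex (w : ℕ → Bool) : ℕ → Vertex
  | 0 => .source
  | i + 1 => if i < I.D then .state (i + 1) (w i) (runLen w i) (worked w (i + 1)) else .sink

/-- The unit flow along the path of a plan. -/
def pathFlow (w : ℕ → Bool) (u v : Vertex) : ℕ :=
  ∑ i ∈ Finset.range (I.D + 1), if u = I.pathVertex w i ∧ v = I.pathVertex w (i + 1) then 1 else 0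

theorem pathVertex_of_lt (w : ℕ → Bool) {i : ℕ} (hi : i < I.D) : I.pathVertex w (i + 1) =
    .state (i + 1) (w i) (runLen w i) (worked w (i + 1)) := by
  simp [pathVertex, hi]

theorem pathVertex_sink (w : ℕ → Bool) : I.pathVertex w (I.D + 1) = .sink := by
  simp [pathVertex]

end Instance

theorem runLen_congr {w w' : ℕ → Bool} {n : ℕ} (h : ∀ i ≤ n, w i = w' i) :
    runLen w n = runLen w' n := by
  induction n with
  | zero => rfl
  | succ n ih =>
    rw [runLen, runLen, h _ le_rfl, h n (by omega), ih fun i hi => h i (by omega)]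

theorem worked_congr {w w' : ℕ → Bool} {n : ℕ} (h : ∀ i < n, w i = w' i) :
    worked w n = worked w' n := by
  induction n with
  | zero => rfl
  | succ n ih => rw [worked, worked, h n (by omega), ih fun i hi => h i (by omega)]

theorem workOf_le_one (b : Bool) : workOf b ≤ 1 := by cases b <;> simp [workOf]

theorem worked_le_add (w : ℕ → Bool) (n k : ℕ) :
    worked w n ≤ worked w (n + k) ∧ worked w (n + k) ≤ worked w n + k := by
  induction k with
  | zero => simp
  | succ k ih =>
    rw [← add_assoc, worked]
    have := workOf_le_one (w (n + k))
    omega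

namespace Instance

variable {I : Instance}

theorem pathVertex_congr {w w' : ℕ → Bool} {n : ℕ} (h : ∀ i < n, i < I.D → w i = w' i) :
    I.pathVertex w n = I.pathVertex w' n := by
  cases n with
  | zero => rfl
  | succ n =>
    rw [pathVertex, pathVertex]
    split_ifs with hn
    · rw [h n (by omega) hn, runLen_congr fun i hi => h i (by omega) (by omega),
        worked_congr fun i hi => h i hi (by omega)]
    · rfl

/-- Vertices of different layers differ, because a state records its day. Hence a path uses each
edge at most once. -/
theorem pathVertex_injective {w : ℕ → Bool} {i j : ℕ} (hi : i ≤ I.D + 1) (hj : j ≤ I.D + 1)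
    (h : I.pathVertex w i = I.pathVertex w j) : i = j := by
  cases i <;> cases j <;> simp only [pathVertex] at h
  · rfl
  · split_ifs at h
  · split_ifs at h
  · split_ifs at h
    · simp only [Vertex.state.injEq] at h
      exact h.1
    · omega

theorem pathFlow_le_one (w : ℕ → Bool) (u v : Vertex) : I.pathFlow w u v ≤ 1 := by
  rw [pathFlow, ← Finset.card_filter, Finset.card_le_one]
  intro i hi j hj
  simp only [Finset.mem_filter, Finset.mem_range] at hi hj
  exact pathVertex_injective (w := w) (by omega) (by omega) (hi.2.1.symm.trans hj.2.1)

theorem pathFlow_ne_zero {w : ℕ → Bool} {u v : Vertex} (h : I.pathFlow w u v ≠ 0) :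
    ∃ i ≤ I.D, u = I.pathVertex w i ∧ v = I.pathVertex w (i + 1) := by
  obtain ⟨i, hi, h'⟩ := Finset.exists_ne_zero_of_sum_ne_zero h
  refine ⟨i, by simpa [Nat.lt_succ_iff] using hi, ?_⟩
  by_contra hc
  exact h' (if_neg hc)

/-- Within a period the run length grows until the last day, where the upper bound is imposed; the
induction runs backwards from the end of the horizon. -/
theorem runLen_le_upper {w : ℕ → Bool} (hw : I.LocalFeasible w) {i : ℕ} (hi : i < I.D) :
    runLen w i ≤ I.upper (w i) := by
  obtain ⟨k, hk⟩ : ∃ k, I.D = i + 1 + k := ⟨I.D - i - 1, by omega⟩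
  induction k generalizing i with
  | zero => exact (hw.1 i hi (Or.inl hk.symm)).2
  | succ k ih =>
    by_cases h : w (i + 1) = w i
    · have := ih (show i + 1 < I.D by omega) (by omega)
      rw [runLen, if_pos h, h] at this
      omega
    · exact (hw.1 i hi (Or.inr h)).2

theorem pathVertex_mem {w : ℕ → Bool} (hw : I.LocalFeasible w) (i : ℕ) :
    I.pathVertex w i ∈ I.vertices := by
  cases i with
  | zero => exact I.source_mem_vertices
  | succ i =>
    rcases Nat.lt_or_ge i I.D with hi | hi
    · rw [pathVertex_of_lt _ _ hi, mem_vertices_state]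
      obtain ⟨k, hk⟩ : ∃ k, I.D = i + 1 + k := ⟨I.D - i - 1, by omega⟩
      -- The global bounds hold for every prefix: the remaining `k` days do not decrease the number
      -- of days worked and increase it by at most `k`.
      have h1 := worked_le_add w 0 (i + 1)
      have h2 := worked_le_add w (i + 1) k
      rw [← hk] at h2
      rw [zero_add] at h1
      have ⟨_, h3, h4⟩ := hw
      have h0 : worked w 0 = 0 := rfl
      refine ⟨by omega, by omega, runLen_pos w i, runLen_le w i, runLen_le_upper hw hi, by omega,
        by omega, by omega, fun h => ?_⟩
      obtain rfl : i = 0 := by omega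
      simp [worked]
    · rw [pathVertex, if_neg (by omega)]
      exact I.sink_mem_vertices

theorem pathVertex_edge (hD : 1 ≤ I.D) {w : ℕ → Bool} (hw : I.LocalFeasible w) {i : ℕ}
    (hi : i ≤ I.D) : (I.pathVertex w i, I.pathVertex w (i + 1)) ∈ I.edges := by
  rw [mem_edges]
  refine ⟨pathVertex_mem hw i, pathVertex_mem hw (i + 1), ?_⟩
  cases i with
  | zero =>
    rw [pathVertex_of_lt _ _ (by omega)]
    simp [pathVertex, Edge]
  | succ i =>
    rw [pathVertex_of_lt _ _ (by omega)]
    rcases Nat.lt_or_ge (i + 1) I.D with hi' | hi'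
    · rw [pathVertex_of_lt _ _ hi']
      refine ⟨rfl, rfl, ?_⟩
      by_cases h : w (i + 1) = w i
      · left
        exact ⟨h, by rw [runLen, if_pos h]⟩
      · right
        exact ⟨h, (hw.1 i (by omega) (Or.inr h)).1, by rw [runLen, if_neg h]⟩
    · have hD' : i + 1 = I.D := by omega
      rw [pathVertex, if_neg (by omega)]
      exact ⟨hD', (hw.1 i (by omega) (Or.inl hD')).1⟩

theorem pathFlow_inflow {w : ℕ → Bool} (hw : I.LocalFeasible w) (v : Vertex) :
    ∑ u ∈ I.vertices, I.pathFlow w u v =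
      ∑ i ∈ Finset.range (I.D + 1), if v = I.pathVertex w (i + 1) then 1 else 0 := by
  simp only [pathFlow]
  rw [Finset.sum_comm]
  refine Finset.sum_congr rfl fun i _ => ?_
  split_ifs with h
  · simp [h, pathVertex_mem hw i]
  · simp [h]

theorem pathFlow_outflow {w : ℕ → Bool} (hw : I.LocalFeasible w) (u : Vertex) :
    ∑ v ∈ I.vertices, I.pathFlow w u v =
      ∑ i ∈ Finset.range (I.D + 1), if u = I.pathVertex w i then 1 else 0 := by
  simp only [pathFlow]
  rw [Finset.sum_comm]
  refine Finset.sum_congr rfl fun i _ => ?_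
  split_ifs with h
  · simp [h, pathVertex_mem hw (i + 1)]
  · simp [h]

/-- Inflow and outflow of a vertex count its occurrences among the heads and the tails of the path
edges. These two lists differ by a shift, hence only in the source and the sink. -/
theorem isFlow_pathFlow (hD : 1 ≤ I.D) {w : ℕ → Bool} (hw : I.LocalFeasible w) :
    I.IsFlow (I.pathFlow w) 1 where
  support u v h := by
    obtain ⟨i, hi, rfl, rfl⟩ := pathFlow_ne_zero h
    exact pathVertex_edge hD hw hi
  conservation v _ h1 h2 := by
    rw [pathFlow_inflow hw, pathFlow_outflow hw, Finset.sum_range_succ, Finset.sum_range_succ',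
      pathVertex_sink, if_neg h2, if_neg (show ¬ v = I.pathVertex w 0 from h1)]
  value := by
    rw [pathFlow_outflow hw, Finset.sum_range_succ', if_pos (show Vertex.source = I.pathVertex w 0 from rfl),
      Finset.sum_eq_zero, zero_add]
    intro i _
    rw [pathVertex]
    split_ifs <;> simp_all

theorem onThroughput_pathFlow {w : ℕ → Bool} (hw : I.LocalFeasible w) {j : ℕ} (hj : j < I.D) :
    I.onThroughput (I.pathFlow w) (j + 1) = workOf (w j) := by
  classical
  rw [onThroughput]
  simp only [pathFlow_inflow hw]
  rw [Finset.sum_comm, Finset.sum_eq_single j]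
  · rw [Finset.sum_ite_eq']
    simp only [Finset.mem_filter, pathVertex_mem hw, true_and]
    rw [pathVertex_of_lt _ _ hj]
    simp [Vertex.IsOn, workOf]
  · intro i _ hij
    rw [Finset.sum_ite_eq', if_neg]
    simp only [Finset.mem_filter, pathVertex_mem hw, true_and]
    rw [pathVertex]
    split_ifs
    · simp [Vertex.IsOn, hij]
    · simp [Vertex.IsOn]
  · simp; omega

/-- The flow for a multiset of plans. -/
def solutionFlow (m : (Fin I.D → Bool) → ℕ) (u v : Vertex) : ℕ :=
  ∑ w, m w * I.pathFlow (extend w) u v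

theorem isFlow_solutionFlow (hD : 1 ≤ I.D) {m : (Fin I.D → Bool) → ℕ}
    (hm : ∀ w, m w ≠ 0 → I.PlanFeasible w) : I.IsFlow (I.solutionFlow m) (∑ w, m w) where
  support u v h := by
    obtain ⟨w, -, hw⟩ := Finset.exists_ne_zero_of_sum_ne_zero h
    rw [Nat.mul_ne_zero_iff] at hw
    exact (isFlow_pathFlow hD ((I.planFeasible_iff_extend w).1 (hm w hw.1))).support u v hw.2
  conservation v hv h1 h2 := by
    simp only [solutionFlow]
    rw [Finset.sum_comm, Finset.sum_comm (s := I.vertices)]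
    refine Finset.sum_congr rfl fun w _ => ?_
    rw [← Finset.mul_sum, ← Finset.mul_sum]
    by_cases hw : m w = 0
    · simp [hw]
    · rw [(isFlow_pathFlow hD ((I.planFeasible_iff_extend w).1 (hm w hw))).conservation v hv h1 h2]
  value := by
    simp only [solutionFlow]
    rw [Finset.sum_comm]
    refine Finset.sum_congr rfl fun w _ => ?_
    rw [← Finset.mul_sum]
    by_cases hw : m w = 0
    · simp [hw]
    · rw [(isFlow_pathFlow hD ((I.planFeasible_iff_extend w).1 (hm w hw))).value, mul_one]

theorem onThroughput_solutionFlow {m : (Fin I.D → Bool) → ℕ}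
    (hm : ∀ w, m w ≠ 0 → I.PlanFeasible w) (d : Fin I.D) :
    I.onThroughput (I.solutionFlow m) (d + 1) = onDuty m d := by
  classical
  have : I.onThroughput (I.solutionFlow m) (d + 1) =
      ∑ w, m w * I.onThroughput (I.pathFlow (extend w)) (d + 1) := by
    simp only [onThroughput, solutionFlow, Finset.mul_sum]
    rw [Finset.sum_comm (s := Finset.univ)]
    refine Finset.sum_congr rfl fun v _ => Finset.sum_comm
  rw [this, onDuty]
  refine Finset.sum_congr rfl fun w _ => ?_
  by_cases hw : m w = 0
  · simp [hw]
  · rw [onThroughput_pathFlow ((I.planFeasible_iff_extend w).1 (hm w hw)) d.2]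
    simp [extend]

end Instance

end Dodosp


namespace Dodosp

/-! ### Decomposition of integral flows into paths, and the size of the network -/

namespace Instance

variable {I : Instance}

theorem IsFlow.not_edge_source {f : Vertex → Vertex → ℕ} {k : ℕ} (hf : I.IsFlow f k) (u : Vertex) :
    f u .source = 0 := by
  by_contra h
  have := (I.mem_edges.1 (hf.support _ _ h)).2.2
  cases u <;> simp [Edge] at this

/-- There are no circulations: if nothing leaves the source, conservation shows by induction on the
day that nothing enters any state, and then nothing enters the sink. -/
theorem IsFlow.eq_zero {f : Vertex → Vertex → ℕ} (hf : I.IsFlow f 0) (u v : Vertex) :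
    f u v = 0 := by
  have hsrc : ∀ v, f .source v = 0 := by
    intro v
    by_contra h
    have hv := (I.mem_edges.1 (hf.support _ _ h)).2.1
    exact h (Finset.sum_eq_zero_iff.1 hf.value v hv)
  have hout : ∀ u, u ∈ I.vertices → u ≠ .sink → (∀ x, f x u = 0) → ∀ v, f u v = 0 := by
    intro u hu h2 h3 v
    by_cases h1 : u = .source
    · exact h1 ▸ hsrc v
    by_contra h
    have hv := (I.mem_edges.1 (hf.support _ _ h)).2.1
    have h4 := hf.conservation u hu h1 h2
    rw [Finset.sum_eq_zero fun x _ => h3 x] at h4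
    exact h (Finset.sum_eq_zero_iff.1 h4.symm v hv)
  have hstate : ∀ n u on a b, f u (.state n on a b) = 0 := by
    intro n
    induction n with
    | zero =>
      intro u on a b
      by_contra h
      have := I.mem_vertices_state.1 (I.mem_edges.1 (hf.support _ _ h)).2.1
      omega
    | succ n ih =>
      intro u on a b
      by_contra h
      obtain ⟨hu, -, he⟩ := I.mem_edges.1 (hf.support _ _ h)
      cases u with
      | source => exact h (hsrc _)
      | sink => exact he
      | state d on' a' b' =>
        obtain ⟨h1, -⟩ := he
        obtain rfl : n = d := by omega
        exact h (hout _ hu (by simp) (fun x => ih x _ _ _) _)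
  cases v with
  | source => exact hf.not_edge_source u
  | state d on a b => exact hstate _ _ _ _ _
  | sink =>
    by_contra h
    obtain ⟨hu, -, he⟩ := I.mem_edges.1 (hf.support _ _ h)
    cases u with
    | source => exact h (hsrc _)
    | sink => exact he
    | state d on a b => exact h (hout _ hu (by simp) (fun x => hstate _ x _ _ _) _)

theorem IsFlow.exists_out {f : Vertex → Vertex → ℕ} {k : ℕ} (hf : I.IsFlow f k) {u v : Vertex}
    (h : f u v ≠ 0) (hv : v ≠ .sink) : ∃ x, f v x ≠ 0 := by
  obtain ⟨hu, hv', -⟩ := I.mem_edges.1 (hf.support _ _ h)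
  by_contra! h0
  have h1 := hf.conservation v hv' (by rintro rfl; exact h (hf.not_edge_source u)) hv
  rw [Finset.sum_eq_zero fun x _ => h0 x] at h1
  exact h (Finset.sum_eq_zero_iff.1 h1 u hu)

/-- Positive edges are followed from the source; by conservation one can continue from every vertex
reached other than the sink. The edge rules force position and days worked, so recording the shifts
alone recovers the path. -/
theorem IsFlow.exists_path {f : Vertex → Vertex → ℕ} {k : ℕ} (hf : I.IsFlow f (k + 1))
    (hD : 1 ≤ I.D) : ∃ w : ℕ → Bool, ∀ i ≤ I.D, f (I.pathVertex w i) (I.pathVertex w (i + 1)) ≠ 0 := by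
  have step : ∀ n < I.D, ∃ w : ℕ → Bool,
      ∀ i ≤ n, f (I.pathVertex w i) (I.pathVertex w (i + 1)) ≠ 0 := by
    intro n hn
    induction n with
    | zero =>
      obtain ⟨v, hv, h⟩ := Finset.exists_ne_zero_of_sum_ne_zero
        (s := I.vertices) (f := fun v => f .source v) (by rw [hf.value]; omega)
      have he := (I.mem_edges.1 (hf.support _ _ h)).2.2
      cases v with
      | source => exact he.elim
      | sink => exact he.elim
      | state d on a b =>
        have hm := I.mem_vertices_state.1 hv
        obtain rfl : d = 1 := he
        -- On day 1 only position 1 and the matching number of days worked are admitted, so the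
        -- first vertex is the one prescribed by the plan.
        obtain ⟨-, -, h1, h2, -, -, -, -, h3⟩ := hm
        obtain rfl : a = 1 := by omega
        obtain rfl := h3 rfl
        refine ⟨fun _ => on, fun i hi => ?_⟩
        obtain rfl : i = 0 := by omega
        rw [pathVertex_of_lt _ _ hD]
        simpa [pathVertex, runLen, worked] using h
    | succ n ih =>
      obtain ⟨w, hw⟩ := ih (by omega)
      have hP := pathVertex_of_lt I w (show n < I.D by omega)
      have hn' := hw n le_rfl
      rw [hP] at hn'
      obtain ⟨v, hv⟩ := hf.exists_out hn' (by simp)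
      obtain ⟨-, hvm, he⟩ := I.mem_edges.1 (hf.support _ _ hv)
      cases v with
      | source => exact he.elim
      | sink =>
        have := he.1
        omega
      | state d on a b =>
        obtain ⟨rfl, rfl, he⟩ := he
        -- The new value affects indices above `n` only, so the part of the path already constructed
        -- is unchanged.
        refine ⟨fun i => if i ≤ n then w i else on, fun i hi => ?_⟩
        have hc : ∀ j ≤ n + 1, I.pathVertex (fun i => if i ≤ n then w i else on) j =
            I.pathVertex w j := fun j hj => pathVertex_congr fun i hi _ => if_pos (by omega)
        rw [hc i hi]
        rcases Nat.lt_or_ge i (n + 1) with h | h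
        · rw [hc (i + 1) h]
          exact hw i (by omega)
        · obtain rfl : i = n + 1 := by omega
          have hwk : worked (fun i => if i ≤ n then w i else on) (n + 1 + 1) =
              worked w (n + 1) + workOf on := by
            rw [worked, worked_congr (w' := w) (n := n + 1) fun i hi => if_pos (by omega)]
            simp
          rw [hP, pathVertex_of_lt _ _ (by omega), runLen,
            runLen_congr (w' := w) (n := n) fun i hi => if_pos (by omega), hwk]
          simp only [le_refl, if_true, Nat.not_succ_le_self, if_false]
          rcases he with ⟨rfl, rfl⟩ | ⟨h1, -, rfl⟩
          · simpa using hv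
          · simpa [h1] using hv
  obtain ⟨w, hw⟩ := step (I.D - 1) (by omega)
  refine ⟨w, fun i hi => ?_⟩
  rcases Nat.lt_or_ge i I.D with h | h
  · exact hw i (by omega)
  · have hi' : i = I.D - 1 + 1 := by omega
    have hl := hw (I.D - 1) le_rfl
    subst hi'
    have hP := pathVertex_of_lt I w (show I.D - 1 < I.D by omega)
    rw [hP] at hl ⊢
    obtain ⟨v, hv⟩ := hf.exists_out hl (by simp)
    obtain ⟨-, hvm, he⟩ := I.mem_edges.1 (hf.support _ _ hv)
    rw [pathVertex, if_neg (by omega)]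
    cases v with
    | source => exact he.elim
    | sink => exact hv
    | state d on a b =>
      have := I.mem_vertices_state.1 hvm
      have := he.1
      omega

/-- Lower bounds come from the edges that leave the last state of a period, upper bounds from
membership of states in the network, and the global bounds from the state of the last day. -/
theorem localFeasible_of_path {w : ℕ → Bool} (hD : 1 ≤ I.D)
    (h : ∀ i ≤ I.D, (I.pathVertex w i, I.pathVertex w (i + 1)) ∈ I.edges) : I.LocalFeasible w := by
  have hv : ∀ i < I.D, Vertex.state (i + 1) (w i) (runLen w i) (worked w (i + 1)) ∈ I.vertices := by
    intro i hi
    have := (I.mem_edges.1 (h i (by omega))).2.1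
    rwa [pathVertex_of_lt _ _ hi] at this
  refine ⟨fun i hi he => ⟨?_, (I.mem_vertices_state.1 (hv i hi)).2.2.2.2.1⟩, ?_⟩
  · have := (I.mem_edges.1 (h (i + 1) (by omega))).2.2
    rw [pathVertex_of_lt _ _ hi] at this
    rcases Nat.lt_or_ge (i + 1) I.D with hi' | hi'
    · rw [pathVertex_of_lt _ _ hi'] at this
      rcases this.2.2 with h1 | h1
      · rcases he with he | he
        · omega
        · exact absurd h1.1 he
      · exact h1.2.1
    · rw [pathVertex, if_neg (by omega)] at this
      exact this.2
  · have := I.mem_vertices_state.1 (hv (I.D - 1) (by omega))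
    rw [show I.D - 1 + 1 = I.D by omega] at this
    omega

/-- Induction on the value: a positive path is subtracted and its plan counted once more. The
equation `f = I.solutionFlow m` is part of the claim because throughputs are then read off from the
plans. -/
theorem IsFlow.exists_solution {f : Vertex → Vertex → ℕ} {k : ℕ} (hf : I.IsFlow f k)
    (hD : 1 ≤ I.D) : ∃ m : (Fin I.D → Bool) → ℕ, (∀ w, m w ≠ 0 → I.PlanFeasible w) ∧
      ∑ w, m w = k ∧ f = I.solutionFlow m := by
  classical
  induction k generalizing f with
  | zero =>
    refine ⟨0, by simp, by simp, ?_⟩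
    funext u v
    simp [hf.eq_zero, solutionFlow]
  | succ k ih =>
    obtain ⟨w, hw⟩ := hf.exists_path hD
    have hlf : I.LocalFeasible w := localFeasible_of_path hD fun i hi => hf.support _ _ (hw i hi)
    have hle : ∀ u v, I.pathFlow w u v ≤ f u v := by
      intro u v
      by_cases h : I.pathFlow w u v = 0
      · omega
      · obtain ⟨i, hi, rfl, rfl⟩ := pathFlow_ne_zero h
        have h1 := I.pathFlow_le_one w (I.pathVertex w i) (I.pathVertex w (i + 1))
        have h2 := hw i hi
        omega
    -- Writing the flow as a sum avoids truncated subtraction in the conservation equations.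
    obtain ⟨g, rfl⟩ : ∃ g : Vertex → Vertex → ℕ, f = fun u v => g u v + I.pathFlow w u v :=
      ⟨fun u v => f u v - I.pathFlow w u v, by
        funext u v
        exact (Nat.sub_add_cancel (hle u v)).symm⟩
    have hp := isFlow_pathFlow hD hlf
    have hg : I.IsFlow g k := by
      refine ⟨fun u v h => hf.support u v (by omega), fun v hv h1 h2 => ?_, ?_⟩
      · have h3 := hf.conservation v hv h1 h2
        rw [Finset.sum_add_distrib, Finset.sum_add_distrib, hp.conservation v hv h1 h2] at h3
        omega
      · have h3 := hf.value
        rw [Finset.sum_add_distrib, hp.value] at h3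
        omega
    obtain ⟨m, h1, h2, h3⟩ := ih hg
    set w₀ : Fin I.D → Bool := fun d => w d with hw₀
    have hpath : I.pathFlow (extend w₀) = I.pathFlow w := by
      have hc : ∀ j, I.pathVertex (extend w₀) j = I.pathVertex w j := fun j =>
        pathVertex_congr fun i _ hi => by simp [extend, hi, hw₀]
      funext u v
      simp [pathFlow, hc]
    refine ⟨fun x => m x + if x = w₀ then 1 else 0, fun x hx => ?_, ?_, ?_⟩
    · by_cases h : x = w₀
      · rw [h]
        exact (I.planFeasible_iff w).2 hlf
      · exact h1 x (by simpa [h] using hx)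
    · rw [Finset.sum_add_distrib, h2]
      simp
    · funext u v
      simp only [solutionFlow, add_mul, Finset.sum_add_distrib, ite_mul, one_mul, zero_mul,
        Finset.sum_ite_eq', Finset.mem_univ, if_true, hpath]
      rw [h3]
      rfl

theorem feasible_iff_exists_isCertificate (hD : 1 ≤ I.D) :
    I.Feasible ↔ ∃ f, I.IsCertificate f := by
  rw [I.feasible_iff_exists_isSolution]
  constructor
  · rintro ⟨m, h1, h2, h3⟩
    refine ⟨I.solutionFlow m, h2 ▸ isFlow_solutionFlow hD h1, fun d => ?_⟩
    rw [onThroughput_solutionFlow h1]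
    exact h3 d
  · rintro ⟨f, hf, h⟩
    obtain ⟨m, h1, h2, rfl⟩ := hf.exists_solution hD
    refine ⟨m, h1, h2, fun d => ?_⟩
    rw [← onThroughput_solutionFlow h1]
    exact h d

/-- Each of the k paths in a decomposition uses a given edge at most once. -/
theorem IsFlow.le {f : Vertex → Vertex → ℕ} {k : ℕ} (hf : I.IsFlow f k) (hD : 1 ≤ I.D)
    (u v : Vertex) : f u v ≤ k := by
  obtain ⟨m, -, rfl, rfl⟩ := hf.exists_solution hD
  refine Finset.sum_le_sum fun w _ => ?_
  have := Nat.mul_le_mul_left (m w) (I.pathFlow_le_one (extend w) u v)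
  omega

theorem RequestFree.feasible_iff_exists_isFlow (h : I.RequestFree) (hD : 1 ≤ I.D) :
    I.Feasible ↔ ∃ f, I.IsFlow f I.N := by
  constructor
  · intro hf
    obtain ⟨f, hf⟩ := (feasible_iff_exists_isCertificate hD).1 hf
    exact ⟨f, hf.1⟩
  · rintro ⟨f, hf⟩
    obtain ⟨m, h1, h2, -⟩ := hf.exists_solution hD
    refine I.feasible_iff_exists_isSolution.2 ⟨m, h1, h2, fun d => ?_⟩
    rw [(h d).1, (h d).2, ← h2]
    refine ⟨Nat.zero_le _, Finset.sum_le_sum fun w _ => ?_⟩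
    have := Nat.mul_le_mul_left (m w) (workOf_le_one (w d))
    omega

/-! ### The size of the network -/

theorem card_vertices_le (hD : 1 ≤ I.D) : I.vertices.card ≤ 6 * I.D ^ 3 := by
  -- For D = 1 this bound equals 6, which fixes the constant.
  have h1 : I.vertices.card ≤ 2 + I.D * (2 * (I.D * (I.D + 1))) := by
    refine (Finset.card_union_le _ _).trans (Nat.add_le_add ?_ ?_)
    · exact Finset.card_le_two
    · refine Finset.card_image_le.trans ((Finset.card_filter_le _ _).trans ?_)
      simp
  refine h1.trans ?_
  obtain ⟨n, hn⟩ : ∃ n, I.D = n + 1 := ⟨I.D - 1, by omega⟩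
  rw [hn]
  ring_nf
  nlinarith [Nat.zero_le n, Nat.zero_le (n ^ 2), Nat.zero_le (n ^ 3)]

/-- The possible successors of a vertex: the sink, and one state for each shift. -/
def successor : Vertex → Option Bool → Vertex
  | _, none => .sink
  | .source, some on => .state 1 on 1 (workOf on)
  | .sink, some _ => .sink
  | .state d on a b, some on' =>
    .state (d + 1) on' (if on' = on then a + 1 else 1) (b + workOf on')

theorem card_edges_le (hD : 1 ≤ I.D) : I.edges.card ≤ 18 * I.D ^ 3 := by
  classical
  have hsub : I.edges ⊆ (I.vertices ×ˢ (Finset.univ : Finset (Option Bool))).image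
      fun x => (x.1, successor x.1 x.2) := by
    rintro ⟨u, v⟩ huv
    obtain ⟨hu, hv, he⟩ := I.mem_edges.1 huv
    rw [Finset.mem_image]
    suffices h : ∃ o, v = successor u o by
      obtain ⟨o, rfl⟩ := h
      exact ⟨(u, o), by simp [hu], rfl⟩
    cases u with
    | sink => exact he.elim
    | source =>
      cases v with
      | source => exact he.elim
      | sink => exact he.elim
      | state d on a b =>
        obtain rfl : d = 1 := he
        obtain ⟨-, -, h1, h2, -, -, -, -, h3⟩ := I.mem_vertices_state.1 hv
        refine ⟨some on, ?_⟩
        rw [successor, h3 rfl, show a = 1 by omega]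
    | state d on a b =>
      cases v with
      | source => exact he.elim
      | sink => exact ⟨none, rfl⟩
      | state d' on' a' b' =>
        obtain ⟨rfl, rfl, h⟩ := he
        refine ⟨some on', ?_⟩
        rw [successor]
        rcases h with ⟨h1, h2⟩ | ⟨h1, -, h2⟩
        · rw [if_pos h1, h2]
        · rw [if_neg h1, h2]
  refine (Finset.card_le_card hsub).trans (Finset.card_image_le.trans ?_)
  rw [Finset.card_product]
  have := card_vertices_le hD
  simp
  omega

end Instance

end Dodosp


namespace Dodosp

/-! ### Instances without requests -/

namespace Instance

variable {I : Instance}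

/-- `c` periods of type `v` can fill exactly `T` days. -/
def Fits (I : Instance) (v : Bool) (c T : ℕ) : Prop :=
  c ≤ T ∧ c * I.lower v ≤ T ∧ T ≤ c * I.upper v

theorem fits_zero (v : Bool) : I.Fits v 0 0 := by simp [Fits]

theorem Fits.succ {v : Bool} {c T r : ℕ} (h : I.Fits v c T) (h0 : 1 ≤ r) (h1 : I.lower v ≤ r)
    (h2 : r ≤ I.upper v) : I.Fits v (c + 1) (T + r) := by
  obtain ⟨h3, h4, h5⟩ := h
  refine ⟨by omega, ?_, ?_⟩ <;> rw [Nat.succ_mul] <;> omega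

/-- One period can be split off from a total that is within range. Periods are nonempty, so the
effective lower bound is the maximum `l` of 1 and the given one. -/
theorem Fits.exists_pred {v : Bool} {c T : ℕ} (h : I.Fits v (c + 1) T) :
    ∃ r S, T = S + r ∧ 1 ≤ r ∧ I.lower v ≤ r ∧ r ≤ I.upper v ∧ I.Fits v c S := by
  obtain ⟨h1, h2, h3⟩ := h
  obtain ⟨l, hl⟩ : ∃ l, l = max 1 (I.lower v) := ⟨_, rfl⟩
  have h4 : (c + 1) * l ≤ T := by
    rw [hl]
    rcases le_total 1 (I.lower v) with h | h
    · rwa [max_eq_right h]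
    · rwa [max_eq_left h, mul_one]
  have hlu : l ≤ I.upper v := Nat.le_of_mul_le_mul_left (h4.trans h3) (Nat.succ_pos c)
  have h5 := Nat.mul_le_mul_left c hlu
  have h6 : c * I.lower v ≤ c * l := Nat.mul_le_mul_left c (by omega)
  have h7 : c ≤ c * l := Nat.le_mul_of_pos_right c (by omega)
  rw [Nat.succ_mul] at h3 h4
  -- The shortest admissible period that leaves at most `c * I.upper v` days for the others; being
  -- shortest, it also leaves enough days for their lower bounds.
  refine ⟨max l (T - c * I.upper v), T - max l (T - c * I.upper v), ?_⟩
  unfold Fits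
  omega

/-- The plan `w` of `n` days meets the bounds for its periods. -/
def PeriodsFit (I : Instance) (w : ℕ → Bool) (n : ℕ) : Prop :=
  ∀ i < n, (i + 1 = n ∨ w (i + 1) ≠ w i) →
    I.lower (w i) ≤ runLen w i ∧ runLen w i ≤ I.upper (w i)

theorem runLen_append (w : ℕ → Bool) {v : Bool} {n : ℕ} (h : n = 0 ∨ w (n - 1) ≠ v) (k : ℕ) :
    runLen (fun i => if i < n then w i else v) (n + k) = k + 1 := by
  induction k with
  | zero =>
    rcases n with _ | n
    · rfl
    · have h' : w n ≠ v := by simpa using h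
      simp [runLen, h'.symm]
  | succ k ih => rw [← add_assoc, runLen, ih]; simp [add_assoc]

theorem worked_append (w : ℕ → Bool) (v : Bool) (n k : ℕ) :
    worked (fun i => if i < n then w i else v) (n + k) = worked w n + k * workOf v := by
  induction k with
  | zero => simpa using worked_congr fun i hi => if_pos hi
  | succ k ih => rw [← add_assoc, worked, ih]; simp [Nat.succ_mul, add_assoc]

/-- The plan ends with type `v`, unless it is empty. The last period is split off and the roles of
the two types are exchanged; the inequalities between the counts say precisely that types alternate
and `v` comes last. -/
theorem exists_periodsFit (v : Bool) (c c' T T' : ℕ) (h1 : c' ≤ c) (h2 : c ≤ c' + 1)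
    (h : I.Fits v c T) (h' : I.Fits (!v) c' T') :
    ∃ w : ℕ → Bool, I.PeriodsFit w (T + T') ∧ (T + T' = 0 ∨ w (T + T' - 1) = v) ∧
      worked w (T + T') = T * workOf v + T' * workOf (!v) := by
  induction hn : c + c' generalizing v c c' T T' with
  | zero =>
    obtain rfl : c = 0 := by omega
    obtain rfl : c' = 0 := by omega
    have h3 := h.2.2
    have h4 := h'.2.2
    rw [zero_mul] at h3 h4
    obtain rfl : T = 0 := by omega
    obtain rfl : T' = 0 := by omega
    exact ⟨fun _ => v, fun i hi => by omega, Or.inl rfl, by simp [worked]⟩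
  | succ n ih =>
    obtain ⟨c, rfl⟩ : ∃ b, c = b + 1 := ⟨c - 1, by omega⟩
    obtain ⟨r, S, rfl, h3, h4, h5, h6⟩ := h.exists_pred
    obtain ⟨w, hw, hlast, hwork⟩ := ih (!v) c' c T' S (by omega) (by omega) h' (by simpa using h6)
      (by omega)
    obtain ⟨m, hm⟩ : ∃ m, m = T' + S := ⟨_, rfl⟩
    rw [← hm] at hw hlast hwork
    have hlast' : m = 0 ∨ w (m - 1) ≠ v := hlast.imp_right fun h => by simp [h]
    rw [show S + r + T' = m + r by omega]
    refine ⟨fun i => if i < m then w i else v, fun i hi he => ?_, Or.inr ?_, ?_⟩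
    · rcases Nat.lt_or_ge i m with hi' | hi'
      · have hr : runLen (fun i => if i < m then w i else v) i = runLen w i :=
          runLen_congr fun j hj => if_pos (by omega)
        rw [hr]
        simp only [hi', if_true] at he ⊢
        refine hw i hi' ?_
        by_cases h7 : i + 1 < m
        · rw [if_pos h7] at he
          exact he.imp_left fun _ => by omega
        · left; omega
      · obtain ⟨k, rfl⟩ := Nat.exists_eq_add_of_le hi'
        rw [runLen_append w hlast' k]
        simp only [show ¬ m + k < m by omega, if_false, show ¬ m + k + 1 < m by omega,
          ne_eq, not_true, or_false] at he ⊢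
        rw [show k + 1 = r by omega]
        exact ⟨h4, h5⟩
    · simp only
      rw [if_neg (by omega)]
    · rw [worked_append, hwork, Bool.not_not, add_mul]
      omega

/-- Here `c` and `T` describe the completed periods of the current type, without the current run,
and `c'` and `T'` those of the other type. The current run is kept apart because its bounds are
known only when it ends. -/
theorem PeriodsFit.exists_fits {w : ℕ → Bool} {n : ℕ} (hw : I.PeriodsFit w n) {i : ℕ}
    (hi : i < n) : ∃ c c' T T' : ℕ, I.Fits (w i) c T ∧ I.Fits (!w i) c' T' ∧ c ≤ c' ∧ c' ≤ c + 1 ∧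
      T + T' + runLen w i = i + 1 ∧
      worked w (i + 1) = (T + runLen w i) * workOf (w i) + T' * workOf (!w i) := by
  induction i with
  | zero => exact ⟨0, 0, 0, 0, fits_zero _, fits_zero _, by simp [runLen, worked]⟩
  | succ i ih =>
    obtain ⟨c, c', T, T', h1, h2, h3, h4, h5, h6⟩ := ih (by omega)
    by_cases h : w (i + 1) = w i
    · refine ⟨c, c', T, T', by rwa [h], by rwa [h], h3, h4, ?_, ?_⟩
      · rw [runLen, if_pos h]; omega
      · rw [worked, h6, runLen, if_pos h, h, ← add_assoc, add_mul (T + runLen w i)]; omega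
    · have hb := hw i (by omega) (Or.inr h)
      have hv : w (i + 1) = !w i := by revert h; cases w (i + 1) <;> cases w i <;> simp
      refine ⟨c', c + 1, T', T + runLen w i, by rwa [hv], ?_, h4, by omega, ?_, ?_⟩
      · rw [hv, Bool.not_not]
        exact h1.succ (runLen_pos w i) hb.1 hb.2
      · rw [runLen, if_neg h]; omega
      · rw [worked, h6, runLen, if_neg h, hv, Bool.not_not, add_mul T' 1, one_mul]; omega

/-- Only the number of periods and the total length of each type matter: the constraints on
individual lengths are independent, and any two counts differing by at most one can alternate. -/
theorem exists_localFeasible_iff : (∃ w, I.LocalFeasible w) ↔ ∃ p q W X : ℕ, W + X = I.D ∧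
    p ≤ q + 1 ∧ q ≤ p + 1 ∧ I.Fits true p W ∧ I.Fits false q X ∧ W ≤ I.Uw ∧ X ≤ I.Uo := by
  constructor
  · rintro ⟨w, hw, h1, h2⟩
    rcases Nat.eq_zero_or_pos I.D with hD | hD
    · exact ⟨0, 0, 0, 0, by omega, by omega, by omega, fits_zero _, fits_zero _, by omega,
        by omega⟩
    obtain ⟨n, hn⟩ : ∃ n, I.D = n + 1 := ⟨I.D - 1, by omega⟩
    obtain ⟨c, c', T, T', h3, h4, h5, h6, h7, h8⟩ :=
      PeriodsFit.exists_fits hw (show n < I.D by omega)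
    have hb := hw n (by omega) (Or.inl hn.symm)
    have h9 := h3.succ (runLen_pos w n) hb.1 hb.2
    rw [hn] at h1 h2 ⊢
    rw [h8] at h1 h2
    cases hv : w n with
    | true =>
      rw [hv] at h1 h2 h4 h9
      simp [workOf] at h1 h2 h4
      exact ⟨c + 1, c', _, T', by omega, by omega, by omega, h9, h4, by omega, by omega⟩
    | false =>
      rw [hv] at h1 h2 h4 h9
      simp [workOf] at h1 h2 h4
      exact ⟨c', c + 1, T', _, by omega, by omega, by omega, h4, h9, by omega, by omega⟩
  · rintro ⟨p, q, W, X, h1, h2, h3, h4, h5, h6, h7⟩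
    rcases le_total q p with h | h
    · obtain ⟨w, hw, -, hk⟩ := exists_periodsFit true p q W X h h2 h4 h5
      rw [h1] at hw hk
      simp [workOf] at hk
      exact ⟨w, hw, by omega, by omega⟩
    · obtain ⟨w, hw, -, hk⟩ := exists_periodsFit false q p X W h h3 h5 h4
      rw [show X + W = I.D by omega] at hw hk
      simp [workOf] at hk
      exact ⟨w, hw, by omega, by omega⟩

/-- Without requests the workers do not interact, so either there are none or one feasible plan can
be given to all. -/
theorem RequestFree.feasible_iff (h : I.RequestFree) :
    I.Feasible ↔ I.N = 0 ∨ ∃ w, I.LocalFeasible w := by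
  constructor
  · rintro ⟨f, -, hf⟩
    rcases Nat.eq_zero_or_pos I.N with hN | hN
    · exact Or.inl hN
    · exact Or.inr ⟨_, (I.planFeasible_iff_extend _).1 (hf ⟨0, hN⟩)⟩
  · intro hw
    have hr : ∀ f : Fin I.N → Fin I.D → Bool, ∀ d,
        I.rl d ≤ (Finset.univ.filter fun i => f i d = true).card ∧
        (Finset.univ.filter fun i => f i d = true).card ≤ I.ru d := by
      intro f d
      rw [(h d).1, (h d).2]
      exact ⟨Nat.zero_le _, (Finset.card_le_univ _).trans_eq (Fintype.card_fin _)⟩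
    rcases hw with hN | ⟨w, hw⟩
    · exact ⟨fun _ _ => true, hr _, fun i => absurd i.2 (by omega)⟩
    · exact ⟨fun _ d => w d, hr _, fun _ => (I.planFeasible_iff w).2 hw⟩

end Instance

end Dodosp


namespace Dodosp

/-! ### Reading an instance -/

namespace Instance

variable (I : Instance)

/-- The numbers that describe an instance. -/
def nums : List ℕ :=
  [I.D, I.N, I.lw, I.uw, I.lo, I.uo, I.Uw, I.Uo] ++
    (List.finRange I.D).flatMap fun d => [I.rl d, I.ru d]

theorem length_nums : I.nums.length = 8 + 2 * I.D := by
  simp [nums]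
  omega

theorem getElem?_flatMap_pair {l : List ℕ} {D : ℕ} (a b : Fin D → ℕ) (d : Fin D) :
    (l ++ (List.finRange D).flatMap fun d => [a d, b d])[l.length + 2 * (d : ℕ)]? = some (a d) ∧
    (l ++ (List.finRange D).flatMap fun d => [a d, b d])[l.length + 1 + 2 * (d : ℕ)]? =
      some (b d) := by
  induction D generalizing l with
  | zero => exact d.elim0
  | succ D ih =>
    rw [List.finRange_succ, List.flatMap_cons, List.flatMap_map, ← List.append_assoc]
    cases d using Fin.cases with
    | zero => simp
    | succ d =>
      have := ih (l := l ++ [a 0, b 0]) (fun i => a i.succ) (fun i => b i.succ) d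
      rw [List.length_append] at this
      simp only [Fin.val_succ]
      rw [show l.length + 2 * ((d : ℕ) + 1) = l.length + [a 0, b 0].length + 2 * (d : ℕ) by
          simp; omega,
        show l.length + 1 + 2 * ((d : ℕ) + 1) = l.length + [a 0, b 0].length + 1 + 2 * (d : ℕ) by
          simp; omega]
      exact this

theorem nums_rl (d : Fin I.D) : I.nums[8 + 2 * (d : ℕ)]? = some (I.rl d) :=
  (getElem?_flatMap_pair I.rl I.ru d).1

theorem nums_ru (d : Fin I.D) : I.nums[9 + 2 * (d : ℕ)]? = some (I.ru d) :=
  (getElem?_flatMap_pair I.rl I.ru d).2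

theorem length_le_length_encodeNats (l : List ℕ) : l.length ≤ (encodeNats l).length := by
  induction l with
  | nil => simp
  | cons a l ih => simp [encodeNats] at ih ⊢; omega

/-- Although D is written in binary, the 2D request bounds make the encoding longer than D. Thus
days are legitimate register values and schedules of single workers have polynomial size. -/
theorem le_length_encode : 8 + 2 * I.D ≤ I.encode.length := by
  rw [← length_nums]
  exact length_le_length_encodeNats _

end Instance

namespace Reading

open Tm

variable {Γ : Type} {R : Reading Γ} {k : ℕ} {w : List Γ} {v : Fin k → ℕ} {I : Instance}

theorem eval_num_nums {rest : List Γ} (hw : w = I.encode.map R.emb ++ rest) (j : Tm Γ k) {a : ℕ}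
    (ha : I.nums[j.eval w v]? = some a) : (R.num j).eval w v = min a w.length := by
  obtain ⟨h, rfl⟩ := List.getElem?_eq_some_iff.1 ha
  exact eval_num hw j h

theorem eval_num_const {rest : List Γ} (hw : w = I.encode.map R.emb ++ rest) (i : ℕ) {a : ℕ}
    (hi : i < 8) (ha : I.nums[i]? = some a) :
    (R.num (const i) : Tm Γ k).eval w v = min a w.length := by
  refine eval_num_nums hw _ ?_
  have := I.le_length_encode
  have hl : I.encode.length ≤ w.length := by simp [hw]
  rw [eval_const, min_eq_left (by omega), ha]

theorem eval_days {rest : List Γ} (hw : w = I.encode.map R.emb ++ rest) :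
    (R.num zero : Tm Γ k).eval w v = I.D := by
  have := I.le_length_encode
  have hl : I.encode.length ≤ w.length := by simp [hw]
  rw [eval_num_nums hw zero (a := I.D) rfl]
  omega

end Reading

/-! ### The algorithm for instances without requests -/

namespace Tm

variable {Γ : Type} {k : ℕ} {w : List Γ} {v : Fin k → ℕ}

/-- The test whether `c` periods with given bounds can fill `T` days. -/
def fits (c T l u : Tm Γ k) : Tm Γ k := and (le c T) (and (le (mul c l) T) (le T (mul c u)))

/-- Truncation at `n` cannot affect a comparison with `T < n`: if `l` exceeds `n` and `c` is
positive, both products are at least `n`. This allows bounds that are too large for a register. -/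
theorem min_mul_min_le {c l n T : ℕ} (hT : T < n) : min (c * min l n) n ≤ T ↔ c * l ≤ T := by
  rcases Nat.eq_zero_or_pos c with rfl | hc
  · simp
  · rcases le_total l n with h | h
    · rw [min_eq_left h]
      omega
    · rw [min_eq_right h]
      have h1 := Nat.le_mul_of_pos_left n hc
      have h2 := Nat.mul_le_mul_left c h
      omega

theorem le_min_mul_min {c u n T : ℕ} (hT : T < n) : T ≤ min (c * min u n) n ↔ T ≤ c * u := by
  rcases Nat.eq_zero_or_pos c with rfl | hc
  · simp
  · rcases le_total u n with h | h
    · rw [min_eq_left h]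
      omega
    · rw [min_eq_right h]
      have h1 := Nat.le_mul_of_pos_left n hc
      have h2 := Nat.mul_le_mul_left c h
      omega

theorem eval_fits {I : Instance} {b : Bool} {c T l u : Tm Γ k} (hT : T.eval w v < w.length)
    (hl : l.eval w v = min (I.lower b) w.length) (hu : u.eval w v = min (I.upper b) w.length) :
    (fits c T l u).eval w v ≠ 0 ↔ I.Fits b (c.eval w v) (T.eval w v) := by
  have hw : 1 ≤ w.length := by omega
  rw [fits, eval_and, eval_and, eval_le' _ _ hw, eval_le' _ _ hw, eval_le' _ _ hw, eval_mul,
    eval_mul, hl, hu, min_mul_min_le hT, le_min_mul_min hT]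
  rfl

end Tm

namespace Reading

open Tm

variable {Γ : Type} {k : ℕ}

/-- The test for given numbers of days worked, off periods and work periods. -/
def runCountTest (R : Reading Γ) : Tm Γ 3 :=
  and (and (le (var 2) (succ (var 1))) (le (var 1) (succ (var 2))))
    (and (and (fits (var 2) (var 0) (R.num (const 2)) (R.num (const 3)))
        (fits (var 1) (sub (R.num zero) (var 0)) (R.num (const 4)) (R.num (const 5))))
      (and (le (var 0) (R.num (const 6))) (le (sub (R.num zero) (var 0)) (R.num (const 7)))))

theorem eval_runCountTest {R : Reading Γ} {w rest : List Γ} {I : Instance}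
    (hw : w = I.encode.map R.emb ++ rest) {p q W : ℕ} (hp : p ≤ I.D) (hq : q ≤ I.D)
    (hW : W ≤ I.D) : R.runCountTest.eval w ![W, q, p] ≠ 0 ↔ (p ≤ q + 1 ∧ q ≤ p + 1) ∧
      (I.Fits true p W ∧ I.Fits false q (I.D - W)) ∧ W ≤ I.Uw ∧ I.D - W ≤ I.Uo := by
  have hD := I.le_length_encode
  have hl : I.encode.length ≤ w.length := by simp [hw]
  have h1 : 1 ≤ w.length := by omega
  have v0 : (var 0 : Tm Γ 3).eval w ![W, q, p] = W := rfl
  have v1 : (var 1 : Tm Γ 3).eval w ![W, q, p] = q := rfl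
  have v2 : (var 2 : Tm Γ 3).eval w ![W, q, p] = p := rfl
  have hX : (sub (R.num zero) (var 0) : Tm Γ 3).eval w ![W, q, p] = I.D - W := by
    rw [eval_sub, eval_days hw, v0]
  have hs : ∀ t : Tm Γ 3, t.eval w ![W, q, p] ≤ I.D →
      (succ t).eval w ![W, q, p] = t.eval w ![W, q, p] + 1 := by
    intro t ht
    simp only [Tm.eval]
    omega
  rw [runCountTest, eval_and, eval_and, eval_and, eval_and, eval_and, eval_le' _ _ h1, eval_le' _ _ h1,
    eval_le' _ _ h1, eval_le' _ _ h1, eval_fits (I := I) (b := true) (by rw [v0]; omega)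
      (eval_num_const hw 2 (by norm_num) rfl) (eval_num_const hw 3 (by norm_num) rfl),
    eval_fits (I := I) (b := false) (by rw [hX]; omega)
      (eval_num_const hw 4 (by norm_num) rfl) (eval_num_const hw 5 (by norm_num) rfl),
    eval_num_const hw 6 (a := I.Uw) (by norm_num) rfl,
    eval_num_const hw 7 (a := I.Uo) (by norm_num) rfl, hX, hs _ (by rwa [v1]), hs _ (by rwa [v2]),
    v0, v1, v2, show W ≤ min I.Uw w.length ↔ W ≤ I.Uw by omega,
    show I.D - W ≤ min I.Uo w.length ↔ I.D - W ≤ I.Uo by omega]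

/-- The decision procedure for instances without requests. -/
def requestFreeTest (R : Reading Γ) : Tm Γ 0 :=
  or (not (R.num (const 1)))
    (ex (succ (R.num zero)) (ex (succ (R.num zero)) (ex (succ (R.num zero)) R.runCountTest)))

theorem eval_requestFreeTest {R : Reading Γ} {w rest : List Γ} {I : Instance}
    (hw : w = I.encode.map R.emb ++ rest) (hI : I.RequestFree) :
    R.requestFreeTest.eval w ![] ≠ 0 ↔ I.Feasible := by
  have hD := I.le_length_encode
  have hl : I.encode.length ≤ w.length := by simp [hw]
  have h1 : 1 ≤ w.length := by omega
  have hs : ∀ {k : ℕ} {v : Fin k → ℕ}, (succ (R.num zero) : Tm Γ k).eval w v = I.D + 1 := by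
    intro k v
    simp only [Tm.eval, eval_days hw]
    omega
  rw [hI.feasible_iff, Instance.exists_localFeasible_iff, requestFreeTest, eval_or,
    eval_not _ h1, eval_num_const hw 1 (by norm_num) (a := I.N) rfl]
  refine or_congr (by omega) ?_
  simp only [eval_ex, hs]
  refine ⟨fun ⟨p, hp, q, hq, W, hW, h⟩ => ?_, fun ⟨p, q, W, X, h2, h3, h4, h5, h6, h7, h8⟩ => ?_⟩
  · obtain ⟨⟨h2, h3⟩, ⟨h4, h5⟩, h6, h7⟩ :=
      (eval_runCountTest hw (by omega) (by omega) (by omega)).1 h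
    exact ⟨p, q, W, I.D - W, by omega, h2, h3, h4, h5, h6, h7⟩
  -- Periods are nonempty, so both counts are at most D and lie within the range of the search.
  · have := h5.1
    have := h6.1
    obtain rfl : X = I.D - W := by omega
    exact ⟨p, by omega, q, by omega, W, by omega,
      (eval_runCountTest hw (by omega) (by omega) (by omega)).2 ⟨⟨h3, h4⟩, ⟨h5, h6⟩, h7, h8⟩⟩

end Reading

/-- The alphabet of the encoded instances. -/
def Reading.id : Reading (Option Bool) where
  emb := _root_.id
  isSep := Option.isNone
  isOne o := o == some true
  isSep_none := rfl
  isSep_some _ := rfl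
  isOne_none := rfl
  isOne_some b := by cases b <;> rfl

theorem inP_requestFree : InP (fun I : {I : Instance // I.RequestFree} => I.1.encode)
    (fun I => I.1.Feasible) :=
  ⟨_, Tm.computableInPolyTime _ Reading.id.requestFreeTest, fun I => by
    rw [decide_eq_true_iff]
    exact (Reading.eval_requestFreeTest (R := Reading.id) (rest := [])
      (by simp [Reading.id]) I.2).symm⟩

end Dodosp


namespace Dodosp

/-! ### Solutions with few different plans -/

/-- The pigeonhole inequality for n = D + 1: the left side counts vectors of D + 1 entries in {0, …,
4n²}, the right side subsets of a set of 4n² plans. -/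
theorem four_sq_lt (n : ℕ) (hn : 1 ≤ n) : (4 * n ^ 2 + 1) ^ n < 2 ^ (4 * n ^ 2) := by
  have h1 : 2 * n + 1 ≤ 2 ^ (2 * n) := Nat.lt_two_pow_self
  have h2 : 4 * n ^ 2 + 1 < 2 ^ (4 * n) := by
    calc 4 * n ^ 2 + 1 < (2 * n + 1) * (2 * n + 1) := by nlinarith
      _ ≤ 2 ^ (2 * n) * 2 ^ (2 * n) := Nat.mul_le_mul h1 h1
      _ = 2 ^ (4 * n) := by rw [← pow_add]; congr 1; ring
  calc (4 * n ^ 2 + 1) ^ n < (2 ^ (4 * n)) ^ n := Nat.pow_lt_pow_left h2 (by omega)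
    _ = 2 ^ (4 * n ^ 2) := by rw [← pow_mul]; congr 1; ring

/-- Two different subsets of a large set of plans with the same size and the same number of
plans working on each day. -/
theorem exists_pair_of_card {D : ℕ} {T : Finset (Fin D → Bool)}
    (hT : T.card = 4 * (D + 1) ^ 2) : ∃ A ⊆ T, ∃ B ⊆ T, A ≠ B ∧ A.card = B.card ∧
      ∀ d, ∑ w ∈ A, workOf (w d) = ∑ w ∈ B, workOf (w d) := by
  have hle : ∀ A ⊆ T, ∀ d, ∑ w ∈ A, workOf (w d) < T.card + 1 := by
    intro A hA d
    have h1 : ∑ w ∈ A, workOf (w d) ≤ ∑ w ∈ A, 1 :=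
      Finset.sum_le_sum fun w _ => workOf_le_one (w d)
    have h2 := Finset.card_le_card hA
    simp at h1
    omega
  -- The key of a subset records its size at `none` and the number of its plans working on day `d`
  -- at `some d`.
  let key : Finset (Fin D → Bool) → Option (Fin D) → ℕ := fun A o =>
    o.elim A.card fun d => ∑ w ∈ A, workOf (w d)
  have hmaps : ∀ A ∈ T.powerset, key A ∈
      Fintype.piFinset fun _ : Option (Fin D) => Finset.range (T.card + 1) := by
    intro A hA
    rw [Finset.mem_powerset] at hA
    rw [Fintype.mem_piFinset]
    rintro (_ | d) <;> rw [Finset.mem_range]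
    · exact Nat.lt_succ_of_le (Finset.card_le_card hA)
    · exact hle A hA d
  obtain ⟨A, hA, B, hB, hne, heq⟩ := Finset.exists_ne_map_eq_of_card_lt_of_maps_to (by
    simpa [Fintype.card_piFinset, hT] using four_sq_lt (D + 1) (by omega)) hmaps
  rw [Finset.mem_powerset] at hA hB
  exact ⟨A, hA, B, hB, hne, congrFun heq none, fun d => congrFun heq (some d)⟩

/-- The support of a vector of multiplicities. -/
def plans {D : ℕ} (m : (Fin D → Bool) → ℕ) : Finset (Fin D → Bool) :=
  Finset.univ.filter fun w => m w ≠ 0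

theorem mem_plans {D : ℕ} {m : (Fin D → Bool) → ℕ} {w : Fin D → Bool} :
    w ∈ plans m ↔ m w ≠ 0 := by
  simp [plans]

theorem sum_exchange {α : Type} [Fintype α] [DecidableEq α] {m m' c : α → ℕ} {A B : Finset α}
    {δ : ℕ} (h : ∀ w, m' w + (if w ∈ A then δ else 0) = m w + if w ∈ B then δ else 0)
    (hc : ∑ w ∈ A, c w = ∑ w ∈ B, c w) : ∑ w, m' w * c w = ∑ w, m w * c w := by
  have h1 : ∑ w, (m' w + (if w ∈ A then δ else 0)) * c w =
      ∑ w, (m w + if w ∈ B then δ else 0) * c w :=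
    Finset.sum_congr rfl fun w _ => by rw [h]
  simp only [add_mul, Finset.sum_add_distrib, ite_mul, zero_mul, Finset.sum_ite_mem,
    Finset.univ_inter, ← Finset.mul_sum, hc] at h1
  omega

/-- Multiplicity is transferred from A to B until a plan of A \ B is used up. Equal sizes preserve
the number of workers, equal daily counts preserve the requests, and no plan outside the old support
is introduced. -/
theorem Instance.IsSolution.exists_smaller {I : Instance} {m : (Fin I.D → Bool) → ℕ}
    (hm : I.IsSolution m) (h : 4 * (I.D + 1) ^ 2 ≤ (plans m).card) :
    ∃ m', I.IsSolution m' ∧ (plans m').card < (plans m).card := by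
  classical
  obtain ⟨T, hTm, hT⟩ := Finset.exists_subset_card_eq h
  obtain ⟨A, hA, B, hB, hne, hcard, hsum⟩ := exists_pair_of_card hT
  -- Otherwise A would be contained in B, and equality of sizes would force A = B.
  have hAB : (A \ B).Nonempty := by
    rw [Finset.sdiff_nonempty]
    intro hs
    exact hne (Finset.eq_of_subset_of_card_le hs hcard.ge)
  obtain ⟨x, hx, hmin⟩ := Finset.exists_min_image (A \ B) m hAB
  rw [Finset.mem_sdiff] at hx
  have hmin' : ∀ w, w ∈ A → w ∉ B → m x ≤ m w := fun w h1 h2 =>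
    hmin w (Finset.mem_sdiff.2 ⟨h1, h2⟩)
  set m' : (Fin I.D → Bool) → ℕ := fun w =>
    (m w + if w ∈ B then m x else 0) - (if w ∈ A then m x else 0) with hm'
  have key : ∀ w, m' w + (if w ∈ A then m x else 0) = m w + if w ∈ B then m x else 0 := by
    intro w
    simp only [hm']
    by_cases h1 : w ∈ A <;> by_cases h2 : w ∈ B <;> simp [h1, h2]
    -- Truncation could only occur on A \ B, where the minimality of `m x` excludes it.
    exact Nat.sub_add_cancel (hmin' w h1 h2)
  have hsupp : ∀ w, m' w ≠ 0 → m w ≠ 0 := by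
    intro w hw h0
    have h1 := key w
    by_cases h2 : w ∈ B
    · exact mem_plans.1 (hTm (hB h2)) h0
    · rw [if_neg h2] at h1
      omega
  refine ⟨m', ⟨fun w hw => hm.plan w (hsupp w hw), ?_, fun d => ?_⟩, ?_⟩
  · have := sum_exchange (c := fun _ => 1) key (by simpa using hcard)
    simpa [hm.total] using this
  · have : onDuty m' d = onDuty m d := sum_exchange key (hsum d)
    rw [this]
    exact hm.request d
  · refine Finset.card_lt_card (Finset.ssubset_iff_of_subset ?_ |>.2 ⟨x, ?_, ?_⟩)
    · intro w hw
      exact mem_plans.2 (hsupp w (mem_plans.1 hw))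
    · exact hTm (hA hx.1)
    · have := key x
      rw [if_pos hx.1, if_neg hx.2] at this
      rw [mem_plans]
      omega

theorem Instance.Feasible.exists_small {I : Instance} (h : I.Feasible) :
    ∃ m, I.IsSolution m ∧ (plans m).card < 4 * (I.D + 1) ^ 2 := by
  obtain ⟨m, hm⟩ := I.feasible_iff_exists_isSolution.1 h
  induction hn : (plans m).card using Nat.strong_induction_on generalizing m with
  | _ n ih =>
    subst hn
    rcases Nat.lt_or_ge (plans m).card (4 * (I.D + 1) ^ 2) with h1 | h1
    · exact ⟨m, hm, h1⟩
    · obtain ⟨m', hm', hlt⟩ := hm.exists_smaller h1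
      exact ih _ hlt m' hm' rfl

end Dodosp


namespace Dodosp

/-! ### The verifier -/

/-- Instances in the alphabet of a verifier. -/
def Reading.inl : Reading (Option Bool ⊕ Bool) where
  emb := Sum.inl
  isSep s := s == Sum.inl none
  isOne s := s == Sum.inl (some true)
  isSep_none := rfl
  isSep_some b := by cases b <;> rfl
  isOne_none := rfl
  isOne_some b := by cases b <;> rfl

/-- The digit at a position of the certificate. -/
def certBit (w : List (Option Bool ⊕ Bool)) (p : ℕ) : Bool := w[p]?.any fun s => s == Sum.inr true

/-- The plan in record `i` of the certificate. -/
def planBit (w : List (Option Bool ⊕ Bool)) (b i d : ℕ) : Bool := certBit w (b * (2 * i + 1) + d)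

/-- The multiplicity in record `i` of the certificate. -/
def multBit (w : List (Option Bool ⊕ Bool)) (b i j : ℕ) : Bool := certBit w (b * (2 * i + 2) + j)

namespace Tm

variable {k : ℕ} {w : List (Option Bool ⊕ Bool)} {v : Fin k → ℕ}

/-- The length of the encoded instance. -/
def blockLen : Tm (Option Bool ⊕ Bool) k := count top (read Sum.isLeft (var 0))

theorem eval_blockLen {x : List (Option Bool)} {y : List Bool}
    (hw : w = x.map Sum.inl ++ y.map Sum.inr) : (blockLen : Tm _ k).eval w v = x.length := by
  rw [blockLen, eval_count _ _ (by simp [Tm.eval]) (fun i => i < x.length)]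
  · have : (Finset.range ((top : Tm (Option Bool ⊕ Bool) k).eval w v)).filter
        (fun i => i < x.length) = Finset.range x.length := by
      ext i
      simp only [Tm.eval, hw, Finset.mem_filter, Finset.mem_range, List.length_append,
        List.length_map]
      omega
    rw [this, Finset.card_range]
  · intro i hi
    simp only [Tm.eval, Matrix.cons_val_zero, hw]
    rcases Nat.lt_or_ge i x.length with h | h
    · simp [List.getElem?_append, h]
    · have h' : ¬ i < x.length := by omega
      simp only [List.getElem?_append, List.length_map, h', if_false, List.getElem?_map, iff_false]
      rcases y[i - x.length]? <;> simp

/-- The digit at position `s` of the plan in record `t`. -/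
def planBit (t s : Tm (Option Bool ⊕ Bool) k) : Tm (Option Bool ⊕ Bool) k :=
  read (fun c => c == Sum.inr true) (add (mul blockLen (succ (add t t))) s)

/-- The digit at position `s` of the multiplicity in record `t`. -/
def multBit (t s : Tm (Option Bool ⊕ Bool) k) : Tm (Option Bool ⊕ Bool) k :=
  read (fun c => c == Sum.inr true) (add (mul blockLen (succ (succ (add t t)))) s)

/-- A saturated position points past the last symbol and is read as 0, just like the true position.
-/
theorem eval_read_min {t : Tm (Option Bool ⊕ Bool) k} {p : ℕ} (ht : t.eval w v = min p w.length) :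
    (read (fun c => c == Sum.inr true) t).eval w v ≠ 0 ↔ certBit w p = true := by
  simp only [Tm.eval, ht, certBit]
  rcases Nat.lt_or_ge p w.length with h | h
  · rw [min_eq_left h.le]
    cases w[p]?.any fun s => s == Sum.inr true <;> simp
  · rw [min_eq_right h, List.getElem?_eq_none h, List.getElem?_eq_none le_rfl]
    simp

variable {x : List (Option Bool)} {y : List Bool}

theorem min_mul_min {a b n : ℕ} (ha : 1 ≤ a) : min (a * min b n) n = min (a * b) n := by
  rcases le_total b n with h | h
  · rw [min_eq_left h]
  · rw [min_eq_right h]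
    have h1 := Nat.le_mul_of_pos_left n ha
    have h2 := Nat.mul_le_mul_left a h
    omega

theorem eval_planBit (hw : w = x.map Sum.inl ++ y.map Sum.inr) (hx : 1 ≤ x.length)
    {t s : Tm (Option Bool ⊕ Bool) k} (ht : t.eval w v ≤ w.length) :
    (planBit t s).eval w v ≠ 0 ↔
      Dodosp.planBit w x.length (t.eval w v) (s.eval w v) = true := by
  rw [planBit, eval_read_min (p := x.length * (2 * t.eval w v + 1) + s.eval w v), Dodosp.planBit]
  have h : (mul blockLen (succ (add t t))).eval w v =
      min (x.length * (2 * t.eval w v + 1)) w.length := by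
    have h' : (succ (add t t)).eval w v = min (2 * t.eval w v + 1) w.length := by
      simp only [Tm.eval, eval_add _ _ ht]
      omega
    rw [eval_mul, eval_blockLen hw, h', min_mul_min hx]
  rw [eval_add _ _ (by rw [h]; exact min_le_right _ _), h]
  omega

theorem eval_multBit (hw : w = x.map Sum.inl ++ y.map Sum.inr) (hx : 1 ≤ x.length)
    {t s : Tm (Option Bool ⊕ Bool) k} (ht : t.eval w v ≤ w.length) :
    (multBit t s).eval w v ≠ 0 ↔
      Dodosp.multBit w x.length (t.eval w v) (s.eval w v) = true := by
  rw [multBit, eval_read_min (p := x.length * (2 * t.eval w v + 2) + s.eval w v), Dodosp.multBit]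
  have h : (mul blockLen (succ (succ (add t t)))).eval w v =
      min (x.length * (2 * t.eval w v + 2)) w.length := by
    have h' : (succ (succ (add t t))).eval w v = min (2 * t.eval w v + 2) w.length := by
      simp only [Tm.eval, eval_add _ _ ht]
      omega
    rw [eval_mul, eval_blockLen hw, h', min_mul_min hx]
  rw [eval_add _ _ (by rw [h]; exact min_le_right _ _), h]
  omega

/-- The position of a day in its period, in the plan of a record. -/
def runLen : Tm (Option Bool ⊕ Bool) 2 :=
  recN (var 0) (const 1)
    (ite (iff (planBit (var 3) (succ (var 1))) (planBit (var 3) (var 1))) (succ (var 0)) (const 1))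

theorem eval_runLen (hw : w = x.map Sum.inl ++ y.map Sum.inr) (hx : 1 ≤ x.length) {d i : ℕ}
    (hd : d < w.length) (hi : i ≤ w.length) :
    runLen.eval w ![d, i] = Dodosp.runLen (Dodosp.planBit w x.length i) d := by
  have h1 : 1 ≤ w.length := by omega
  have key : ∀ m ≤ d, Nat.rec (motive := fun _ => ℕ) ((const 1 : Tm _ 2).eval w ![d, i])
      (fun q acc => (ite (iff (planBit (var 3) (succ (var 1))) (planBit (var 3) (var 1)))
        (succ (var 0)) (const 1) : Tm (Option Bool ⊕ Bool) 4).eval w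
        (Matrix.vecCons acc (Matrix.vecCons q ![d, i]))) m =
      Dodosp.runLen (Dodosp.planBit w x.length i) m := by
    intro m hm
    induction m with
    | zero => simp [eval_const, Dodosp.runLen, h1]
    | succ m ih =>
      dsimp only
      rw [ih (by omega)]
      have e : (iff (planBit (var 3) (succ (var 1))) (planBit (var 3) (var 1)) :
          Tm (Option Bool ⊕ Bool) 4).eval w (Matrix.vecCons
            (Dodosp.runLen (Dodosp.planBit w x.length i) m) (Matrix.vecCons m ![d, i])) ≠ 0 ↔
          Dodosp.planBit w x.length i (m + 1) = Dodosp.planBit w x.length i m := by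
        rw [eval_iff _ _ h1, eval_planBit hw hx (by simpa [Tm.eval] using hi),
          eval_planBit hw hx (by simpa [Tm.eval] using hi), ← Bool.eq_iff_iff]
        simp only [Tm.eval, Matrix.cons_val_one, Matrix.cons_val_zero, Matrix.cons_val]
        rw [min_eq_left (show m + 1 ≤ w.length by omega)]
      have hr := runLen_le (Dodosp.planBit w x.length i) m
      rw [eval_ite, Dodosp.runLen]
      by_cases h : Dodosp.planBit w x.length i (m + 1) = Dodosp.planBit w x.length i m
      · rw [if_pos (e.2 h), if_pos h]
        simp only [Tm.eval, Matrix.cons_val_zero]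
        omega
      · rw [if_neg (mt e.1 h), if_neg h, eval_const]
        omega
  have := key d le_rfl
  simpa [runLen, Tm.eval] using this

/-- The test whether the plan in a record is feasible. -/
def localFeasible : Tm (Option Bool ⊕ Bool) 1 :=
  let D {k : ℕ} : Tm (Option Bool ⊕ Bool) k := Reading.inl.num zero
  let worked : Tm (Option Bool ⊕ Bool) 1 := count D (planBit (var 1) (var 0))
  and
    (all D (imp (or (eq (succ (var 0)) D)
        (not (iff (planBit (var 1) (succ (var 0))) (planBit (var 1) (var 0)))))
      (and
        (le (ite (planBit (var 1) (var 0)) (Reading.inl.num (const 2)) (Reading.inl.num (const 4)))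
          runLen)
        (le runLen (ite (planBit (var 1) (var 0)) (Reading.inl.num (const 3))
          (Reading.inl.num (const 5)))))))
    (and (le worked (Reading.inl.num (const 6))) (le D (add worked (Reading.inl.num (const 7)))))

theorem worked_eq_card (p : ℕ → Bool) (n : ℕ) :
    worked p n = ((Finset.range n).filter fun d => p d = true).card := by
  rw [worked_eq_sum, Finset.card_filter]
  rfl

theorem eval_localFeasible {I : Instance} (hw : w = I.encode.map Sum.inl ++ y.map Sum.inr) {i : ℕ}
    (hi : i ≤ w.length) : localFeasible.eval w ![i] ≠ 0 ↔
      I.LocalFeasible (Dodosp.planBit w I.encode.length i) := by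
  have hD := I.le_length_encode
  have hl : I.encode.length ≤ w.length := by simp [hw]
  have h1 : 1 ≤ w.length := by omega
  have hx : 1 ≤ I.encode.length := by omega
  have hw' : w = I.encode.map Reading.inl.emb ++ y.map Sum.inr := hw
  set p := Dodosp.planBit w I.encode.length i with hp
  have hwk : (count (Reading.inl.num zero) (planBit (var 1) (var 0)) : Tm _ 1).eval w ![i] =
      worked p I.D := by
    rw [eval_count _ _ (by rw [Reading.eval_days hw']; omega) fun d => p d = true,
      Reading.eval_days hw', worked_eq_card]
    intro d _
    exact eval_planBit hw hx hi
  have hle := worked_le_add p 0 I.D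
  have h0 : worked p 0 = 0 := rfl
  rw [zero_add] at hle
  rw [localFeasible, eval_and, eval_all _ _ h1, eval_and, eval_le' _ _ h1, eval_le' _ _ h1,
    eval_add _ _ (by rw [hwk]; omega), hwk, Reading.eval_days hw',
    Reading.eval_num_const hw' 6 (a := I.Uw) (by norm_num) rfl,
    Reading.eval_num_const hw' 7 (a := I.Uo) (by norm_num) rfl, Instance.LocalFeasible]
  refine and_congr (forall₂_congr fun d hd => ?_) (by omega)
  have e0 : ∀ {t : Tm (Option Bool ⊕ Bool) 2}, (planBit (var 1) t).eval w ![d, i] ≠ 0 ↔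
      p (t.eval w ![d, i]) = true := eval_planBit hw hx hi
  have e1 : (succ (var 0) : Tm (Option Bool ⊕ Bool) 2).eval w ![d, i] = d + 1 := by
    simp only [Tm.eval, Matrix.cons_val_zero]
    omega
  have e2 : (var 0 : Tm (Option Bool ⊕ Bool) 2).eval w ![d, i] = d := rfl
  have hr := runLen_le p d
  rw [eval_imp _ _ h1, eval_or, eval_eq' _ _ h1, eval_not _ h1, eval_iff _ _ h1, eval_and,
    eval_le' _ _ h1, eval_le' _ _ h1, eval_runLen hw hx (by omega) hi, eval_ite, eval_ite,
    Reading.eval_days hw',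
    Reading.eval_num_const hw' 2 (a := I.lw) (by norm_num) rfl,
    Reading.eval_num_const hw' 3 (a := I.uw) (by norm_num) rfl,
    Reading.eval_num_const hw' 4 (a := I.lo) (by norm_num) rfl,
    Reading.eval_num_const hw' 5 (a := I.uo) (by norm_num) rfl]
  simp only [e0, e1, e2, ← Bool.eq_iff_iff, Instance.lower, Instance.upper]
  refine imp_congr Iff.rfl ?_
  rw [← hp]
  -- Truncated bounds are harmless because the run length is at most d + 1 ≤ D, which is below |w|.
  split_ifs <;> omega

/-- Comparison of a number, given by digits, with a sum of powers of two, given by their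
multiplicities. -/
def carry (b c : Tm (Option Bool ⊕ Bool) (k + 1)) (u₀ : ℕ) : Tm (Option Bool ⊕ Bool) k :=
  recN blockLen (const u₀) (half (sub (succ (add (var 0) (shift c))) (shift b)))

/-- Digitwise comparison in which only a carry is stored. The carry after J digits is the floor of
(Σ_{j<J} 2^j C_j + 2^J + u₀ - (R mod 2^J) - 1) / 2^J, the summand 2^J keeping the numerator
nonnegative. After all digits it is positive exactly when Σ 2^j C_j + u₀ exceeds R. -/
theorem eval_carry (hw : w = x.map Sum.inl ++ y.map Sum.inr) (hn : 8 ≤ w.length)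
    {b c : Tm (Option Bool ⊕ Bool) (k + 1)} {R u₀ : ℕ} {C : ℕ → ℕ} (hu : u₀ ≤ 1)
    (hR : R < 2 ^ x.length)
    (hb : ∀ j, b.eval w (Matrix.vecCons j v) = if R.testBit j then 1 else 0)
    (hc : ∀ j < x.length, c.eval w (Matrix.vecCons j v) = C j)
    (hC : ∀ j < x.length, C j ≤ w.length / 4) :
    (carry b c u₀).eval w v ≠ 0 ↔ R + 1 ≤ ∑ j ∈ Finset.range x.length, 2 ^ j * C j + u₀ := by
  -- Since C_j ≤ |w| / 4, the carry stays at most |w| / 4 + 1. For |w| ≥ 8 the intermediate sum fits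
  -- into a register, so nothing saturates.
  have key : ∀ J ≤ x.length, ∀ u, u = Nat.rec (motive := fun _ => ℕ)
      ((const u₀ : Tm (Option Bool ⊕ Bool) k).eval w v) (fun q acc =>
        (half (sub (succ (add (var 0) (shift c))) (shift b))).eval w
        (Matrix.vecCons acc (Matrix.vecCons q v))) J → u ≤ w.length / 4 + 1 ∧
      2 ^ J * u + R % 2 ^ J + 1 ≤ ∑ j ∈ Finset.range J, 2 ^ j * C j + 2 ^ J + u₀ ∧
      ∑ j ∈ Finset.range J, 2 ^ j * C j + 2 ^ J + u₀ < 2 ^ J * (u + 1) + R % 2 ^ J + 1 := by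
    intro J hJ
    induction J with
    | zero =>
      rintro u rfl
      simp only [eval_const, pow_zero, Nat.mod_one, Finset.range_zero, Finset.sum_empty,
        Nat.rec_zero]
      omega
    | succ J ih =>
      intro u hu'
      obtain ⟨a, ha⟩ : ∃ a, a = Nat.rec (motive := fun _ => ℕ)
        ((const u₀ : Tm (Option Bool ⊕ Bool) k).eval w v) (fun q acc =>
          (half (sub (succ (add (var 0) (shift c))) (shift b))).eval w
          (Matrix.vecCons acc (Matrix.vecCons q v))) J := ⟨_, rfl⟩
      obtain ⟨h1, h2, h3⟩ := ih (by omega) a ha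
      dsimp only at hu'
      rw [← ha] at hu'
      have hCJ := hC J (by omega)
      have hv : (var 0 : Tm (Option Bool ⊕ Bool) (k + 2)).eval w
        (Matrix.vecCons a (Matrix.vecCons J v)) = a := rfl
      have hadd : (succ (add (var 0) (shift c))).eval w (Matrix.vecCons a (Matrix.vecCons J v)) =
          a + C J + 1 := by
        rw [Tm.eval, eval_add _ _ (by rw [hv]; omega), hv, eval_shift, hc J (by omega)]
        omega
      rw [eval_half _ (by rw [eval_sub, hadd]; omega), eval_sub, hadd, eval_shift, hb] at hu'
      obtain ⟨β, hβ, hβ1⟩ : ∃ β : ℕ, β = (if R.testBit J then 1 else 0) ∧ β ≤ 1 :=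
        ⟨_, rfl, by split_ifs <;> simp⟩
      have hmod : R % 2 ^ (J + 1) = R % 2 ^ J + 2 ^ J * β := by
        rw [pow_succ, Nat.mod_mul, hβ, Nat.testBit_eq_decide_div_mod_eq]
        congr 2
        have := Nat.mod_two_eq_zero_or_one (R / 2 ^ J)
        split_ifs <;> simp_all
      rw [← hβ] at hu'
      rw [Finset.sum_range_succ, hmod, pow_succ]
      have h4 : 2 * u + β ≤ a + C J + 1 := by omega
      have h5 : a + C J + 1 ≤ 2 * u + 1 + β := by omega
      have h6 := Nat.mul_le_mul_left (2 ^ J) h4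
      have h7 := Nat.mul_le_mul_left (2 ^ J) h5
      refine ⟨by omega, ?_, ?_⟩ <;> ring_nf at h2 h3 h6 h7 ⊢ <;> omega
  obtain ⟨-, h2, h3⟩ := key _ le_rfl _ rfl
  have hev : (carry b c u₀).eval w v = Nat.rec (motive := fun _ => ℕ)
      ((const u₀ : Tm (Option Bool ⊕ Bool) k).eval w v) (fun q acc =>
        (half (sub (succ (add (var 0) (shift c))) (shift b))).eval w
        (Matrix.vecCons acc (Matrix.vecCons q v))) x.length := by
    rw [carry, Tm.eval, eval_blockLen hw]
  rw [← hev, Nat.mod_eq_of_lt hR] at h2 h3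
  rcases Nat.eq_zero_or_pos ((carry b c u₀).eval w v) with h | h
  · rw [h] at h3 ⊢
    omega
  · have := Nat.le_mul_of_pos_right (2 ^ x.length) h
    omega

end Tm

end Dodosp


/-! ### Acceptance by the verifier and soundness of certificates -/

namespace Dodosp

/-- Records `i < K`, consisting of a plan `p i` and a multiplicity with the `B` digits `q i`,
describe a feasible schedule. -/
structure Instance.Accepts (I : Instance) (B K : ℕ) (p q : ℕ → ℕ → Bool) : Prop where
  plan : ∀ i < K, (∃ j < B, q i j = true) → I.LocalFeasible (p i)
  request : ∀ d : Fin I.D,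
    I.rl d ≤ ∑ j ∈ Finset.range B,
      2 ^ j * ((Finset.range K).filter fun i => q i j = true ∧ p i d = true).card ∧
    ∑ j ∈ Finset.range B,
      2 ^ j * ((Finset.range K).filter fun i => q i j = true ∧ p i d = true).card ≤ I.ru d
  total : ∑ j ∈ Finset.range B, 2 ^ j * ((Finset.range K).filter fun i => q i j = true).card = I.N

theorem lt_two_pow_of_mem_nums {I : Instance} {i a : ℕ} (h : I.nums[i]? = some a) :
    a < 2 ^ I.encode.length := by
  obtain ⟨hi, rfl⟩ := List.getElem?_eq_some_iff.1 h
  refine (lt_two_pow_encodeNat_length _).trans_le (Nat.pow_le_pow_right (by norm_num) ?_)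
  have : I.encode = encodeNats I.nums := rfl
  rw [this, Reading.encodeNats_split hi]
  simp
  omega

namespace Tm

variable {k : ℕ} {w : List (Option Bool ⊕ Bool)} {v : Fin k → ℕ} {y : List Bool} {I : Instance}

/-- The bound on the number of records. -/
def quarter : Tm (Option Bool ⊕ Bool) k := half (half top)

theorem eval_quarter : (quarter : Tm _ k).eval w v = w.length / 4 := by
  rw [quarter, eval_half, eval_half]
  · simp only [Tm.eval]; omega
  · exact le_rfl
  · rw [eval_half _ le_rfl]
    simp only [Tm.eval]; omega

/-- The test of the number of workers on duty on a day. -/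
def requestTest : Tm (Option Bool ⊕ Bool) 1 :=
  let c : Tm (Option Bool ⊕ Bool) 2 :=
    count quarter (and (multBit (var 0) (var 1)) (planBit (var 0) (var 2)))
  and (carry (Reading.inl.bit (add (const 8) (add (var 1) (var 1))) (var 0)) c 1)
    (not (carry (Reading.inl.bit (add (const 9) (add (var 1) (var 1))) (var 0)) c 0))

/-- The test of the number of workers. -/
def totalTest : Tm (Option Bool ⊕ Bool) 0 :=
  let c : Tm (Option Bool ⊕ Bool) 1 := count quarter (multBit (var 0) (var 1))
  and (carry (Reading.inl.bit (const 1) (var 0)) c 1)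
    (not (carry (Reading.inl.bit (const 1) (var 0)) c 0))

/-- The verifier. -/
def verifier : Tm (Option Bool ⊕ Bool) 0 :=
  and (all quarter (imp (ex blockLen (multBit (var 1) (var 0))) localFeasible))
    (and (all (Reading.inl.num zero) requestTest) totalTest)

theorem eval_bit_const (hw : w = I.encode.map Sum.inl ++ y.map Sum.inr)
    {t r : Tm (Option Bool ⊕ Bool) k} {a : ℕ} (ha : I.nums[t.eval w v]? = some a) :
    (Reading.inl.bit t r).eval w v = if a.testBit (r.eval w v) then 1 else 0 := by
  obtain ⟨h, rfl⟩ := List.getElem?_eq_some_iff.1 ha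
  exact Reading.eval_bit (R := Reading.inl) hw t r h

theorem card_filter_range_le (K : ℕ) (p : ℕ → Prop) [DecidablePred p] :
    ((Finset.range K).filter p).card ≤ K := by
  simpa using Finset.card_filter_le (Finset.range K) p

theorem eval_requestTest (hw : w = I.encode.map Sum.inl ++ y.map Sum.inr) (d : Fin I.D) :
    let S := ∑ j ∈ Finset.range I.encode.length, 2 ^ j *
      ((Finset.range (w.length / 4)).filter fun i =>
        Dodosp.multBit w I.encode.length i j = true ∧
        Dodosp.planBit w I.encode.length i d = true).card
    requestTest.eval w ![d] ≠ 0 ↔ I.rl d ≤ S ∧ S ≤ I.ru d := by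
  intro S
  have hD := I.le_length_encode
  have hl : I.encode.length ≤ w.length := by simp [hw]
  have h1 : 1 ≤ w.length := by omega
  have hx : 1 ≤ I.encode.length := by omega
  have hd := d.2
  have hc : ∀ j, (count quarter (and (multBit (var 0) (var 1)) (planBit (var 0) (var 2))) :
      Tm (Option Bool ⊕ Bool) 2).eval w (Matrix.vecCons j ![d]) =
      ((Finset.range (w.length / 4)).filter fun i =>
        Dodosp.multBit w I.encode.length i j = true ∧
        Dodosp.planBit w I.encode.length i d = true).card := by
    intro j
    rw [eval_count _ _ (by rw [eval_quarter]; omega) (fun i =>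
        Dodosp.multBit w I.encode.length i j = true ∧
        Dodosp.planBit w I.encode.length i d = true), eval_quarter]
    intro i hi
    rw [eval_quarter] at hi
    have hv : (var 0 : Tm (Option Bool ⊕ Bool) 3).eval w
      (Matrix.vecCons i (Matrix.vecCons j ![(d : ℕ)])) ≤ w.length := by
      simp only [Tm.eval, Matrix.cons_val_zero]; omega
    rw [eval_and, eval_multBit hw hx hv, eval_planBit hw hx hv]
    rfl
  have hidx : ∀ c j, c ≤ 9 → (add (const c) (add (var 1) (var 1)) :
      Tm (Option Bool ⊕ Bool) 2).eval w (Matrix.vecCons j ![(d : ℕ)]) =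
      min (c + 2 * (d : ℕ)) w.length := by
    intro c j hc
    rw [eval_add _ _ (by rw [eval_const]; omega), eval_const, eval_add]
    · simp only [Tm.eval, Matrix.cons_val_one, Matrix.cons_val_fin_one]
      omega
    · simp only [Tm.eval, Matrix.cons_val_one, Matrix.cons_val_fin_one]
      omega
  have hb8 : ∀ j, (Reading.inl.bit (add (const 8) (add (var 1) (var 1))) (var 0) :
      Tm (Option Bool ⊕ Bool) 2).eval w (Matrix.vecCons j ![(d : ℕ)]) =
      if (I.rl d).testBit j then 1 else 0 := fun j =>
    eval_bit_const hw (by rw [hidx _ _ (by norm_num), min_eq_left (by omega), I.nums_rl])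
  have hb9 : ∀ j, (Reading.inl.bit (add (const 9) (add (var 1) (var 1))) (var 0) :
      Tm (Option Bool ⊕ Bool) 2).eval w (Matrix.vecCons j ![(d : ℕ)]) =
      if (I.ru d).testBit j then 1 else 0 := fun j =>
    eval_bit_const hw (by rw [hidx _ _ (by norm_num), min_eq_left (by omega), I.nums_ru])
  -- Start value 1 tests `I.rl d ≤ S`; the negated test with start value 0 excludes `I.ru d < S`.
  rw [requestTest, eval_and, eval_not _ h1,
    eval_carry hw (by omega) le_rfl (lt_two_pow_of_mem_nums (I.nums_rl d)) hb8 (fun j _ => hc j)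
      fun j _ => card_filter_range_le _ _,
    eval_carry hw (by omega) zero_le_one (lt_two_pow_of_mem_nums (I.nums_ru d)) hb9
      (fun j _ => hc j) fun j _ => card_filter_range_le _ _]
  omega

theorem eval_totalTest (hw : w = I.encode.map Sum.inl ++ y.map Sum.inr) :
    totalTest.eval w ![] ≠ 0 ↔ ∑ j ∈ Finset.range I.encode.length, 2 ^ j *
      ((Finset.range (w.length / 4)).filter fun i =>
        Dodosp.multBit w I.encode.length i j = true).card = I.N := by
  have hD := I.le_length_encode
  have hl : I.encode.length ≤ w.length := by simp [hw]
  have h1 : 1 ≤ w.length := by omega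
  have hx : 1 ≤ I.encode.length := by omega
  have hc : ∀ j, (count quarter (multBit (var 0) (var 1)) :
      Tm (Option Bool ⊕ Bool) 1).eval w (Matrix.vecCons j ![]) =
      ((Finset.range (w.length / 4)).filter fun i =>
        Dodosp.multBit w I.encode.length i j = true).card := by
    intro j
    rw [eval_count _ _ (by rw [eval_quarter]; omega) (fun i =>
        Dodosp.multBit w I.encode.length i j = true), eval_quarter]
    intro i hi
    rw [eval_quarter] at hi
    exact eval_multBit hw hx (by simp only [Tm.eval, Matrix.cons_val_zero]; omega)
  have hN : I.nums[1]? = some I.N := rfl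
  have hb : ∀ j, (Reading.inl.bit (const 1) (var 0) :
      Tm (Option Bool ⊕ Bool) 1).eval w (Matrix.vecCons j ![]) =
      if I.N.testBit j then 1 else 0 := fun j =>
    eval_bit_const hw (by rw [eval_const, min_eq_left h1, hN])
  rw [totalTest, eval_and, eval_not _ h1,
    eval_carry hw (by omega) le_rfl (lt_two_pow_of_mem_nums hN) hb (fun j _ => hc j)
      fun j _ => card_filter_range_le _ _,
    eval_carry hw (by omega) zero_le_one (lt_two_pow_of_mem_nums hN) hb
      (fun j _ => hc j) fun j _ => card_filter_range_le _ _]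
  omega

theorem eval_verifier (hw : w = I.encode.map Sum.inl ++ y.map Sum.inr) :
    verifier.eval w ![] ≠ 0 ↔ I.Accepts I.encode.length (w.length / 4)
      (Dodosp.planBit w I.encode.length) (Dodosp.multBit w I.encode.length) := by
  have hD := I.le_length_encode
  have hl : I.encode.length ≤ w.length := by simp [hw]
  have h1 : 1 ≤ w.length := by omega
  have hx : 1 ≤ I.encode.length := by omega
  rw [verifier, eval_and, eval_and, eval_all _ _ h1, eval_all _ _ h1, eval_totalTest hw,
    eval_quarter, Reading.eval_days (R := Reading.inl) hw]
  have hp : ∀ i < w.length / 4, (imp (ex blockLen (multBit (var 1) (var 0))) localFeasible).eval w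
      ![i] ≠ 0 ↔ ((∃ j < I.encode.length, Dodosp.multBit w I.encode.length i j = true) →
        I.LocalFeasible (Dodosp.planBit w I.encode.length i)) := by
    intro i hi
    rw [eval_imp _ _ h1, eval_ex, eval_blockLen hw, eval_localFeasible hw (by omega)]
    refine imp_congr (exists_congr fun j => and_congr_right fun _ => ?_) Iff.rfl
    exact eval_multBit hw hx (show i ≤ w.length by omega)
  constructor
  · rintro ⟨h2, h3, h4⟩
    exact ⟨fun i hi => (hp i hi).1 (h2 i hi), fun d => (eval_requestTest hw d).1 (h3 d d.2), h4⟩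
  · rintro ⟨h2, h3, h4⟩
    exact ⟨fun i hi => (hp i hi).2 (h2 i hi),
      fun d hd => (eval_requestTest hw ⟨d, hd⟩).2 (h3 ⟨d, hd⟩), h4⟩

end Tm

/-! ### Certificates -/

/-- The value of `B` binary digits. -/
def ofBits (B : ℕ) (q : ℕ → Bool) : ℕ := ∑ j ∈ Finset.range B, 2 ^ j * workOf (q j)

theorem ofBits_testBit {B n : ℕ} (h : n < 2 ^ B) : ofBits B n.testBit = n := by
  have key : ∀ B, ofBits B n.testBit = n % 2 ^ B := by
    intro B
    induction B with
    | zero => simp [ofBits, Nat.mod_one]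
    | succ B ih =>
      rw [ofBits, Finset.sum_range_succ, ← ofBits, ih, pow_succ, Nat.mod_mul,
        Nat.testBit_eq_decide_div_mod_eq, workOf]
      congr 2
      have := Nat.mod_two_eq_zero_or_one (n / 2 ^ B)
      split_ifs <;> simp_all
  rw [key, Nat.mod_eq_of_lt h]

/-- Counting records digit position by digit position gives the same total as adding multiplicities.
Each count is at most K, so the verifier never has to form a multiplicity. -/
theorem sum_pow_mul_card (B K : ℕ) (q : ℕ → ℕ → Bool) (s : ℕ → Bool) :
    ∑ j ∈ Finset.range B, 2 ^ j *
      ((Finset.range K).filter fun i => q i j = true ∧ s i = true).card =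
    ∑ i ∈ Finset.range K, ofBits B (q i) * workOf (s i) := by
  simp only [ofBits, Finset.card_filter, Finset.mul_sum, Finset.sum_mul]
  rw [Finset.sum_comm]
  refine Finset.sum_congr rfl fun i _ => Finset.sum_congr rfl fun j _ => ?_
  cases q i j <;> cases s i <;> simp [workOf]

theorem sum_pow_mul_card' (B K : ℕ) (q : ℕ → ℕ → Bool) :
    ∑ j ∈ Finset.range B, 2 ^ j * ((Finset.range K).filter fun i => q i j = true).card =
    ∑ i ∈ Finset.range K, ofBits B (q i) := by
  simpa [workOf] using sum_pow_mul_card B K q fun _ => true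

theorem ofBits_ne_zero {B : ℕ} {q : ℕ → Bool} (h : ofBits B q ≠ 0) : ∃ j < B, q j = true := by
  obtain ⟨j, hj, h'⟩ := Finset.exists_ne_zero_of_sum_ne_zero h
  refine ⟨j, Finset.mem_range.1 hj, ?_⟩
  by_contra hq
  simp [workOf, hq] at h'

/-- Different records may carry the same plan, so the multiplicity of a plan is the sum over all
records with this plan. -/
theorem Instance.Accepts.feasible {I : Instance} {B K : ℕ} {p q : ℕ → ℕ → Bool}
    (h : I.Accepts B K p q) : I.Feasible := by
  classical
  have hsum : ∀ c : (Fin I.D → Bool) → ℕ, ∑ u, (∑ i ∈ Finset.range K,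
      if (fun d : Fin I.D => p i d) = u then ofBits B (q i) else 0) * c u =
      ∑ i ∈ Finset.range K, ofBits B (q i) * c fun d => p i d := by
    intro c
    simp only [Finset.sum_mul]
    rw [Finset.sum_comm]
    refine Finset.sum_congr rfl fun i _ => ?_
    simp
  refine I.feasible_iff_exists_isSolution.2 ⟨fun u => ∑ i ∈ Finset.range K,
    if (fun d : Fin I.D => p i d) = u then ofBits B (q i) else 0, fun u hu => ?_, ?_, fun d => ?_⟩
  · obtain ⟨i, hi, h'⟩ := Finset.exists_ne_zero_of_sum_ne_zero hu
    rw [ne_eq, ite_eq_right_iff, Classical.not_imp] at h'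
    obtain ⟨rfl, h'⟩ := h'
    exact (I.planFeasible_iff _).2 (h.plan i (Finset.mem_range.1 hi) (ofBits_ne_zero h'))
  · rw [← h.total, sum_pow_mul_card']
    simpa using hsum fun _ => 1
  · have := h.request d
    rw [sum_pow_mul_card B K q fun i => p i d] at this
    rwa [onDuty, hsum fun u => workOf (u d)]

end Dodosp


/-! ### Completeness of certificates and membership in NP -/

namespace Dodosp

theorem Instance.LocalFeasible.congr {I : Instance} {w w' : ℕ → Bool} (h : I.LocalFeasible w)
    (hw : ∀ d < I.D, w d = w' d) : I.LocalFeasible w' := by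
  obtain ⟨h1, h2⟩ := h
  rw [worked_congr hw] at h2
  refine ⟨fun i hi he => ?_, h2⟩
  rw [← hw i hi, ← runLen_congr fun j hj => hw j (by omega)]
  refine h1 i hi ?_
  by_cases hi' : i + 1 = I.D
  · exact Or.inl hi'
  · rw [hw i hi, hw (i + 1) (by omega)]
    exact he

/-- The certificate with `k` records, consisting of two blocks of `B` digits each. -/
def certificate (B k : ℕ) (p q : ℕ → ℕ → Bool) : List Bool :=
  (List.range (2 * k * B)).map fun s =>
    if s / B % 2 = 0 then p (s / B / 2) (s % B) else q (s / B / 2) (s % B)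

theorem certBit_append (x : List (Option Bool)) (y : List Bool) (s : ℕ) :
    certBit (x.map Sum.inl ++ y.map Sum.inr) (x.length + s) = y[s]?.getD false := by
  rw [certBit, List.getElem?_append_right (by simp), List.length_map, Nat.add_sub_cancel_left,
    List.getElem?_map]
  rcases y[s]? with _ | b
  · rfl
  · cases b <;> rfl

section

variable {x : List (Option Bool)} {k : ℕ} {p q : ℕ → ℕ → Bool}

theorem certificate_getD {B r s : ℕ} (hs : s < B) : (certificate B k p q)[B * r + s]?.getD false =
    if r < 2 * k then (if r % 2 = 0 then p (r / 2) s else q (r / 2) s) else false := by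
  have hd : (B * r + s) / B = r := by
    rw [Nat.mul_add_div (by omega), Nat.div_eq_of_lt hs, add_zero]
  have hm : (B * r + s) % B = s := by rw [Nat.mul_add_mod, Nat.mod_eq_of_lt hs]
  rw [certificate, List.getElem?_map]
  split_ifs with h1
  · have : B * r + s < 2 * k * B := by nlinarith
    rw [List.getElem?_range this]
    simp [*]
  · have : B * r + s < 2 * k * B := by nlinarith
    rw [List.getElem?_range this]
    simp [*]
  · have : 2 * k * B ≤ B * r + s := by nlinarith
    rw [List.getElem?_eq_none (by simpa using this)]
    rfl

/-- The encoded instance is itself block 0, so record `i` occupies blocks 2i + 1 and 2i + 2 of the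
whole input. Records past the end read as zero. -/
theorem planBit_certificate (hp : ∀ i, k ≤ i → ∀ d, p i d = false) (i : ℕ) {d : ℕ}
    (hd : d < x.length) :
    planBit (x.map Sum.inl ++ (certificate x.length k p q).map Sum.inr) x.length i d = p i d := by
  rw [planBit, show x.length * (2 * i + 1) + d = x.length + (x.length * (2 * i) + d) by ring,
    certBit_append, certificate_getD hd]
  split_ifs with h1 h2
  · congr 1; omega
  · omega
  · rw [hp i (by omega)]

theorem multBit_certificate (hq : ∀ i, k ≤ i → ∀ j, q i j = false) (i : ℕ) {j : ℕ}
    (hj : j < x.length) :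
    multBit (x.map Sum.inl ++ (certificate x.length k p q).map Sum.inr) x.length i j = q i j := by
  rw [multBit, show x.length * (2 * i + 2) + j = x.length + (x.length * (2 * i + 1) + j) by ring,
    certBit_append, certificate_getD hj]
  split_ifs with h1 h2
  · omega
  · congr 1; omega
  · rw [hq i (by omega)]

end

theorem Instance.Feasible.exists_certificate {I : Instance} (h : I.Feasible) :
    ∃ y : List Bool, y.length ≤ 8 * I.encode.length ^ 3 ∧
      Tm.verifier.eval (I.encode.map Sum.inl ++ y.map Sum.inr) ![] ≠ 0 := by
  classical
  obtain ⟨m, hm, hk⟩ := h.exists_small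
  have hD := I.le_length_encode
  set B := I.encode.length with hB
  obtain ⟨k, hk'⟩ : ∃ k, k = (plans m).card := ⟨_, rfl⟩
  rw [← hk'] at hk
  obtain ⟨e⟩ : Nonempty (Fin k ≃ plans m) := ⟨(finCongr hk').trans (plans m).equivFin.symm⟩
  set p : ℕ → ℕ → Bool := fun i d => if h : i < k then extend (e ⟨i, h⟩).1 d else false with hp
  set q : ℕ → ℕ → Bool := fun i j => if h : i < k then (m (e ⟨i, h⟩).1).testBit j else false
    with hq
  have hp0 : ∀ i, k ≤ i → ∀ d, p i d = false := fun i hi d => dif_neg (by omega)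
  have hq0 : ∀ i, k ≤ i → ∀ d, q i d = false := fun i hi d => dif_neg (by omega)
  obtain ⟨y, hy⟩ : ∃ y, y = certificate B k p q := ⟨_, rfl⟩
  have hylen : y.length = 2 * k * B := by simp [hy, certificate]
  -- A multiplicity is at most N, whose digits belong to the encoding, so it fits into one block.
  have hmB : ∀ u, m u < 2 ^ B := by
    intro u
    have h1 : m u ≤ I.N := by
      rw [← hm.total]
      exact Finset.single_le_sum (f := m) (fun _ _ => Nat.zero_le _) (Finset.mem_univ u)
    exact h1.trans_lt (lt_two_pow_of_mem_nums (I := I) (i := 1) rfl)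
  have hsum : ∀ (K : ℕ) (c : (Fin I.D → Bool) → ℕ) (c' : ℕ → ℕ), k ≤ K →
      (∀ i (hi : i < k), c' i = c (e ⟨i, hi⟩).1) →
      ∑ i ∈ Finset.range K, ofBits B (q i) * c' i = ∑ u, m u * c u := by
    intro K c c' hK hc
    have h1 : ∑ i ∈ Finset.range K, ofBits B (q i) * c' i =
        ∑ i ∈ Finset.range k, ofBits B (q i) * c' i := by
      symm
      refine Finset.sum_subset (Finset.range_subset_range.2 hK) fun i _ hi => ?_
      rw [Finset.mem_range, not_lt] at hi
      simp [ofBits, hq0 i hi, workOf]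
    rw [h1, Finset.sum_range]
    have h2 : ∀ i : Fin k, ofBits B (q i) * c' i = m (e i).1 * c (e i).1 := by
      intro i
      rw [hc i i.2]
      congr 1
      have : q i = (m (e i).1).testBit := by
        funext j
        exact dif_pos i.2
      rw [this, ofBits_testBit (hmB _)]
    simp only [h2]
    rw [e.sum_comp fun u : plans m => m u.1 * c u.1,
      Finset.sum_coe_sort (plans m) fun u => m u * c u]
    refine Finset.sum_subset (Finset.subset_univ _) fun u _ hu => ?_
    rw [mem_plans, not_not] at hu
    rw [hu, zero_mul]
  refine ⟨y, ?_, (Tm.eval_verifier rfl).2 ?_⟩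
  · rw [hylen]
    have h1 : I.D + 1 ≤ B := by omega
    have h2 := Nat.pow_le_pow_left h1 2
    have h3 : k ≤ 4 * B ^ 2 := by omega
    calc 2 * k * B ≤ 2 * (4 * B ^ 2) * B := by gcongr
      _ = 8 * B ^ 3 := by ring
  · have hplan : ∀ i d, d < B → planBit (I.encode.map Sum.inl ++ y.map Sum.inr) B i d = p i d :=
      fun i d hd => hy ▸ planBit_certificate hp0 i hd
    have hmult : ∀ i j, j < B → multBit (I.encode.map Sum.inl ++ y.map Sum.inr) B i j = q i j :=
      fun i j hj => hy ▸ multBit_certificate hq0 i hj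
    -- Two blocks of at least 8 symbols per record ensure that a quarter of the input length covers
    -- all records.
    have hK : k ≤ (I.encode.map Sum.inl ++ y.map Sum.inr).length / 4 := by
      simp only [List.length_append, List.length_map, hylen]
      have := Nat.mul_le_mul_left (2 * k) (show 8 ≤ B by omega)
      omega
    refine ⟨fun i _ ⟨j, hj, hij⟩ => ?_, fun d => ?_, ?_⟩
    · rw [hmult i j hj] at hij
      by_cases hi : i < k
      · have h1 := mem_plans.1 (e ⟨i, hi⟩).2
        refine ((I.planFeasible_iff_extend _).1 (hm.plan _ h1)).congr fun d hd => ?_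
        rw [hplan i d (by omega)]
        simp [hp, hi]
      · rw [hq0 i (by omega)] at hij
        exact absurd hij (by simp)
    · have hd := d.2
      have h1 : ∀ K, k ≤ K → ∑ j ∈ Finset.range B, 2 ^ j * ((Finset.range K).filter fun i =>
          multBit (I.encode.map Sum.inl ++ y.map Sum.inr) B i j = true ∧
          planBit (I.encode.map Sum.inl ++ y.map Sum.inr) B i d = true).card = onDuty m d := by
        intro K hK
        have h2 : ∀ j ∈ Finset.range B, 2 ^ j * ((Finset.range K).filter fun i =>
            multBit (I.encode.map Sum.inl ++ y.map Sum.inr) B i j = true ∧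
            planBit (I.encode.map Sum.inl ++ y.map Sum.inr) B i d = true).card =
            2 ^ j * ((Finset.range K).filter fun i => q i j = true ∧ p i d = true).card := by
          intro j hj
          simp only [hmult _ _ (Finset.mem_range.1 hj), hplan _ _ (show (d : ℕ) < B by omega)]
        rw [Finset.sum_congr rfl h2, sum_pow_mul_card B K q fun i => p i d]
        refine hsum K (fun u => workOf (u d)) (fun i => workOf (p i d)) hK fun i hi => ?_
        simp [hp, hi, extend]
      rw [h1 _ hK]
      exact hm.request d
    · have h1 : ∀ K, k ≤ K → ∑ j ∈ Finset.range B, 2 ^ j * ((Finset.range K).filter fun i =>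
          multBit (I.encode.map Sum.inl ++ y.map Sum.inr) B i j = true).card = I.N := by
        intro K hK
        have h2 : ∀ j ∈ Finset.range B, 2 ^ j * ((Finset.range K).filter fun i =>
            multBit (I.encode.map Sum.inl ++ y.map Sum.inr) B i j = true).card =
            2 ^ j * ((Finset.range K).filter fun i => q i j = true).card := by
          intro j hj
          simp only [hmult _ _ (Finset.mem_range.1 hj)]
        rw [Finset.sum_congr rfl h2, sum_pow_mul_card', ← hm.total]
        simpa using hsum K (fun _ => 1) (fun _ => 1) hK fun _ _ => rfl
      exact h1 _ hK

theorem inNP : InNP Instance.encode Instance.Feasible := by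
  refine ⟨8 * Polynomial.X ^ 3, _, Tm.computableInPolyTime _ Tm.verifier, fun I => ?_⟩
  simp only [decide_eq_true_iff]
  constructor
  · intro h
    obtain ⟨y, hy, hv⟩ := h.exists_certificate
    exact ⟨y, by simpa using hy, hv⟩
  · rintro ⟨y, -, hv⟩
    exact ((Tm.eval_verifier rfl).1 hv).feasible

end Dodosp


namespace Dodosp

/-! ### The length of the encoding -/

theorem length_encodeNats_le (l : List ℕ) :
    (encodeNats l).length ≤ (l.map fun a => Nat.log 2 a + 2).sum := by
  induction l with
  | nil => simp [encodeNats]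
  | cons a l ih =>
    have := encodeNat_length_le a
    simp [encodeNats] at ih ⊢
    omega

namespace Instance

variable {I : Instance}

theorem sum_log_requests_le (I : Instance) :
    (((List.finRange I.D).flatMap fun d => [I.rl d, I.ru d]).map fun a => Nat.log 2 a + 2).sum ≤
      2 * I.D * (Nat.log 2 I.N + 2) := by
  have h := List.sum_le_card_nsmul
    (((List.finRange I.D).flatMap fun d => [I.rl d, I.ru d]).map fun a => Nat.log 2 a + 2)
    (Nat.log 2 I.N + 2) (by
      intro b hb
      simp only [List.mem_map, List.mem_flatMap, List.mem_finRange, true_and, List.mem_cons,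
        List.not_mem_nil, or_false] at hb
      obtain ⟨a, ⟨d, hd⟩, rfl⟩ := hb
      have h1 := I.rl_le_ru d
      have h2 := I.ru_le_N d
      exact Nat.add_le_add_right (Nat.log_mono_right (by omega)) 2)
  refine h.trans_eq ?_
  simp [mul_comm]

theorem length_encode_le (h₁ : I.lw ≤ I.D) (h₂ : I.uw ≤ I.D) (h₃ : I.lo ≤ I.D) (h₄ : I.uo ≤ I.D)
    (h₅ : I.Uw ≤ I.D) (h₆ : I.Uo ≤ I.D) :
    I.encode.length ≤ 18 * ((I.D + 1) * (Nat.log 2 I.N + 1)) := by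
  have h : I.encode.length ≤ _ := length_encodeNats_le I.nums
  have hr := I.sum_log_requests_le
  have hlog : ∀ a ≤ I.D, Nat.log 2 a ≤ I.D := fun a ha => (Nat.log_le_self 2 a).trans ha
  have e0 := hlog _ le_rfl
  have e1 := hlog _ h₁
  have e2 := hlog _ h₂
  have e3 := hlog _ h₃
  have e4 := hlog _ h₄
  have e5 := hlog _ h₅
  have e6 := hlog _ h₆
  rw [nums, List.map_append, List.sum_append] at h
  simp only [List.map_cons, List.map_nil, List.sum_cons, List.sum_nil] at h
  generalize Nat.log 2 I.N = n at *
  -- Seven numbers are at most D and the remaining 2D + 1 are at most N, giving at most 7(D + 2) +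
  -- (2D + 1)(n + 2) symbols.
  nlinarith [Nat.zero_le (I.D * n)]

/-- An instance with `2 ^ (n + 1)` workers and no requests. -/
def large (D n : ℕ) : Instance where
  D := D
  N := 2 ^ (n + 1)
  lw := 1
  uw := D
  lo := 1
  uo := D
  Uw := D
  Uo := D
  rl _ := 0
  ru _ := 2 ^ (n + 1)
  rl_le_ru _ := Nat.zero_le _
  ru_le_N _ := le_rfl

theorem feasible_large (D n : ℕ) : (large D n).Feasible := by
  have hI : (large D n).RequestFree := fun _ => ⟨rfl, rfl⟩
  refine hI.feasible_iff.2 (Or.inr ⟨fun _ => true, fun i hi _ => ⟨runLen_pos _ i, ?_⟩, ?_, ?_⟩)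
  · exact (runLen_le _ i).trans hi
  · have h := (worked_le_add (fun _ => true) 0 D).2
    rw [zero_add] at h
    exact h.trans_eq (Nat.zero_add D)
  · exact Nat.le_add_left _ _

theorem two_pow_length_encode_large_le {D : ℕ} (hD : 1 ≤ D) (n : ℕ) :
    2 ^ (large D n).encode.length ≤ ((large D n).N * (large D n).D) ^ (36 * (D + 1)) := by
  have h : (large D n).encode.length ≤ 18 * ((D + 1) * (Nat.log 2 (2 ^ (n + 1)) + 1)) :=
    length_encode_le hD le_rfl hD le_rfl le_rfl le_rfl
  rw [Nat.log_pow (by norm_num)] at h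
  calc 2 ^ (large D n).encode.length ≤ 2 ^ ((n + 1) * (36 * (D + 1))) :=
        -- The length is at most 18(D + 1)(n + 2), and n + 2 ≤ 2(n + 1) accounts for the factor 36.
        Nat.pow_le_pow_right (by norm_num) (by nlinarith)
    _ = (2 ^ (n + 1)) ^ (36 * (D + 1)) := by rw [pow_mul]
    _ ≤ (2 ^ (n + 1) * D) ^ (36 * (D + 1)) :=
        Nat.pow_le_pow_left (Nat.le_mul_of_pos_right _ hD) _

theorem le_length_encode_large (D n : ℕ) : n ≤ (large D n).encode.length := by
  have h : 2 ^ (n + 1) < 2 ^ (large D n).encode.length :=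
    lt_two_pow_of_mem_nums (I := large D n) (i := 1) rfl
  have := (Nat.pow_lt_pow_iff_right (by norm_num)).1 h
  omega

end Instance

end Dodosp

theorem mainTheorem9 :
    -- the problem is in NP
    Dodosp.InNP Dodosp.Instance.encode Dodosp.Instance.Feasible ∧
    -- instances take `O(D log N)` bits, provided that the bounds on periods and totals
    -- are at most `D`
    (∃ C : ℕ, ∀ I : Dodosp.Instance,
      I.lw ≤ I.D → I.uw ≤ I.D → I.lo ≤ I.D → I.uo ≤ I.D → I.Uw ≤ I.D → I.Uo ≤ I.D →
      I.encode.length ≤ C * ((I.D + 1) * (Nat.log 2 I.N + 1))) ∧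
    -- the `N * D` bits of a schedule are exponential in the length of the encoding, for
    -- every fixed number of days
    (∀ D : ℕ, 1 ≤ D → ∃ c : ℕ, ∀ n : ℕ, ∃ I : Dodosp.Instance,
      I.D = D ∧ I.Feasible ∧ n ≤ I.encode.length ∧
      2 ^ I.encode.length ≤ (I.N * I.D) ^ c) ∧
    -- the network has size `O(D ^ 3)`
    (∃ C : ℕ, ∀ I : Dodosp.Instance, 1 ≤ I.D →
      I.vertices.card ≤ C * I.D ^ 3 ∧ I.edges.card ≤ C * I.D ^ 3) ∧
    -- integral flows of value `N` that meet the requests certify feasibility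
    (∀ I : Dodosp.Instance, 1 ≤ I.D →
      ((I.Feasible ↔ ∃ f : Dodosp.Vertex → Dodosp.Vertex → ℕ, I.IsCertificate f) ∧
        ∀ f : Dodosp.Vertex → Dodosp.Vertex → ℕ, I.IsCertificate f → ∀ u v, f u v ≤ I.N)) ∧
    -- the problem without requests is decidable in polynomial time, and there feasibility
    -- is the existence of an integral flow of value `N`
    (Dodosp.InP (fun I : {I : Dodosp.Instance // I.RequestFree} => I.1.encode)
        (fun I => I.1.Feasible) ∧
      ∀ I : Dodosp.Instance, I.RequestFree → 1 ≤ I.D →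
        (I.Feasible ↔ ∃ f : Dodosp.Vertex → Dodosp.Vertex → ℕ, I.IsFlow f I.N)) := by
  refine ⟨Dodosp.inNP, ⟨18, fun I => Dodosp.Instance.length_encode_le⟩, fun D hD =>
      ⟨36 * (D + 1), fun n => ⟨Dodosp.Instance.large D n, rfl, Dodosp.Instance.feasible_large D n,
        Dodosp.Instance.le_length_encode_large D n,
        Dodosp.Instance.two_pow_length_encode_large_le hD n⟩⟩,
    ⟨18, fun I hD => ⟨?_, Dodosp.Instance.card_edges_le hD⟩⟩,
    fun I hD => ⟨Dodosp.Instance.feasible_iff_exists_isCertificate hD,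
      fun f hf => hf.1.le hD⟩, Dodosp.inP_requestFree,
    fun I hI hD => Dodosp.Instance.RequestFree.feasible_iff_exists_isFlow hI hD⟩
  exact (Dodosp.Instance.card_vertices_le hD).trans (Nat.mul_le_mul_right _ (by norm_num))
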